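/- For a real number $\psi$ and a complex number $\tau$ let $\Gamma(\psi,\tau)\subset \mathrm{SL}(3,\mathbb{C})$ be the group generated by $$J=\begin{pmatrix}0&0&1\\1&0&0\\0&1&0\end{pmatrix},\qquad R_1=\begin{pmatrix}e^{2i\psi/3}&\tau&-e^{i\psi/3}\overline{\tau}\\0&e^{-i\psi/3}&0\\0&0&e^{-i\psi/3}\end{pmatrix}.$$ These matrices preserve the Hermitian form $\langle z,w\rangle=w^*H_\tau z$ with $$H_\tau=\begin{pmatrix}2\sin(\psi/2)&-ie^{-i\psi/6}\tau&ie^{i\psi/6}\overline{\tau}\\ ie^{i\psi/6}\overline{\tau}&2\sin(\psi/2)&-ie^{-i\psi/6}\tau\\ -ie^{-i\psi/6}\tau&ie^{i\psi/6}\overline{\tau}&2\sin(\psi/2)\end{pmatrix},$$ and $\Gamma(\psi,\tau)$ is called hyperbolic if $H_\tau$ has signature $(2,1)$. The 18 sporadic values of $\tau$ are the numbers $\sigma_1,\dots,\sigma_9$ and their complex conjugates, where $$\begin{array}{lll} \sigma_1=e^{i\pi/3}+2e^{-i\pi/6}\cos\frac{\pi}{4},&\sigma_2=e^{i\pi/3}+2e^{-i\pi/6}\cos\frac{\pi}{5},&\sigma_3=e^{i\pi/3}+2e^{-i\pi/6}\cos\frac{2\pi}{5},\\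 \sigma_4=e^{2\pi i/7}+e^{4\pi i/7}+e^{8\pi i/7},&\sigma_5=e^{2\pi i/9}+2e^{-i\pi/9}\cos\frac{2\pi}{5},&\sigma_6=e^{2\pi i/9}+2e^{-i\pi/9}\cos\frac{4\pi}{5},\\ \sigma_7=e^{2\pi i/9}+2e^{-i\pi/9}\cos\frac{2\pi}{7},&\sigma_8=e^{2\pi i/9}+2e^{-i\pi/9}\cos\frac{4\pi}{7},&\sigma_9=e^{2\pi i/9}+2e^{-i\pi/9}\cos\frac{6\pi}{7}. \end{array}$$ Let $p\ge 2$ denote an integer. Then only finitely many of the sporadic triangle groups are discrete: there are only finitely many pairs $(p,\tau)$ with $p\ge 2$ and $\tau$ a sporadic value such that $\Gamma(\frac{2\pi}{p},\tau)$ is hyperbolic and discrete. More precisely: - for $p\ge 7$, $\Gamma(\frac{2\pi}{p},\sigma_1)$ is not discrete; - for $p=3,5,6,7$, $\Gamma(\frac{2\pi}{p},\overline{\sigma}_1)$ is not discrete; - for $p\ge 6$, $\Gamma(\frac{2\pi}{p},\sigma_2)$ is not discrete; - for $6\le p\le 19$, $\Gamma(\frac{2\pi}{p},\overline{\sigma}_2)$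 is not discrete; - for $p=4,5,6$, $\Gamma(\frac{2\pi}{p},\sigma_4)$ is not discrete; - for $p\neq 2,3,4,5,6,8,12$, $\Gamma(\frac{2\pi}{p},\overline{\sigma}_4)$ is not discrete; - for $p\neq 2,3,4,5,6,8,12$, $\Gamma(\frac{2\pi}{p},\sigma_5)$ is not discrete; - $\Gamma(\frac{2\pi}{4},\overline{\sigma}_5)$ is not discrete; - $\Gamma(\frac{2\pi}{5},\sigma_6)$ and $\Gamma(\frac{2\pi}{5},\overline{\sigma}_6)$ are not discrete; - for $p\neq 2,3,4,7,14$, $\Gamma(\frac{2\pi}{p},\sigma_7)$ is not discrete. -/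

import Mathlib

open scoped ComplexConjugate Matrix

/-- The matrix of the order three elliptic element `J`. -/
def matJ : Matrix (Fin 3) (Fin 3) ℂ := !![0, 0, 1; 1, 0, 0; 0, 1, 0]

/-- The matrix of the complex reflection `R₁` with rotation angle `ψ`. -/
noncomputable def matR₁ (ψ : ℝ) (τ : ℂ) : Matrix (Fin 3) (Fin 3) ℂ :=
  !![Complex.exp (2 * Complex.I * ψ / 3), τ, -(Complex.exp (Complex.I * ψ / 3) * conj τ);
     0, Complex.exp (-(Complex.I * ψ / 3)), 0;
     0, 0, Complex.exp (-(Complex.I * ψ / 3))]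

theorem det_matJ : matJ.det = 1 := by
  simp [matJ, Matrix.det_fin_three]

theorem det_matR₁ (ψ : ℝ) (τ : ℂ) : (matR₁ ψ τ).det = 1 := by
  simp only [matR₁, Matrix.det_fin_three, Matrix.of_apply, Matrix.cons_val]
  simp only [mul_zero, zero_mul, sub_zero, add_zero, ← Complex.exp_add]
  rw [← Complex.exp_zero]
  congr 1
  ring

/-- `J` as an element of `SL(3, ℂ)`. -/
def elemJ : Matrix.SpecialLinearGroup (Fin 3) ℂ := ⟨matJ, det_matJ⟩

/-- `R₁` as an element of `SL(3, ℂ)`. -/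
noncomputable def elemR₁ (ψ : ℝ) (τ : ℂ) : Matrix.SpecialLinearGroup (Fin 3) ℂ :=
  ⟨matR₁ ψ τ, det_matR₁ ψ τ⟩

/-- The symmetric triangle group `Γ(ψ, τ)`, generated by `R₁` and `J`. -/
noncomputable def triangleGroup (ψ : ℝ) (τ : ℂ) :
    Subgroup (Matrix.SpecialLinearGroup (Fin 3) ℂ) :=
  Subgroup.closure {elemR₁ ψ τ, elemJ}

/-- The Hermitian matrix `H_τ` of the form `⟨z, w⟩ = w* H_τ z` preserved by `Γ(ψ, τ)`. -/
noncomputable def formH (ψ : ℝ) (τ : ℂ) : Matrix (Fin 3) (Fin 3) ℂ :=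
  let d : ℂ := 2 * Complex.sin (ψ / 2)
  let a : ℂ := -(Complex.I * Complex.exp (-(Complex.I * ψ / 6)) * τ)
  let b : ℂ := Complex.I * Complex.exp (Complex.I * ψ / 6) * conj τ
  !![d, a, b; b, d, a; a, b, d]

/-- A `3 × 3` matrix is the matrix of a Hermitian form of signature `(2, 1)`: some invertible
linear change of coordinates turns it into `-v₀ w̄₀ + v₁ w̄₁ + v₂ w̄₂`. -/
def HasSignatureTwoOne (H : Matrix (Fin 3) (Fin 3) ℂ) : Prop :=
  ∃ P : Matrix (Fin 3) (Fin 3) ℂ, IsUnit P ∧ Pᴴ * H * P = Matrix.diagonal ![-1, 1, 1]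

/-- `Γ(ψ, τ)` is hyperbolic when `H_τ` has signature `(2, 1)`. -/
def IsHyperbolicTriangleGroup (ψ : ℝ) (τ : ℂ) : Prop :=
  HasSignatureTwoOne (formH ψ τ)

/-- Discreteness of a group of matrices, for the topology of the entries. -/
def IsDiscreteGroup (Γ : Subgroup (Matrix.SpecialLinearGroup (Fin 3) ℂ)) : Prop :=
  DiscreteTopology Γ

/-- `e^{iθ}` for a real angle `θ`. -/
noncomputable def expI (θ : ℝ) : ℂ := Complex.exp (θ * Complex.I)

noncomputable def σ₁ : ℂ := expI (Real.pi / 3) + expI (-Real.pi / 6) * (2 * Real.cos (Real.pi / 4))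

noncomputable def σ₂ : ℂ := expI (Real.pi / 3) + expI (-Real.pi / 6) * (2 * Real.cos (Real.pi / 5))

noncomputable def σ₃ : ℂ :=
  expI (Real.pi / 3) + expI (-Real.pi / 6) * (2 * Real.cos (2 * Real.pi / 5))

noncomputable def σ₄ : ℂ :=
  expI (2 * Real.pi / 7) + expI (4 * Real.pi / 7) + expI (8 * Real.pi / 7)

noncomputable def σ₅ : ℂ :=
  expI (2 * Real.pi / 9) + expI (-Real.pi / 9) * (2 * Real.cos (2 * Real.pi / 5))

noncomputable def σ₆ : ℂ :=
  expI (2 * Real.pi / 9) + expI (-Real.pi / 9) * (2 * Real.cos (4 * Real.pi / 5))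

noncomputable def σ₇ : ℂ :=
  expI (2 * Real.pi / 9) + expI (-Real.pi / 9) * (2 * Real.cos (2 * Real.pi / 7))

noncomputable def σ₈ : ℂ :=
  expI (2 * Real.pi / 9) + expI (-Real.pi / 9) * (2 * Real.cos (4 * Real.pi / 7))

noncomputable def σ₉ : ℂ :=
  expI (2 * Real.pi / 9) + expI (-Real.pi / 9) * (2 * Real.cos (6 * Real.pi / 7))

/-- The eighteen sporadic values: `σ₁, …, σ₉` and their complex conjugates. -/
noncomputable def sporadicValues : Set ℂ :=
  {τ | τ ∈ ({σ₁, σ₂, σ₃, σ₄, σ₅, σ₆, σ₇, σ₈, σ₉} : Set ℂ) ∨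
    conj τ ∈ ({σ₁, σ₂, σ₃, σ₄, σ₅, σ₆, σ₇, σ₈, σ₉} : Set ℂ)}

/-!
# Discreteness of the sporadic triangle groups

The group `Γ(ψ, τ)` contains, up to scalars of modulus one, complex reflections of the Hermitian
form `formH ψ τ`: the generator `R₁` and its conjugates `R₂`, `R₃` by `J`, with normal vectors the
basis vectors `e₁`, `e₂`, `e₃`. Moreover, for all the sporadic `τ` the product `R₁ R₂` has a power
which is a scalar on the span of `e₁` and `e₂`. It is then a complex reflection whose normal vector
`c` is orthogonal to `e₁` and `e₂` (`projMem_crefl_polarVec`), called a line reflection below.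

Nondiscreteness comes from a reflection `A` of normal vector `a` and multiplier `μ`, and an isometry
`T` of the form in the group, through the numbers `s = |μ - 1|²` and
`X = |⟨a, T a⟩|² / ⟨a, a⟩²`.

* If `s ≤ 1`, `s X < 1` and `X ≠ 0, 1`, the reflections `B₀ = T A T⁻¹`, `Bₙ₊₁ = Bₙ A Bₙ⁻¹` are
  all different from `A` and converge to it, so the group is not discrete
  (`not_discrete_of_jorgensen`).
* If `0 < s X < 4` and `X ≠ 1`, the product `A T A T⁻¹` is diagonalizable, with two eigenvalues of
  ratio `e^{2iθ}`, where `2 cos θ = 2 - s X`. In a discrete group such an element has finite order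
  (`not_discrete_of_irrational_angle`). If the order were finite, `2 - 2 cos θ` and all its Galois
  conjugates would lie in `[0, 4]`; so one conjugate of `s X` greater than `4` suffices
  (`GalConj.add_inv_ne`).

For the basis reflections, `s X = |⟨e₁, v⟩|²`, where `v` is a vector in the orbit of `e₁`, and for
the line reflections and `T = J`, `X` is `lineInv`. These are explicit functions of `cos ψ`, `sin ψ`,
`|τ|²`, `Re τ³` and `Im τ³`, and the last three have simple values for the sporadic `τ` (`HasParams`).
The inequalities are checked on decimal approximations of cosines, with rigorous error bounds
(`Near`), or, for infinite families of `p`, by monotonicity in the angle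
(`not_discrete_of_line_family`).

For the finiteness, let `ψ = 2π / p` with `p` large. Then `det (formH ψ τ)` has the sign of
`-Im τ³`, because the other terms are of order `ψ²`, and `Im τ³ ≠ 0` for every sporadic `τ`. If
`Im τ³ < 0`, the determinant is positive and the signature is not `(2, 1)`
(`eventually_not_hyperbolic`). If `Im τ³ > 0`, then `lineInv > 1`, and `lineInv` tends to `1`, while
the order of the line reflections is at least `p / 8`; so `s X` tends to `0` and the first criterion
applies (`eventually_not_discrete`).
-/

/-! ### Complex reflections of a Hermitian form -/

/-- The sesquilinear form `⟨x, y⟩ = x* H y`, conjugate linear in the first variable. -/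
noncomputable def sesq (H : Matrix (Fin 3) (Fin 3) ℂ) (x y : Fin 3 → ℂ) : ℂ :=
  star x ⬝ᵥ (H *ᵥ y)

/-- The complex reflection with multiplier `μ` in the vector `v`: it multiplies `v` by `μ` and
fixes the orthogonal complement of `v`. -/
noncomputable def crefl (H : Matrix (Fin 3) (Fin 3) ℂ) (v : Fin 3 → ℂ) (μ : ℂ) :
    Matrix (Fin 3) (Fin 3) ℂ :=
  1 + ((μ - 1) / sesq H v v) • Matrix.vecMulVec v (star v ᵥ* H)

section Form

variable {H : Matrix (Fin 3) (Fin 3) ℂ}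

theorem sesq_add_right (x y z : Fin 3 → ℂ) : sesq H x (y + z) = sesq H x y + sesq H x z := by
  simp [sesq, Matrix.mulVec_add]

theorem sesq_smul_right (c : ℂ) (x y : Fin 3 → ℂ) : sesq H x (c • y) = c * sesq H x y := by
  simp [sesq, Matrix.mulVec_smul]

theorem sesq_add_left (x y z : Fin 3 → ℂ) : sesq H (x + y) z = sesq H x z + sesq H y z := by
  simp [sesq, add_dotProduct]

theorem sesq_smul_left (c : ℂ) (x y : Fin 3 → ℂ) : sesq H (c • x) y = conj c * sesq H x y := by
  simp [sesq]

theorem sesq_conj (hH : H.IsHermitian) (x y : Fin 3 → ℂ) : conj (sesq H x y) = sesq H y x := by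
  have : star (star x ⬝ᵥ (H *ᵥ y)) = star y ⬝ᵥ (H *ᵥ x) := by
    rw [← Matrix.star_dotProduct_star, star_star, Matrix.star_mulVec, hH.eq,
      Matrix.dotProduct_mulVec (star y), dotProduct_comm]
  simpa [sesq] using this

theorem sesq_isometry {T : Matrix (Fin 3) (Fin 3) ℂ} (hT : Tᴴ * H * T = H) (x y : Fin 3 → ℂ) :
    sesq H (T *ᵥ x) (T *ᵥ y) = sesq H x y := by
  unfold sesq
  rw [Matrix.star_mulVec, ← Matrix.dotProduct_mulVec, Matrix.mulVec_mulVec, Matrix.mulVec_mulVec,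
    hT]

theorem crefl_mulVec (v x : Fin 3 → ℂ) (μ : ℂ) :
    crefl H v μ *ᵥ x = x + ((μ - 1) / sesq H v v * sesq H v x) • v := by
  unfold crefl
  rw [Matrix.add_mulVec, Matrix.one_mulVec, Matrix.smul_mulVec, Matrix.vecMulVec_mulVec]
  congr 1
  rw [← Matrix.dotProduct_mulVec]
  ext i
  simp only [sesq, Pi.smul_apply, MulOpposite.smul_eq_mul_unop, MulOpposite.unop_op, smul_eq_mul]
  ring

theorem crefl_mulVec_self {v : Fin 3 → ℂ} (hv : sesq H v v ≠ 0) (μ : ℂ) :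
    crefl H v μ *ᵥ v = μ • v := by
  rw [crefl_mulVec, div_mul_cancel₀ _ hv, sub_smul, one_smul]
  abel

theorem crefl_mulVec_of_orthogonal {v x : Fin 3 → ℂ} (h : sesq H v x = 0) (μ : ℂ) :
    crefl H v μ *ᵥ x = x := by
  simp [crefl_mulVec, h]

/-- Matrices agreeing on all vectors are equal. -/
theorem matrix_ext_mulVec {A B : Matrix (Fin 3) (Fin 3) ℂ} (h : ∀ x, A *ᵥ x = B *ᵥ x) : A = B :=
  Matrix.ext_of_mulVec_single fun _ => h _

theorem crefl_mul {v : Fin 3 → ℂ} (hv : sesq H v v ≠ 0) (μ ν : ℂ) :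
    crefl H v μ * crefl H v ν = crefl H v (μ * ν) := by
  refine matrix_ext_mulVec fun x => ?_
  rw [← Matrix.mulVec_mulVec]
  simp only [crefl_mulVec, sesq_add_right, sesq_smul_right]
  rw [add_assoc, ← add_smul]
  congr 2
  field_simp
  ring

theorem crefl_one (v : Fin 3 → ℂ) : crefl H v 1 = 1 := by simp [crefl]

theorem crefl_pow {v : Fin 3 → ℂ} (hv : sesq H v v ≠ 0) (μ : ℂ) (n : ℕ) :
    crefl H v μ ^ n = crefl H v (μ ^ n) := by
  induction n with
  | zero => simp [crefl_one]
  | succ n ih => rw [pow_succ, ih, crefl_mul hv, pow_succ]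

theorem conj_mul_self_of_norm {μ : ℂ} (hμ : ‖μ‖ = 1) : conj μ * μ = 1 := by
  rw [← Complex.normSq_eq_conj_mul_self, Complex.normSq_eq_norm_sq, hμ]; simp

theorem crefl_isometry (hH : H.IsHermitian) {v : Fin 3 → ℂ} (hv : sesq H v v ≠ 0) {μ : ℂ}
    (hμ : ‖μ‖ = 1) : (crefl H v μ)ᴴ * H * crefl H v μ = H := by
  have key : ∀ x y, sesq H (crefl H v μ *ᵥ x) (crefl H v μ *ᵥ y) = sesq H x y := by
    intro x y
    have h1 := conj_mul_self_of_norm hμ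
    simp only [crefl_mulVec, sesq_add_right, sesq_smul_right, sesq_add_left, sesq_smul_left,
      map_mul, map_div₀, map_sub, map_one, sesq_conj hH]
    field_simp
    linear_combination (sesq H x v * sesq H v y) * h1
  ext i j
  have := key (Pi.single i 1) (Pi.single j 1)
  unfold sesq at this
  rw [Matrix.star_mulVec, ← Matrix.dotProduct_mulVec, Matrix.mulVec_mulVec,
    Matrix.mulVec_mulVec] at this
  simpa [Pi.single_star] using this

/-- Conjugating a complex reflection by an isometry gives the reflection in the image vector. -/
theorem mul_crefl {T : Matrix (Fin 3) (Fin 3) ℂ} (hT : Tᴴ * H * T = H) (v : Fin 3 → ℂ) (μ : ℂ) :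
    T * crefl H v μ = crefl H (T *ᵥ v) μ * T := by
  refine matrix_ext_mulVec fun x => ?_
  rw [← Matrix.mulVec_mulVec, ← Matrix.mulVec_mulVec, crefl_mulVec, crefl_mulVec,
    sesq_isometry hT, sesq_isometry hT, Matrix.mulVec_add, Matrix.mulVec_smul]

theorem mul_isometry {S T : Matrix (Fin 3) (Fin 3) ℂ} (hS : Sᴴ * H * S = H) (hT : Tᴴ * H * T = H) :
    (S * T)ᴴ * H * (S * T) = H := by
  rw [Matrix.conjTranspose_mul]
  calc Tᴴ * Sᴴ * H * (S * T) = Tᴴ * (Sᴴ * H * S) * T := by simp only [Matrix.mul_assoc]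
    _ = H := by rw [hS, hT]

end Form

/-! ### Projective membership and discreteness -/

/-- `M` is, up to a scalar of modulus one, the matrix of an element of `Γ`. -/
def ProjMem (Γ : Subgroup (Matrix.SpecialLinearGroup (Fin 3) ℂ))
    (M : Matrix (Fin 3) (Fin 3) ℂ) : Prop :=
  ∃ g ∈ Γ, ∃ ν : ℂ, ‖ν‖ = 1 ∧ (g : Matrix (Fin 3) (Fin 3) ℂ) = ν • M

section Discrete

variable {Γ : Subgroup (Matrix.SpecialLinearGroup (Fin 3) ℂ)}

theorem ProjMem.mul {A B : Matrix (Fin 3) (Fin 3) ℂ} (hA : ProjMem Γ A) (hB : ProjMem Γ B) :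
    ProjMem Γ (A * B) := by
  obtain ⟨g, hg, ν, hν, e⟩ := hA
  obtain ⟨g', hg', ν', hν', e'⟩ := hB
  exact ⟨g * g', Γ.mul_mem hg hg', ν * ν', by simp [hν, hν'], by
    rw [Matrix.SpecialLinearGroup.coe_mul, e, e', smul_mul_smul_comm]⟩

theorem ProjMem.one : ProjMem Γ 1 := ⟨1, Γ.one_mem, 1, by simp, by simp⟩

theorem ProjMem.pow {A : Matrix (Fin 3) (Fin 3) ℂ} (hA : ProjMem Γ A) (n : ℕ) :
    ProjMem Γ (A ^ n) := by
  induction n with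
  | zero => simpa using ProjMem.one
  | succ n ih => rw [pow_succ]; exact ih.mul hA

theorem ProjMem.of_smul {A : Matrix (Fin 3) (Fin 3) ℂ} {c : ℂ} (hc : ‖c‖ = 1)
    (h : ProjMem Γ (c • A)) : ProjMem Γ A := by
  obtain ⟨g, hg, ν, hν, e⟩ := h
  exact ⟨g, hg, ν * c, by simp [hν, hc], by rw [e, smul_smul]⟩

/-- In a discrete group a sequence whose matrices converge to those of an element is eventually
equal to that element. -/
theorem eventually_eq_of_discrete (hΓ : IsDiscreteGroup Γ)
    {u : ℕ → Matrix.SpecialLinearGroup (Fin 3) ℂ} (hu : ∀ n, u n ∈ Γ)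
    {g : Matrix.SpecialLinearGroup (Fin 3) ℂ} (hg : g ∈ Γ)
    (h : Filter.Tendsto (fun n => (u n : Matrix (Fin 3) (Fin 3) ℂ)) Filter.atTop
      (nhds (g : Matrix (Fin 3) (Fin 3) ℂ))) :
    ∀ᶠ n in Filter.atTop, u n = g := by
  have : DiscreteTopology Γ := hΓ
  have h1 : Filter.Tendsto u Filter.atTop (nhds g) := tendsto_subtype_rng.2 h
  have h2 : Filter.Tendsto (fun n => (⟨u n, hu n⟩ : Γ)) Filter.atTop (nhds (⟨g, hg⟩ : Γ)) :=
    tendsto_subtype_rng.2 h1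
  rw [nhds_discrete, Filter.tendsto_pure] at h2
  exact h2.mono fun n hn => congrArg Subtype.val hn

end Discrete

/-! ### A Jørgensen-type criterion -/

open Filter Topology in
/-- The quadratic iteration behind the Jørgensen-type criterion. -/
theorem tendsto_zero_of_quadratic_recursion {s Y : ℝ} (hs0 : 0 ≤ s) (hs : s ≤ 1) (hY0 : -1 < Y)
    (hY1 : Y ≠ 0) (hsY : s * (1 + Y) < 1) {q : ℕ → ℝ} (h0 : q 0 = 1)
    (hq : ∀ n, q (n + 1) = s * (1 + Y * q n) * q n) :
    (∀ n, 0 ≤ q n ∧ q n ≤ 1) ∧ Tendsto q atTop (𝓝 0) := by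
  have hfac : ∀ x : ℝ, 0 ≤ x → x ≤ 1 → 0 ≤ s * (1 + Y * x) ∧ s * (1 + Y * x) ≤ 1 := by
    intro x hx0 hx1
    refine ⟨mul_nonneg hs0 (by nlinarith), ?_⟩
    nlinarith [mul_nonneg hs0 hx0, mul_nonneg hs0 (sub_nonneg.2 hx1)]
  have hb : ∀ n, 0 ≤ q n ∧ q n ≤ 1 := by
    intro n
    induction n with
    | zero => simp [h0]
    | succ n ih =>
      obtain ⟨f0, f1⟩ := hfac _ ih.1 ih.2
      rw [hq]
      exact ⟨mul_nonneg f0 ih.1, mul_le_one₀ f1 ih.1 ih.2⟩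
  refine ⟨hb, ?_⟩
  have hanti : Antitone q := antitone_nat_of_succ_le fun n => by
    rw [hq]
    exact mul_le_of_le_one_left (hb n).1 (hfac _ (hb n).1 (hb n).2).2
  have hlim := tendsto_atTop_ciInf hanti ⟨0, by rintro _ ⟨n, rfl⟩; exact (hb n).1⟩
  set l := ⨅ n, q n with hl
  have hl0 : 0 ≤ l := ge_of_tendsto' hlim fun n => (hb n).1
  have hl1 : l ≤ 1 := le_of_tendsto' hlim fun n => (hb n).2
  have heq : l = s * (1 + Y * l) * l := by
    have h1 : Tendsto (fun n => q (n + 1)) atTop (𝓝 l) := hlim.comp (tendsto_add_atTop_nat 1)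
    have h2 : Tendsto (fun n => s * (1 + Y * q n) * q n) atTop (𝓝 (s * (1 + Y * l) * l)) :=
      ((hlim.const_mul Y).const_add 1 |>.const_mul s).mul hlim
    simp only [hq] at h1
    exact tendsto_nhds_unique h1 h2
  suffices l = 0 by rwa [this] at hlim
  by_contra hne
  have hpos : 0 < l := lt_of_le_of_ne hl0 (Ne.symm hne)
  have hone : s * (1 + Y * l) = 1 := mul_right_cancel₀ hne (by rw [one_mul]; exact heq.symm)
  rcases lt_or_gt_of_ne hY1 with h | h
  · nlinarith [mul_pos hpos (neg_pos.2 h), mul_nonneg hs0 hl0]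
  · nlinarith [mul_nonneg hs0 (mul_nonneg h.le (sub_nonneg.2 hl1))]

section Jorgensen

variable {H : Matrix (Fin 3) (Fin 3) ℂ} {Γ : Subgroup (Matrix.SpecialLinearGroup (Fin 3) ℂ)}

/-- Coordinates, on a vector `a` and a vector orthogonal to it, of the vectors obtained by
iterating `b ↦ crefl H b μ *ᵥ a`. -/
noncomputable def jorgensenSeq (μ k : ℂ) : ℕ → ℂ × ℂ
  | 0 => (k, 1)
  | n + 1 => (1 + (μ - 1) * (conj (jorgensenSeq μ k n).1 * (jorgensenSeq μ k n).1),
      (μ - 1) * conj (jorgensenSeq μ k n).1 * (jorgensenSeq μ k n).2)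

theorem normSq_one_add_mul {μ : ℂ} (hμ : ‖μ‖ = 1) (x : ℝ) :
    Complex.normSq (1 + (μ - 1) * x) =
      1 - Complex.normSq (μ - 1) * x + Complex.normSq (μ - 1) * x ^ 2 := by
  have h : μ.re * μ.re + μ.im * μ.im = 1 := by
    rw [← Complex.normSq_apply, Complex.normSq_eq_norm_sq, hμ]; norm_num
  simp only [Complex.normSq_apply, Complex.add_re, Complex.add_im, Complex.mul_re, Complex.mul_im,
    Complex.sub_re, Complex.sub_im, Complex.one_re, Complex.one_im, Complex.ofReal_re,
    Complex.ofReal_im]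
  linear_combination x * h

open Filter Topology in
/-- A discrete group of isometries cannot contain a complex reflection of small angle together with
a conjugate of it that is too close: with `X = |⟨a, T a⟩|² / ⟨a, a⟩²` and `s = |μ - 1|²`, the
reflections `B₀ = T A T⁻¹`, `Bₙ₊₁ = Bₙ A Bₙ⁻¹` converge to `A` without ever reaching it. -/
theorem not_discrete_of_jorgensen (hH : H.IsHermitian) {a : Fin 3 → ℂ} {μ : ℂ} (hμ : ‖μ‖ = 1)
    {T : Matrix (Fin 3) (Fin 3) ℂ} (ha : sesq H a a ≠ 0) (hA : ProjMem Γ (crefl H a μ))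
    (hTΓ : ProjMem Γ T) (hT : Tᴴ * H * T = H) {X : ℝ}
    (hX : Complex.normSq (sesq H a (T *ᵥ a)) = X * Complex.normSq (sesq H a a))
    (hX0 : 0 < X) (hX1 : X ≠ 1) (hs : Complex.normSq (μ - 1) ≤ 1)
    (hsX : Complex.normSq (μ - 1) * X < 1) (hμ1 : μ ≠ 1) : ¬ IsDiscreteGroup Γ := by
  intro hΓ
  obtain ⟨gA, hgA, ν, hν, egA⟩ := hA
  obtain ⟨gT, hgT, ν', hν', egT⟩ := hTΓ
  have hν0 : ν ≠ 0 := fun h => by simp [h] at hν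
  set N := sesq H a a with hN
  have hNc : conj N = N := sesq_conj hH a a
  set k : ℂ := sesq H a (T *ᵥ a) / N with hk
  set s := Complex.normSq (μ - 1) with hsdef
  have hkX : Complex.normSq k = X := by
    rw [hk, Complex.normSq_div, hX, mul_div_assoc, div_self (Complex.normSq_pos.2 ha).ne', mul_one]
  set w : Fin 3 → ℂ := T *ᵥ a - k • a with hw
  have hTa : T *ᵥ a = k • a + (1 : ℂ) • w := by rw [hw, one_smul]; abel
  have haw : sesq H a w = 0 := by
    have h1 := sesq_add_right (H := H) a (k • a) ((1 : ℂ) • w)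
    have h2 : k * N = sesq H a (T *ᵥ a) := by rw [hk]; field_simp
    rw [← hTa, one_smul, sesq_smul_right, ← hN] at h1
    linear_combination -h1 - h2
  have hwa : sesq H w a = 0 := by rw [← sesq_conj hH, haw, map_zero]
  have hexp : ∀ α β : ℂ, sesq H (α • a + β • w) (α • a + β • w) =
      conj α * α * N + conj β * β * sesq H w w := by
    intro α β
    simp only [sesq_add_left, sesq_add_right, sesq_smul_left, sesq_smul_right, haw, hwa, ← hN]
    ring
  have hW : sesq H w w = N * (1 - X) := by
    have h1 := hexp k 1
    rw [← hTa, sesq_isometry hT, ← hN] at h1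
    have h2 : conj k * k = X := by rw [← Complex.normSq_eq_conj_mul_self, hkX]
    rw [h2] at h1
    simp only [map_one, one_mul] at h1
    linear_combination -h1
  -- the squared lengths of the two coordinates
  let z := jorgensenSeq μ k
  let q : ℕ → ℝ := fun n => Complex.normSq (z n).2
  have hzq : ∀ n, Complex.normSq (z n).1 = 1 + (X - 1) * q n := by
    intro n
    induction n with
    | zero => simp [z, q, jorgensenSeq, hkX]
    | succ n ih =>
      have e1 : (z (n + 1)).1 = 1 + (μ - 1) * ((Complex.normSq (z n).1 : ℝ) : ℂ) := by
        rw [Complex.normSq_eq_conj_mul_self]; rfl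
      have e2 : q (n + 1) = s * Complex.normSq (z n).1 * q n := by
        simp only [q, z, jorgensenSeq, map_mul, Complex.normSq_conj, hsdef]
      rw [e1, e2, normSq_one_add_mul hμ, ← hsdef, ih]
      ring
  have hq : ∀ n, q (n + 1) = s * (1 + (X - 1) * q n) * q n := by
    intro n
    rw [← hzq n]
    simp only [q, z, jorgensenSeq, map_mul, Complex.normSq_conj, hsdef]
  obtain ⟨hb, hlim⟩ := tendsto_zero_of_quadratic_recursion (Complex.normSq_nonneg _) hs
    (by linarith : -1 < X - 1) (sub_ne_zero.2 hX1) (by linarith) (q := q)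
    (by simp [q, z, jorgensenSeq]) hq
  have hzpos : ∀ n, 0 < Complex.normSq (z n).1 := by
    intro n
    rw [hzq]
    by_contra! h
    have h1 := mul_nonneg hX0.le (hb n).1
    have h2 : q n = 1 := le_antisymm (hb n).2 (by linarith)
    rw [h2] at h
    linarith
  have hβ : ∀ n, (z n).2 ≠ 0 := by
    intro n
    induction n with
    | zero => simp [z, jorgensenSeq]
    | succ n ih =>
      refine mul_ne_zero (mul_ne_zero (sub_ne_zero.2 hμ1) ?_) ih
      exact (map_ne_zero _).2 (Complex.normSq_pos.1 (hzpos n))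
  let b : ℕ → Fin 3 → ℂ := fun n => (z n).1 • a + (z n).2 • w
  have hbb : ∀ n, sesq H (b n) (b n) = N := by
    intro n
    rw [hexp, hW, ← Complex.normSq_eq_conj_mul_self, ← Complex.normSq_eq_conj_mul_self, hzq]
    push_cast
    ring
  have hbs : ∀ n, b (n + 1) = crefl H (b n) μ *ᵥ a := by
    intro n
    have h1 : sesq H (b n) a = conj (z n).1 * N := by
      simp only [b, sesq_add_left, sesq_smul_left, hwa, ← hN, mul_zero, add_zero]
    rw [crefl_mulVec, hbb, h1, div_mul_eq_mul_div, mul_comm (conj _) N, ← mul_assoc,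
      mul_div_right_comm, mul_div_assoc, div_self ha, mul_one]
    simp only [b, z, jorgensenSeq]
    module
  -- the corresponding elements of the group
  let g : ℕ → Matrix.SpecialLinearGroup (Fin 3) ℂ := fun n =>
    Nat.rec (gT * gA * gT⁻¹) (fun _ h => h * gA * h⁻¹) n
  have hgs : ∀ n, g (n + 1) = g n * gA * (g n)⁻¹ := fun n => rfl
  have hgΓ : ∀ n, g n ∈ Γ := by
    intro n
    induction n with
    | zero => exact Γ.mul_mem (Γ.mul_mem hgT hgA) (Γ.inv_mem hgT)
    | succ n ih => exact Γ.mul_mem (Γ.mul_mem ih hgA) (Γ.inv_mem ih)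
  have hconj : ∀ (h : Matrix.SpecialLinearGroup (Fin 3) ℂ) (S : Matrix (Fin 3) (Fin 3) ℂ) (κ : ℂ),
      Sᴴ * H * S = H → (h : Matrix (Fin 3) (Fin 3) ℂ) = κ • S →
      ((h * gA * h⁻¹ : Matrix.SpecialLinearGroup (Fin 3) ℂ) : Matrix (Fin 3) (Fin 3) ℂ) =
        ν • crefl H (S *ᵥ a) μ := by
    intro h S κ hS eh
    have e1 : ((h * gA : Matrix.SpecialLinearGroup (Fin 3) ℂ) : Matrix (Fin 3) (Fin 3) ℂ) =
        (ν • crefl H (S *ᵥ a) μ) * h := by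
      rw [Matrix.SpecialLinearGroup.coe_mul, eh, egA, smul_mul_smul_comm, mul_crefl hS,
        smul_mul_smul_comm, mul_comm]
    rw [Matrix.SpecialLinearGroup.coe_mul, e1, Matrix.mul_assoc,
      ← Matrix.SpecialLinearGroup.coe_mul, mul_inv_cancel, Matrix.SpecialLinearGroup.coe_one,
      Matrix.mul_one]
  have hg : ∀ n, (g n).val = ν • crefl H (b n) μ := by
    intro n
    induction n with
    | zero =>
      have := hconj gT T ν' hT egT
      rw [hTa] at this
      exact this
    | succ n ih =>
      rw [hgs, hbs]
      exact hconj (g n) _ ν (crefl_isometry hH (by rw [hbb]; exact ha) hμ) ih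
  -- convergence of the reflections
  have hx1 : Tendsto (fun n => (z n).1 * conj (z n).1) atTop (𝓝 1) := by
    have : Tendsto (fun n => ((1 + (X - 1) * q n : ℝ) : ℂ)) atTop (𝓝 ((1 + (X - 1) * 0 : ℝ) : ℂ)) :=
      (Complex.continuous_ofReal.tendsto _).comp ((hlim.const_mul _).const_add 1)
    simp only [← hzq, Complex.normSq_eq_conj_mul_self] at this
    simpa [mul_comm] using this
  have hβ0 : Tendsto (fun n => (z n).2) atTop (𝓝 0) := by
    rw [tendsto_zero_iff_norm_tendsto_zero]
    have := (Real.continuous_sqrt.tendsto _).comp hlim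
    rw [Real.sqrt_zero] at this
    exact this
  have hβc : Tendsto (fun n => conj (z n).2) atTop (𝓝 0) := by
    have := (Complex.continuous_conj.tendsto _).comp hβ0
    simpa [Function.comp_def] using this
  have hα : ∀ n, ‖(z n).1‖ ≤ 1 + |X - 1| := by
    intro n
    have h1 : ‖(z n).1‖ ^ 2 ≤ 1 + |X - 1| := by
      rw [← Complex.normSq_eq_norm_sq, hzq]
      have := mul_le_mul (le_abs_self (X - 1)) (hb n).2 (hb n).1 (abs_nonneg _)
      linarith
    have h2 := abs_nonneg (X - 1)
    nlinarith [norm_nonneg (z n).1]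
  have hαβ : Tendsto (fun n => (z n).1 * conj (z n).2) atTop (𝓝 0) := by
    simp only [mul_comm (z _).1]
    exact hβc.zero_mul_isBoundedUnder_le (isBoundedUnder_of ⟨_, hα⟩)
  have hβα : Tendsto (fun n => (z n).2 * conj (z n).1) atTop (𝓝 0) := by
    have := (Complex.continuous_conj.tendsto _).comp hαβ
    simpa [Function.comp_def, mul_comm] using this
  have hββ : Tendsto (fun n => (z n).2 * conj (z n).2) atTop (𝓝 0) := by
    simpa using hβ0.mul hβc
  let P : (Fin 3 → ℂ) → (Fin 3 → ℂ) → Matrix (Fin 3) (Fin 3) ℂ := fun x y =>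
    Matrix.vecMulVec x (star y ᵥ* H)
  have hexpand : ∀ n, crefl H (b n) μ = 1 + ((μ - 1) / N) •
      (((z n).1 * conj (z n).1) • P a a + ((z n).1 * conj (z n).2) • P a w +
        ((z n).2 * conj (z n).1) • P w a + ((z n).2 * conj (z n).2) • P w w) := by
    intro n
    unfold crefl
    rw [hbb]
    congr 2
    ext i j
    simp only [b, P, Matrix.vecMulVec_apply, Matrix.add_apply, Matrix.smul_apply, smul_eq_mul,
      star_add, star_smul, Matrix.add_vecMul, Matrix.smul_vecMul, Pi.add_apply, Pi.smul_apply,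
      Complex.star_def]
    ring
  have hcrefl : Tendsto (fun n => crefl H (b n) μ) atTop (𝓝 (crefl H a μ)) := by
    have h1 : crefl H a μ = 1 + ((μ - 1) / N) •
        ((1 : ℂ) • P a a + (0 : ℂ) • P a w + (0 : ℂ) • P w a + (0 : ℂ) • P w w) := by
      simp [crefl, P, hN]
    simp only [h1, hexpand]
    exact ((((hx1.smul_const _).add (hαβ.smul_const _)).add (hβα.smul_const _)).add
      (hββ.smul_const _)).const_smul _ |>.const_add _
  have hgt : Tendsto (fun n => (g n).val) atTop
      (𝓝 gA.val) := by
    simp only [hg, egA]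
    exact hcrefl.const_smul ν
  obtain ⟨n, hn⟩ := (eventually_eq_of_discrete hΓ hgΓ hgA hgt).exists
  -- `crefl H a μ` fixes `w`, and `crefl H (b n) μ` does not
  have h1 : crefl H (b n) μ = crefl H a μ := by
    have := congrArg (fun x : Matrix.SpecialLinearGroup (Fin 3) ℂ =>
      (x : Matrix (Fin 3) (Fin 3) ℂ)) hn
    simp only [hg, egA] at this
    exact smul_right_injective _ hν0 this
  have h2 := congrArg (· *ᵥ w) h1
  simp only [crefl_mulVec_of_orthogonal haw] at h2
  rw [crefl_mulVec, hbb, add_eq_left, smul_eq_zero] at h2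
  have h3 : sesq H (b n) w = conj (z n).2 * (N * (1 - X)) := by
    simp only [b, sesq_add_left, sesq_smul_left, haw, hW, mul_zero, zero_add]
  have h4 : (1 - X : ℂ) ≠ 0 := by
    rw [sub_ne_zero]
    exact_mod_cast hX1.symm
  rcases h2 with h2 | h2
  · rw [h3] at h2
    exact mul_ne_zero (div_ne_zero (sub_ne_zero.2 hμ1) ha)
      (mul_ne_zero ((map_ne_zero (starRingEnd ℂ)).2 (hβ n)) (mul_ne_zero ha h4)) h2
  · have := hbb n
    rw [h2] at this
    simp [sesq] at this
    exact ha this.symm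

end Jorgensen

/-! ### Elliptic elements of infinite order -/

open Filter Topology in
/-- Finitely many complex numbers of modulus one have simultaneous powers arbitrarily close to
one. -/
theorem exists_pow_tendsto_one (d : Fin 3 → ℂ) (hd : ∀ i, ‖d i‖ = 1) :
    ∃ m : ℕ → ℕ, (∀ n, 0 < m n) ∧ Tendsto (fun n i => d i ^ m n) atTop (𝓝 fun _ => 1) := by
  have hmem : ∀ n : ℕ, (fun i => d i ^ n) ∈ Metric.closedBall (0 : Fin 3 → ℂ) 1 := by
    intro n
    rw [mem_closedBall_zero_iff, pi_norm_le_iff_of_nonneg zero_le_one]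
    intro i
    rw [norm_pow, hd, one_pow]
  obtain ⟨x, -, φ, hφ, hx⟩ := (isCompact_closedBall (0 : Fin 3 → ℂ) 1).tendsto_subseq hmem
  refine ⟨fun n => φ (n + 1) - φ n, fun n => Nat.sub_pos_of_lt (hφ n.lt_succ_self), ?_⟩
  rw [tendsto_pi_nhds] at hx ⊢
  intro i
  have hxi := hx i
  have hxn : ‖x i‖ = 1 := by
    refine tendsto_nhds_unique hxi.norm ?_
    simp [hd]
  have hx0 : x i ≠ 0 := fun h => by simp [h] at hxn
  have hdi : d i ≠ 0 := fun h => by have := hd i; simp [h] at this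
  have h1 := (hxi.comp (tendsto_add_atTop_nat 1)).div hxi hx0
  rw [div_self hx0] at h1
  refine h1.congr fun n => ?_
  simp only [Function.comp_apply, Pi.div_apply]
  rw [pow_sub₀ _ hdi (hφ n.lt_succ_self).le, div_eq_mul_inv]

open Filter Topology in
/-- In a discrete group, an element that is diagonalizable with eigenvalues of modulus one has
finite order. -/
theorem exists_pow_eq_one_of_discrete {Γ : Subgroup (Matrix.SpecialLinearGroup (Fin 3) ℂ)}
    (hΓ : IsDiscreteGroup Γ) {g : Matrix.SpecialLinearGroup (Fin 3) ℂ} (hg : g ∈ Γ)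
    {P : Matrix (Fin 3) (Fin 3) ℂ} (hP : IsUnit P.det) {d : Fin 3 → ℂ} (hd : ∀ i, ‖d i‖ = 1)
    (h : (g : Matrix (Fin 3) (Fin 3) ℂ) * P = P * Matrix.diagonal d) :
    ∃ m : ℕ, 0 < m ∧ ∀ i, d i ^ m = 1 := by
  obtain ⟨m, hm, hlim⟩ := exists_pow_tendsto_one d hd
  have hpow : ∀ n : ℕ, ((g ^ n : Matrix.SpecialLinearGroup (Fin 3) ℂ) :
      Matrix (Fin 3) (Fin 3) ℂ) * P = P * Matrix.diagonal (d ^ n) := by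
    intro n
    induction n with
    | zero => simp
    | succ n ih =>
      rw [pow_succ, Matrix.SpecialLinearGroup.coe_mul, Matrix.mul_assoc, h, ← Matrix.mul_assoc, ih,
        Matrix.mul_assoc, Matrix.diagonal_mul_diagonal, pow_succ]
      rfl
  have hpow' : ∀ n : ℕ, (g ^ n).val = P * Matrix.diagonal (d ^ n) * P⁻¹ := by
    intro n
    rw [← hpow, Matrix.mul_nonsing_inv_cancel_right _ _ hP]
  have ht : Tendsto (fun n => (g ^ m n).val) atTop
      (𝓝 (1 : Matrix.SpecialLinearGroup (Fin 3) ℂ).val) := by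
    have h1 : (1 : Matrix.SpecialLinearGroup (Fin 3) ℂ).val =
        P * Matrix.diagonal (fun _ => 1) * P⁻¹ := by
      rw [Matrix.diagonal_one, Matrix.mul_one, Matrix.mul_nonsing_inv _ hP]; rfl
    simp only [h1, hpow']
    have hc : Continuous fun x : Fin 3 → ℂ => P * Matrix.diagonal x * P⁻¹ := by fun_prop
    exact (hc.tendsto _).comp hlim
  obtain ⟨n, hn⟩ := (eventually_eq_of_discrete hΓ (fun n => Γ.pow_mem hg _) Γ.one_mem ht).exists
  refine ⟨m n, hm n, fun i => ?_⟩
  have h1 := hpow (m n)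
  rw [hn, Matrix.SpecialLinearGroup.coe_one, Matrix.one_mul] at h1
  have h2 : Matrix.diagonal (d ^ m n) = 1 := by
    have := congrArg (P⁻¹ * ·) h1
    simp only [← Matrix.mul_assoc, Matrix.nonsing_inv_mul _ hP, Matrix.one_mul] at this
    exact this.symm
  have := congrFun (congrFun h2 i) i
  simpa using this

section Elliptic

variable {H : Matrix (Fin 3) (Fin 3) ℂ} {Γ : Subgroup (Matrix.SpecialLinearGroup (Fin 3) ℂ)}

/-- There is a nonzero vector orthogonal to two given ones. -/
theorem exists_orthogonal (a b : Fin 3 → ℂ) :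
    ∃ n : Fin 3 → ℂ, n ≠ 0 ∧ sesq H a n = 0 ∧ sesq H b n = 0 := by
  have hdet : (Matrix.of ![star a ᵥ* H, star b ᵥ* H, 0] : Matrix (Fin 3) (Fin 3) ℂ).det = 0 :=
    Matrix.det_eq_zero_of_row_eq_zero 2 (fun j => by simp)
  obtain ⟨n, hn, h⟩ := Matrix.exists_mulVec_eq_zero_iff.2 hdet
  refine ⟨n, hn, ?_, ?_⟩
  · have := congrFun h 0
    simpa [Matrix.mulVec, sesq, Matrix.dotProduct_mulVec] using this
  · have := congrFun h 1
    simpa [Matrix.mulVec, sesq, Matrix.dotProduct_mulVec] using this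

/-- The product of a complex reflection `A` with its conjugate `T A T⁻¹` acts on the span of the
two normal vectors with eigenvalues `μ e^{±iθ}`, where `2 cos θ = 2 - |μ - 1|² X`. If `θ` is not a
rational multiple of `π`, the group is not discrete. -/
theorem not_discrete_of_irrational_angle (hH : H.IsHermitian) {a : Fin 3 → ℂ} {μ : ℂ} (hμ : ‖μ‖ = 1)
    {T : Matrix (Fin 3) (Fin 3) ℂ} (ha : sesq H a a ≠ 0) (hA : ProjMem Γ (crefl H a μ))
    (hTΓ : ProjMem Γ T) (hT : Tᴴ * H * T = H) {X L : ℝ}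
    (hX : Complex.normSq (sesq H a (T *ᵥ a)) = X * Complex.normSq (sesq H a a))
    (hX1 : X ≠ 1) (hL : L = Complex.normSq (μ - 1) * X) (hL0 : 0 < L) (hL4 : L < 4)
    (hirr : ∀ (z : ℂ) (m : ℕ), 0 < m → z ^ m = 1 → z + z⁻¹ ≠ 2 - L) : ¬ IsDiscreteGroup Γ := by
  intro hΓ
  obtain ⟨gA, hgA, ν, hν, egA⟩ := hA
  obtain ⟨gT, hgT, ν', hν', egT⟩ := hTΓ
  set N := sesq H a a with hN
  have hNc : conj N = N := sesq_conj hH a a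
  set b := T *ᵥ a with hb
  have hbb : sesq H b b = N := sesq_isometry hT a a
  set k : ℂ := sesq H a b / N with hk
  have hab : sesq H a b = k * N := by rw [hk]; field_simp
  have hba : sesq H b a = conj k * N := by rw [← sesq_conj hH, hab, map_mul, hNc]
  have hkX : conj k * k = X := by
    have : Complex.normSq k = X := by
      rw [hk, Complex.normSq_div, hX, mul_div_assoc, div_self (Complex.normSq_pos.2 ha).ne',
        mul_one]
    rw [← Complex.normSq_eq_conj_mul_self, this]
  have hμ0 : μ ≠ 0 := fun h => by simp [h] at hμ
  have hμμ := conj_mul_self_of_norm hμ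
  have hμL : (μ - 1) ^ 2 * X = - L * μ := by
    rw [hL]
    push_cast
    rw [Complex.normSq_eq_conj_mul_self, map_sub, map_one]
    linear_combination (X * (μ - 1)) * hμμ
  have hμ1 : μ - 1 ≠ 0 := fun h => by simp [h] at hL; exact hL0.ne' hL
  have hk0 : conj k ≠ 0 := by
    intro h
    rw [h, zero_mul] at hkX
    have : X = 0 := by exact_mod_cast hkX.symm
    simp [this] at hL
    exact hL0.ne' hL
  -- the eigenvalues
  obtain ⟨x, hxn, hx⟩ : ∃ x : ℂ, ‖x‖ = 1 ∧ x ^ 2 - (2 - L) * x + 1 = 0 := by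
    refine ⟨Complex.exp (Real.arccos ((2 - L) / 2) * Complex.I),
      Complex.norm_exp_ofReal_mul_I _, ?_⟩
    set θ := Real.arccos ((2 - L) / 2) with hθ
    have hc : Real.cos θ = (2 - L) / 2 := Real.cos_arccos (by linarith) (by linarith)
    have hs := Real.sin_sq_add_cos_sq θ
    rw [Complex.exp_mul_I, ← Complex.ofReal_cos, ← Complex.ofReal_sin]
    have hL' : (2 - L : ℂ) = 2 * (Real.cos θ : ℝ) := by rw [hc]; push_cast; ring
    have hs' : (Real.sin θ : ℂ) ^ 2 + (Real.cos θ : ℂ) ^ 2 = 1 := by exact_mod_cast hs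
    rw [hL']
    linear_combination (Real.sin θ : ℂ) ^ 2 * Complex.I_sq - hs'
  have hx0 : x ≠ 0 := fun h => by simp [h] at hxn
  have hxx : x + x⁻¹ = 2 - L := by
    field_simp
    linear_combination hx
  have hxne : x ≠ x⁻¹ := by
    intro h
    have h2 : x ^ 2 = 1 := by rw [sq]; nth_rewrite 2 [h]; exact mul_inv_cancel₀ hx0
    exact hirr x 2 two_pos h2 hxx
  have hyn : ‖x⁻¹‖ = 1 := by rw [norm_inv, hxn, inv_one]
  have hy : x⁻¹ ^ 2 - (2 - L) * x⁻¹ + 1 = 0 := by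
    field_simp
    linear_combination hx
  -- the action on the span of `a` and `b`
  have hAa : crefl H a μ *ᵥ a = μ • a := crefl_mulVec_self ha μ
  have hAb : crefl H a μ *ᵥ b = b + ((μ - 1) * k) • a := by
    rw [crefl_mulVec, hab, ← hN]; congr 2; field_simp
  have hBa : crefl H b μ *ᵥ a = a + ((μ - 1) * conj k) • b := by
    rw [crefl_mulVec, hba, hbb]; congr 2; field_simp
  have hBb : crefl H b μ *ᵥ b = μ • b := crefl_mulVec_self (by rw [hbb]; exact ha) μ
  have heig : ∀ y : ℂ, y ^ 2 - (2 - L) * y + 1 = 0 →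
      (crefl H a μ * crefl H b μ) *ᵥ ((μ * y - μ) • a + ((μ - 1) * conj k) • b) =
        (μ * y) • ((μ * y - μ) • a + ((μ - 1) * conj k) • b) := by
    intro y hy
    rw [← Matrix.mulVec_mulVec]
    simp only [Matrix.mulVec_add, Matrix.mulVec_smul, hAa, hAb, hBa, hBb]
    have e1 : (μ * y - μ) * μ + (μ * y - μ) * ((μ - 1) * conj k) * ((μ - 1) * k) +
        (μ - 1) * conj k * μ * ((μ - 1) * k) = μ * y * (μ * y - μ) := by
      linear_combination (μ * y * (μ - 1) ^ 2) * hkX + (μ * y) * hμL - μ ^ 2 * hy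
    have e2 : (μ * y - μ) * ((μ - 1) * conj k) + (μ - 1) * conj k * μ =
        μ * y * ((μ - 1) * conj k) := by ring
    calc _ = ((μ * y - μ) * μ + (μ * y - μ) * ((μ - 1) * conj k) * ((μ - 1) * k) +
        (μ - 1) * conj k * μ * ((μ - 1) * k)) • a +
        ((μ * y - μ) * ((μ - 1) * conj k) + (μ - 1) * conj k * μ) • b := by module
      _ = _ := by rw [e1, e2]; module
  obtain ⟨n, hn0, han, hbn⟩ := exists_orthogonal (H := H) a b
  have hMn : (crefl H a μ * crefl H b μ) *ᵥ n = n := by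
    rw [← Matrix.mulVec_mulVec, crefl_mulVec_of_orthogonal hbn, crefl_mulVec_of_orthogonal han]
  -- the group element and its eigenbasis
  have hgval : ((gA * (gT * gA * gT⁻¹) : Matrix.SpecialLinearGroup (Fin 3) ℂ) :
      Matrix (Fin 3) (Fin 3) ℂ) = (ν * ν) • (crefl H a μ * crefl H b μ) := by
    have e1 : ((gT * gA : Matrix.SpecialLinearGroup (Fin 3) ℂ) : Matrix (Fin 3) (Fin 3) ℂ) =
        (ν • crefl H b μ) * gT := by
      rw [Matrix.SpecialLinearGroup.coe_mul, egT, egA, smul_mul_smul_comm, mul_crefl hT,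
        smul_mul_smul_comm, mul_comm, hb]
    have e2 : ((gT * gA * gT⁻¹ : Matrix.SpecialLinearGroup (Fin 3) ℂ) :
        Matrix (Fin 3) (Fin 3) ℂ) = ν • crefl H b μ := by
      rw [Matrix.SpecialLinearGroup.coe_mul, e1, Matrix.mul_assoc,
        ← Matrix.SpecialLinearGroup.coe_mul, mul_inv_cancel, Matrix.SpecialLinearGroup.coe_one,
        Matrix.mul_one]
    rw [Matrix.SpecialLinearGroup.coe_mul, e2, egA, smul_mul_smul_comm]
  have hgΓ : gA * (gT * gA * gT⁻¹) ∈ Γ :=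
    Γ.mul_mem hgA (Γ.mul_mem (Γ.mul_mem hgT hgA) (Γ.inv_mem hgT))
  let v : ℂ → Fin 3 → ℂ := fun y => (μ * y - μ) • a + ((μ - 1) * conj k) • b
  let P : Matrix (Fin 3) (Fin 3) ℂ := (Matrix.of ![v x, v x⁻¹, n])ᵀ
  let d : Fin 3 → ℂ := ![ν * ν * (μ * x), ν * ν * (μ * x⁻¹), ν * ν]
  have hPv : ∀ c : Fin 3 → ℂ, P *ᵥ c = c 0 • v x + c 1 • v x⁻¹ + c 2 • n := by
    intro c
    ext i
    simp [P, Matrix.mulVec, dotProduct, Fin.sum_univ_three, mul_comm]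
  have hPdet : IsUnit P.det := by
    rw [isUnit_iff_ne_zero]
    intro h
    obtain ⟨c, hc0, hc⟩ := Matrix.exists_mulVec_eq_zero_iff.2 h
    rw [hPv] at hc
    set α := c 0 * (μ * x - μ) + c 1 * (μ * x⁻¹ - μ) with hα
    set β := (c 0 + c 1) * ((μ - 1) * conj k) with hβ
    have hc' : α • a + β • b + c 2 • n = 0 := by
      rw [← hc, hα, hβ]
      simp only [v]
      module
    have h1 := congrArg (sesq H a) hc'
    have h2 := congrArg (sesq H b) hc'
    have hz : ∀ u : Fin 3 → ℂ, sesq H u 0 = 0 := fun u => by simp [sesq]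
    simp only [sesq_add_right, sesq_smul_right, hab, hba, hbb, han, hbn, ← hN, hz] at h1 h2
    have h1' : α + β * k = 0 := mul_right_cancel₀ ha (by linear_combination h1)
    have h2' : α * conj k + β = 0 := mul_right_cancel₀ ha (by linear_combination h2)
    have hX1' : (1 - X : ℂ) ≠ 0 := by
      rw [sub_ne_zero]
      exact_mod_cast hX1.symm
    have hβ0 : β = 0 := mul_right_cancel₀ hX1' (by
      linear_combination h2' - conj k * h1' + β * hkX)
    have hα0 : α = 0 := by linear_combination h1' - k * hβ0
    have h01 : c 0 + c 1 = 0 := by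
      rw [hβ] at hβ0
      exact (mul_eq_zero.1 hβ0).resolve_right (mul_ne_zero hμ1 hk0)
    have h0 : c 0 = 0 := by
      have : c 0 * (μ * (x - x⁻¹)) = 0 := by
        linear_combination hα0 - (μ * x⁻¹ - μ) * h01
      exact (mul_eq_zero.1 this).resolve_right (mul_ne_zero hμ0 (sub_ne_zero.2 hxne))
    have h1 : c 1 = 0 := by linear_combination h01 - h0
    rw [hα0, hβ0, zero_smul, zero_smul, zero_add, zero_add, smul_eq_zero] at hc'
    have h2 := hc'.resolve_right hn0
    exact hc0 (funext fun i => by fin_cases i <;> assumption)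
  have hPd : ((gA * (gT * gA * gT⁻¹) : Matrix.SpecialLinearGroup (Fin 3) ℂ) :
      Matrix (Fin 3) (Fin 3) ℂ) * P = P * Matrix.diagonal d := by
    refine matrix_ext_mulVec fun c => ?_
    rw [← Matrix.mulVec_mulVec, ← Matrix.mulVec_mulVec, hPv, hPv, hgval]
    have hvx : (crefl H a μ * crefl H b μ) *ᵥ v x = (μ * x) • v x := heig x hx
    have hvy : (crefl H a μ * crefl H b μ) *ᵥ v x⁻¹ = (μ * x⁻¹) • v x⁻¹ := heig _ hy
    simp only [Matrix.mulVec_add, Matrix.mulVec_smul, Matrix.smul_mulVec, hvx, hvy, hMn,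
      Matrix.mulVec_diagonal, d]
    simp only [Matrix.cons_val]
    module
  obtain ⟨m, hm, hdm⟩ := exists_pow_eq_one_of_discrete hΓ hgΓ hPdet (d := d) (by
    intro i
    fin_cases i <;> simp [d, hν, hμ, hxn]) hPd
  have hd0 := hdm 0
  have hd1 := hdm 1
  refine hirr x (2 * m) (by positivity) ?_ hxx
  simp only [d, Matrix.cons_val] at hd0 hd1
  have hu : (ν * ν * (μ * x⁻¹)) ≠ 0 := by
    intro h
    rw [h, zero_pow hm.ne'] at hd1
    exact zero_ne_one hd1
  have : x ^ 2 = ν * ν * (μ * x) / (ν * ν * (μ * x⁻¹)) := by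
    rw [eq_div_iff hu]
    field_simp
  rw [pow_mul, this, div_pow, hd0, hd1, div_one]

end Elliptic

/-! ### Galois conjugation of real cyclotomic numbers -/

/-- The embedding `φ` of the algebraic numbers into `ℂ` takes the real number `x` to the real
number `x'`. -/
def GalConj (φ : algebraicClosure ℚ ℂ →ₐ[ℚ] ℂ) (x x' : ℝ) : Prop :=
  ∃ u : algebraicClosure ℚ ℂ, (u : ℂ) = x ∧ φ u = x'

namespace GalConj

variable {φ : algebraicClosure ℚ ℂ →ₐ[ℚ] ℂ} {x x' y y' : ℝ}

theorem add (hx : GalConj φ x x') (hy : GalConj φ y y') : GalConj φ (x + y) (x' + y') := by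
  obtain ⟨u, h1, h2⟩ := hx
  obtain ⟨v, h3, h4⟩ := hy
  exact ⟨u + v, by push_cast; rw [h1, h3], by rw [map_add, h2, h4]; push_cast; rfl⟩

theorem sub (hx : GalConj φ x x') (hy : GalConj φ y y') : GalConj φ (x - y) (x' - y') := by
  obtain ⟨u, h1, h2⟩ := hx
  obtain ⟨v, h3, h4⟩ := hy
  exact ⟨u - v, by push_cast; rw [h1, h3], by rw [map_sub, h2, h4]; push_cast; rfl⟩

theorem mul (hx : GalConj φ x x') (hy : GalConj φ y y') : GalConj φ (x * y) (x' * y') := by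
  obtain ⟨u, h1, h2⟩ := hx
  obtain ⟨v, h3, h4⟩ := hy
  exact ⟨u * v, by push_cast; rw [h1, h3], by rw [map_mul, h2, h4]; push_cast; rfl⟩

theorem div (hx : GalConj φ x x') (hy : GalConj φ y y') : GalConj φ (x / y) (x' / y') := by
  obtain ⟨u, h1, h2⟩ := hx
  obtain ⟨v, h3, h4⟩ := hy
  exact ⟨u / v, by push_cast; rw [h1, h3], by rw [map_div₀, h2, h4]; push_cast; rfl⟩

theorem ofNat (n : ℕ) [n.AtLeastTwo] :
    GalConj φ (OfNat.ofNat n : ℝ) (OfNat.ofNat n : ℝ) :=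
  ⟨OfNat.ofNat n, by push_cast; rfl, by rw [map_ofNat]; push_cast; rfl⟩

theorem one : GalConj φ 1 1 := ⟨1, by simp, by simp⟩

theorem neg (hx : GalConj φ x x') : GalConj φ (-x) (-x') := by
  obtain ⟨u, h1, h2⟩ := hx
  exact ⟨-u, by push_cast; rw [h1], by rw [map_neg, h2]; push_cast; rfl⟩

theorem pow (hx : GalConj φ x x') (n : ℕ) : GalConj φ (x ^ n) (x' ^ n) := by
  obtain ⟨u, h1, h2⟩ := hx
  exact ⟨u ^ n, by push_cast; rw [h1], by rw [map_pow, h2]; push_cast; rfl⟩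

/-- If `2 - x = 2 cos θ` with `θ` a rational multiple of `π`, all the conjugates of `x` lie in
`[0, 4]`. -/
theorem add_inv_ne (h : GalConj φ x x') (hx' : 4 < x') (z : ℂ) (m : ℕ) (hm : 0 < m)
    (hz : z ^ m = 1) : z + z⁻¹ ≠ 2 - x := by
  intro heq
  obtain ⟨u, h1, h2⟩ := h
  have halg : z ∈ algebraicClosure ℚ ℂ := by
    rw [mem_algebraicClosure_iff]
    refine ⟨Polynomial.X ^ m - 1, (Polynomial.monic_X_pow_sub_C (1 : ℚ) hm.ne').ne_zero, ?_⟩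
    simp [hz]
  set w : algebraicClosure ℚ ℂ := ⟨z, halg⟩ with hw
  have e1 : w + w⁻¹ = 2 - u := by
    apply Subtype.ext
    push_cast
    rw [h1]
    exact heq
  have e2 : w ^ m = 1 := by
    apply Subtype.ext
    push_cast
    exact hz
  have e3 : φ w + (φ w)⁻¹ = 2 - x' := by
    rw [← map_inv₀, ← map_add, e1, map_sub, map_ofNat, h2]
  have e4 : φ w ^ m = 1 := by rw [← map_pow, e2, map_one]
  have e5 : ‖φ w‖ = 1 := Complex.norm_eq_one_of_pow_eq_one e4 hm.ne'
  have e6 : ‖(2 - x' : ℂ)‖ ≤ 2 := by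
    rw [← e3]
    refine (norm_add_le _ _).trans ?_
    rw [norm_inv, e5]
    norm_num
  have e7 : ‖(2 - x' : ℂ)‖ = |2 - x'| := by
    rw [← Real.norm_eq_abs, ← Complex.norm_real]
    push_cast
    rfl
  rw [e7, abs_le] at e6
  linarith

end GalConj

/-- The automorphisms of the cyclotomic fields, acting on cosines. -/
theorem exists_galConj_cos (N k : ℕ) (hN : 0 < N) (hk : k.Coprime N) :
    ∃ φ : algebraicClosure ℚ ℂ →ₐ[ℚ] ℂ, ∀ j : ℤ,
      GalConj φ (Real.cos (2 * Real.pi * (j / N))) (Real.cos (2 * Real.pi * (k * j / N))) := by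
  have hp := Complex.isPrimitiveRoot_exp N hN.ne'
  have hp' := Complex.isPrimitiveRoot_exp_of_coprime k N hN.ne' hk
  set ξ := Complex.exp (2 * Real.pi * Complex.I / N) with hξ
  have halg : ξ ∈ algebraicClosure ℚ ℂ := by
    rw [mem_algebraicClosure_iff]
    exact (hp.isIntegral hN).tower_top.isAlgebraic
  set x : algebraicClosure ℚ ℂ := ⟨ξ, halg⟩ with hx
  have hmin : minpoly ℚ x = Polynomial.cyclotomic N ℚ := by
    rw [Polynomial.cyclotomic_eq_minpoly_rat hp hN]
    exact (minpoly.algebraMap_eq (B' := ℂ) (algebraMap (algebraicClosure ℚ ℂ) ℂ).injective x).symm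
  have hroot : Complex.exp (2 * Real.pi * Complex.I * (k / N)) ∈ (minpoly ℚ x).rootSet ℂ := by
    rw [hmin, Polynomial.mem_rootSet]
    refine ⟨Polynomial.cyclotomic_ne_zero N ℚ, ?_⟩
    rw [Polynomial.aeval_def, Polynomial.eval₂_eq_eval_map, Polynomial.map_cyclotomic]
    exact hp'.isRoot_cyclotomic hN
  have : Algebra.IsAlgebraic ℚ (algebraicClosure ℚ ℂ) := algebraicClosure.isAlgebraic ℚ ℂ
  rw [← Algebra.IsAlgebraic.range_eval_eq_rootSet_minpoly] at hroot
  obtain ⟨φ, hφ⟩ := hroot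
  have hc : ∀ j : ℤ, ((x ^ j : algebraicClosure ℚ ℂ) : ℂ) = ξ ^ j := fun j =>
    map_zpow₀ (algebraMap (algebraicClosure ℚ ℂ) ℂ) x j
  refine ⟨φ, fun j => ⟨(x ^ j + x ^ (-j)) / 2, ?_, ?_⟩⟩
  · push_cast
    rw [hc, hc, Complex.cos, hξ, ← Complex.exp_int_mul, ← Complex.exp_int_mul]
    congr 3 <;> (push_cast; ring)
  · rw [map_div₀, map_add, map_zpow₀, map_zpow₀, map_ofNat]
    have : φ x = Complex.exp (2 * Real.pi * Complex.I * (k / N)) := hφ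
    rw [this, Complex.ofReal_cos, Complex.cos, ← Complex.exp_int_mul, ← Complex.exp_int_mul]
    congr 3 <;> (push_cast; ring)

/-! ### The reflections of the triangle group -/

/-- The off-diagonal entry of `formH ψ τ`. -/
noncomputable def offDiag (ψ : ℝ) (τ : ℂ) : ℂ :=
  -(Complex.I * Complex.exp (-(Complex.I * ψ / 6)) * τ)

/-- The unit complex number `y = i e^{iψ/2}`, for which `y + ȳ` is minus the diagonal entry of
`formH ψ τ`, and `y² = -e^{iψ}`. -/
noncomputable def halfRot (ψ : ℝ) : ℂ := Complex.I * Complex.exp (Complex.I * ψ / 2)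

theorem conj_exp_I_mul (x : ℂ) (hx : conj x = x) :
    conj (Complex.exp (Complex.I * x)) = Complex.exp (-(Complex.I * x)) := by
  rw [← Complex.exp_conj, map_mul, hx, Complex.conj_I, neg_mul]

theorem conj_halfRot (ψ : ℝ) :
    conj (halfRot ψ) = -(Complex.I * Complex.exp (-(Complex.I * ψ / 2))) := by
  have := conj_exp_I_mul ((ψ : ℂ) / 2) (by simp only [map_div₀, Complex.conj_ofReal, map_ofNat])
  rw [halfRot, map_mul, Complex.conj_I, mul_div_assoc, this]
  ring

theorem halfRot_mul_conj (ψ : ℝ) : halfRot ψ * conj (halfRot ψ) = 1 := by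
  have h : Complex.exp (Complex.I * ψ / 2) * Complex.exp (-(Complex.I * ψ / 2)) = 1 := by
    rw [← Complex.exp_add, add_neg_cancel, Complex.exp_zero]
  rw [conj_halfRot, halfRot]
  linear_combination (-Complex.I ^ 2) * h - Complex.I_sq

theorem halfRot_ne_zero (ψ : ℝ) : halfRot ψ ≠ 0 := left_ne_zero_of_mul_eq_one (halfRot_mul_conj ψ)

theorem conj_halfRot_eq_inv (ψ : ℝ) : conj (halfRot ψ) = (halfRot ψ)⁻¹ :=
  eq_inv_of_mul_eq_one_right (halfRot_mul_conj ψ)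

theorem exp_eq_neg_halfRot_sq (ψ : ℝ) : Complex.exp (Complex.I * ψ) = -halfRot ψ ^ 2 := by
  rw [halfRot, mul_pow, Complex.I_sq, ← Complex.exp_nat_mul]
  push_cast
  rw [mul_div_cancel₀ _ two_ne_zero]
  ring

theorem two_sin_half (ψ : ℝ) :
    ((2 * Real.sin (ψ / 2) : ℝ) : ℂ) = -(halfRot ψ + (halfRot ψ)⁻¹) := by
  rw [← conj_halfRot_eq_inv, conj_halfRot, halfRot]
  push_cast
  rw [Complex.sin]
  ring_nf

theorem complex_cos_eq (ψ : ℝ) :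
    Complex.cos ψ = -(halfRot ψ ^ 2 + (halfRot ψ)⁻¹ ^ 2) / 2 := by
  have h := exp_eq_neg_halfRot_sq ψ
  have h2 : Complex.exp (-(Complex.I * ψ)) = -(halfRot ψ)⁻¹ ^ 2 := by
    rw [Complex.exp_neg, h, inv_pow, inv_neg]
  rw [Complex.cos, mul_comm (ψ : ℂ), neg_mul, mul_comm (ψ : ℂ), h, h2]
  ring

theorem complex_sin_eq (ψ : ℝ) :
    Complex.sin ψ = Complex.I * (halfRot ψ ^ 2 - (halfRot ψ)⁻¹ ^ 2) / 2 := by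
  have h := exp_eq_neg_halfRot_sq ψ
  have h2 : Complex.exp (-(Complex.I * ψ)) = -(halfRot ψ)⁻¹ ^ 2 := by
    rw [Complex.exp_neg, h, inv_pow, inv_neg]
  rw [Complex.sin, mul_comm (ψ : ℂ), neg_mul, mul_comm (ψ : ℂ), h, h2]
  ring

theorem conj_offDiag (ψ : ℝ) (τ : ℂ) :
    conj (offDiag ψ τ) = Complex.I * Complex.exp (Complex.I * ψ / 6) * conj τ := by
  have := conj_exp_I_mul (-(ψ : ℂ) / 6)
    (by simp only [map_div₀, map_neg, Complex.conj_ofReal, map_ofNat])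
  rw [offDiag, map_neg, map_mul, map_mul, Complex.conj_I]
  rw [show -(Complex.I * (ψ : ℂ) / 6) = Complex.I * (-(ψ : ℂ) / 6) by ring, this]
  rw [show -(Complex.I * (-(ψ : ℂ) / 6)) = Complex.I * ψ / 6 by ring]
  ring

theorem offDiag_mul_conj (ψ : ℝ) (τ : ℂ) :
    offDiag ψ τ * conj (offDiag ψ τ) = (Complex.normSq τ : ℂ) := by
  have h : Complex.exp (Complex.I * ψ / 6) * Complex.exp (-(Complex.I * ψ / 6)) = 1 := by
    rw [← Complex.exp_add, add_neg_cancel, Complex.exp_zero]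
  rw [conj_offDiag, offDiag, Complex.normSq_eq_conj_mul_self]
  linear_combination (-Complex.I ^ 2 * τ * conj τ) * h - τ * conj τ * Complex.I_sq

/-- `τ³` in terms of the entries of the form; the choice of a cube root in `offDiag` disappears. -/
theorem pow_three_eq_offDiag (ψ : ℝ) (τ : ℂ) : τ ^ 3 = -halfRot ψ * offDiag ψ τ ^ 3 := by
  have h : Complex.exp (Complex.I * ψ / 2) * Complex.exp (-(Complex.I * ψ / 6)) ^ 3 = 1 := by
    rw [← Complex.exp_nat_mul, ← Complex.exp_add, ← Complex.exp_zero]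
    congr 1
    push_cast
    ring
  rw [halfRot, offDiag]
  linear_combination (-Complex.I ^ 4 * τ ^ 3) * h - τ ^ 3 * Complex.I_pow_four

/-- The diagonal entry of `formH ψ τ`. -/
noncomputable def diagEntry (ψ : ℝ) : ℝ := 2 * Real.sin (ψ / 2)

theorem diagEntry_sq (ψ : ℝ) : diagEntry ψ ^ 2 = 2 - 2 * Real.cos ψ := by
  rw [diagEntry, mul_pow, Real.sin_sq, Real.cos_sq, mul_div_cancel₀ _ two_ne_zero]
  ring

theorem formH_eq (ψ : ℝ) (τ : ℂ) :
    formH ψ τ = !![(diagEntry ψ : ℂ), offDiag ψ τ, conj (offDiag ψ τ);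
      conj (offDiag ψ τ), (diagEntry ψ : ℂ), offDiag ψ τ;
      offDiag ψ τ, conj (offDiag ψ τ), (diagEntry ψ : ℂ)] := by
  rw [conj_offDiag]
  simp [formH, offDiag, diagEntry]

theorem formH_isHermitian (ψ : ℝ) (τ : ℂ) : (formH ψ τ).IsHermitian := by
  rw [formH_eq]
  ext i j
  fin_cases i <;> fin_cases j <;> simp [Matrix.conjTranspose_apply]

theorem sesq_formH (ψ : ℝ) (τ : ℂ) (u₀ u₁ u₂ v₀ v₁ v₂ : ℂ) :
    sesq (formH ψ τ) ![u₀, u₁, u₂] ![v₀, v₁, v₂] =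
      conj u₀ * (diagEntry ψ * v₀ + offDiag ψ τ * v₁ + conj (offDiag ψ τ) * v₂) +
      conj u₁ * (conj (offDiag ψ τ) * v₀ + diagEntry ψ * v₁ + offDiag ψ τ * v₂) +
      conj u₂ * (offDiag ψ τ * v₀ + conj (offDiag ψ τ) * v₁ + diagEntry ψ * v₂) := by
  rw [formH_eq]
  simp [sesq, Matrix.mulVec, dotProduct, Fin.sum_univ_three]

theorem matJ_mulVec (v₀ v₁ v₂ : ℂ) : matJ *ᵥ ![v₀, v₁, v₂] = ![v₂, v₀, v₁] := by
  ext i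
  fin_cases i <;> simp [matJ, Matrix.mulVec, dotProduct, Fin.sum_univ_three]

theorem matJ_isometry (ψ : ℝ) (τ : ℂ) : matJᴴ * formH ψ τ * matJ = formH ψ τ := by
  rw [formH_eq]
  ext i j
  fin_cases i <;> fin_cases j <;> simp [matJ, Matrix.mul_apply, Fin.sum_univ_three]

theorem ProjMem.of_mul_eq_one {Γ : Subgroup (Matrix.SpecialLinearGroup (Fin 3) ℂ)}
    {A B : Matrix (Fin 3) (Fin 3) ℂ} (hA : ProjMem Γ A) (h : A * B = 1) : ProjMem Γ B := by
  obtain ⟨g, hg, ν, hν, e⟩ := hA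
  refine ⟨g⁻¹, Γ.inv_mem hg, ν⁻¹, by simp [hν], ?_⟩
  have hν0 : ν ≠ 0 := fun h => by simp [h] at hν
  have e1 : g.val * (ν⁻¹ • B) = 1 := by
    rw [e, smul_mul_smul_comm, mul_inv_cancel₀ hν0, h, one_smul]
  calc (g⁻¹).val = (g⁻¹).val * (g.val * (ν⁻¹ • B)) := by rw [e1, Matrix.mul_one]
    _ = ν⁻¹ • B := by
      rw [← Matrix.mul_assoc, ← Matrix.SpecialLinearGroup.coe_mul, inv_mul_cancel,
        Matrix.SpecialLinearGroup.coe_one, Matrix.one_mul]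

theorem projMem_matJ (ψ : ℝ) (τ : ℂ) : ProjMem (triangleGroup ψ τ) matJ :=
  ⟨elemJ, Subgroup.subset_closure (by simp), 1, by simp, by simp [elemJ]⟩

/-- The three basis vectors are normal to the mirrors of `R₁` and its conjugates by `J`. -/
theorem sesq_basis (ψ : ℝ) (τ : ℂ) (i : Fin 3) :
    sesq (formH ψ τ) (Pi.single i 1) (Pi.single i 1) = diagEntry ψ := by
  rw [formH_eq]
  fin_cases i <;> simp [sesq]

theorem exp_sub_one_div (ψ : ℝ) (h : diagEntry ψ ≠ 0) :
    (Complex.exp (Complex.I * ψ) - 1) / diagEntry ψ = halfRot ψ := by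
  have h' : (diagEntry ψ : ℂ) ≠ 0 := by exact_mod_cast h
  have hy := halfRot_ne_zero ψ
  rw [div_eq_iff h', exp_eq_neg_halfRot_sq, diagEntry, two_sin_half]
  field_simp
  ring

theorem exp_neg_sub_one_div (ψ : ℝ) (h : diagEntry ψ ≠ 0) :
    (Complex.exp (-(Complex.I * ψ)) - 1) / diagEntry ψ = (halfRot ψ)⁻¹ := by
  have h' : (diagEntry ψ : ℂ) ≠ 0 := by exact_mod_cast h
  have hy := halfRot_ne_zero ψ
  rw [div_eq_iff h', Complex.exp_neg, exp_eq_neg_halfRot_sq, diagEntry, two_sin_half]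
  field_simp
  ring

theorem projMem_crefl_zero (ψ : ℝ) (τ : ℂ) (h : diagEntry ψ ≠ 0) :
    ProjMem (triangleGroup ψ τ)
      (crefl (formH ψ τ) (Pi.single 0 1) (Complex.exp (Complex.I * ψ))) := by
  refine ⟨elemR₁ ψ τ, Subgroup.subset_closure (by simp), Complex.exp (-(Complex.I * ψ / 3)), ?_, ?_⟩
  · rw [Complex.norm_exp]
    simp
  · rw [crefl, sesq_basis, exp_sub_one_div ψ h]
    have e1 : Complex.exp (-(Complex.I * ψ / 3)) * Complex.exp (Complex.I * ψ) =
        Complex.exp (2 * Complex.I * ψ / 3) := by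
      rw [← Complex.exp_add]; congr 1; ring
    have e2 : Complex.exp (-(Complex.I * ψ / 3)) * (Complex.exp (Complex.I * ψ / 2) *
        Complex.exp (-(Complex.I * ψ / 6))) = 1 := by
      rw [← Complex.exp_add, ← Complex.exp_add, ← Complex.exp_zero]; congr 1; ring
    have e3 : Complex.exp (-(Complex.I * ψ / 3)) * (Complex.exp (Complex.I * ψ / 2) *
        Complex.exp (Complex.I * ψ / 6)) = Complex.exp (Complex.I * ψ / 3) := by
      rw [← Complex.exp_add, ← Complex.exp_add]; congr 1; ring
    have e4 : 1 + halfRot ψ * diagEntry ψ = Complex.exp (Complex.I * ψ) := by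
      have h' : (diagEntry ψ : ℂ) ≠ 0 := by exact_mod_cast h
      rw [← exp_sub_one_div ψ h]
      field_simp
      ring
    rw [formH_eq, conj_offDiag]
    ext i j
    fin_cases i <;> fin_cases j <;>
      simp [elemR₁, matR₁]
    · rw [e4, e1]
    · rw [halfRot, offDiag]
      linear_combination (-τ) * e2 + τ * Complex.I_sq * (Complex.exp (-(Complex.I * ψ / 3)) *
        (Complex.exp (Complex.I * ψ / 2) * Complex.exp (-(Complex.I * ψ / 6))))
    · rw [halfRot]
      linear_combination conj τ * e3 - conj τ * Complex.I_sq * (Complex.exp (-(Complex.I * ψ / 3)) *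
        (Complex.exp (Complex.I * ψ / 2) * Complex.exp (Complex.I * ψ / 6)))

/-! ### The orbit of the first basis vector -/

theorem matJ_mulVec_single (i : Fin 3) :
    matJ *ᵥ (Pi.single i 1 : Fin 3 → ℂ) = Pi.single (i + 1) 1 := by
  fin_cases i <;> (ext j; fin_cases j <;> simp [matJ])

theorem matJ_pow_three : matJ * (matJ * matJ) = 1 := by
  ext i j
  fin_cases i <;> fin_cases j <;> simp [matJ, Matrix.mul_apply, Fin.sum_univ_three]

theorem projMem_crefl_succ {ψ : ℝ} {τ μ : ℂ} {i : Fin 3}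
    (h : ProjMem (triangleGroup ψ τ) (crefl (formH ψ τ) (Pi.single i 1) μ)) :
    ProjMem (triangleGroup ψ τ) (crefl (formH ψ τ) (Pi.single (i + 1) 1) μ) := by
  have hJ := projMem_matJ ψ τ
  have h1 := (hJ.mul h).mul (hJ.mul hJ)
  rwa [mul_crefl (matJ_isometry ψ τ), matJ_mulVec_single, Matrix.mul_assoc, matJ_pow_three,
    Matrix.mul_one] at h1

theorem sesq_basis_ne_zero {ψ : ℝ} (τ : ℂ) (hd : diagEntry ψ ≠ 0) (i : Fin 3) :
    sesq (formH ψ τ) (Pi.single i 1) (Pi.single i 1) ≠ 0 := by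
  rw [sesq_basis]
  exact_mod_cast hd

/-- `R₁` and its conjugates by `J` are complex reflections of multiplier `e^{iψ}`, with the basis
vectors as normal vectors. -/
theorem projMem_crefl {ψ : ℝ} (τ : ℂ) (hd : diagEntry ψ ≠ 0) (i : Fin 3) :
    ProjMem (triangleGroup ψ τ)
      (crefl (formH ψ τ) (Pi.single i 1) (Complex.exp (Complex.I * ψ))) := by
  have h0 := projMem_crefl_zero ψ τ hd
  have h1 := projMem_crefl_succ h0
  have h2 := projMem_crefl_succ h1
  rw [zero_add] at h1
  rw [zero_add, show (1 + 1 : Fin 3) = 2 from rfl] at h2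
  match i with
  | 0 => exact h0
  | 1 => exact h1
  | 2 => exact h2

theorem projMem_crefl_inv {ψ : ℝ} (τ : ℂ) (hd : diagEntry ψ ≠ 0) (i : Fin 3) :
    ProjMem (triangleGroup ψ τ)
      (crefl (formH ψ τ) (Pi.single i 1) (Complex.exp (-(Complex.I * ψ)))) :=
  (projMem_crefl τ hd i).of_mul_eq_one (by
    rw [crefl_mul (sesq_basis_ne_zero τ hd i), ← Complex.exp_add, add_neg_cancel, Complex.exp_zero,
      crefl_one])

theorem norm_exp_I_mul (ψ : ℝ) : ‖Complex.exp (Complex.I * ψ)‖ = 1 := by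
  rw [mul_comm]; exact Complex.norm_exp_ofReal_mul_I ψ

theorem norm_exp_neg_I_mul (ψ : ℝ) : ‖Complex.exp (-(Complex.I * ψ))‖ = 1 := by
  rw [Complex.exp_neg, norm_inv, norm_exp_I_mul, inv_one]

/-- `v` is the image of the first basis vector under a product of conjugates of `R₁` and `J`,
normalized to act as isometries of the form. -/
def InOrbit (ψ : ℝ) (τ : ℂ) (v : Fin 3 → ℂ) : Prop :=
  ∃ T, ProjMem (triangleGroup ψ τ) T ∧ Tᴴ * formH ψ τ * T = formH ψ τ ∧
    T *ᵥ Pi.single 0 1 = v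

section Orbit

variable {ψ : ℝ} {τ : ℂ} {v : Fin 3 → ℂ} {v₀ v₁ v₂ : ℂ}

theorem InOrbit.mulVec (h : InOrbit ψ τ v) {S : Matrix (Fin 3) (Fin 3) ℂ}
    (hS : ProjMem (triangleGroup ψ τ) S) (hS' : Sᴴ * formH ψ τ * S = formH ψ τ) :
    InOrbit ψ τ (S *ᵥ v) := by
  obtain ⟨T, h1, h2, rfl⟩ := h
  exact ⟨S * T, hS.mul h1, mul_isometry hS' h2, (Matrix.mulVec_mulVec _ _ _).symm⟩

theorem single_zero_eq : (Pi.single 0 1 : Fin 3 → ℂ) = ![1, 0, 0] := by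
  ext i; fin_cases i <;> simp

theorem single_one_eq : (Pi.single 1 1 : Fin 3 → ℂ) = ![0, 1, 0] := by
  ext i; fin_cases i <;> simp

theorem single_two_eq : (Pi.single 2 1 : Fin 3 → ℂ) = ![0, 0, 1] := by
  ext i; fin_cases i <;> simp

theorem InOrbit.zero : InOrbit ψ τ ![1, 0, 0] :=
  ⟨1, ProjMem.one, by simp, by rw [Matrix.one_mulVec, single_zero_eq]⟩

theorem InOrbit.rotate (h : InOrbit ψ τ ![v₀, v₁, v₂]) : InOrbit ψ τ ![v₂, v₀, v₁] := by
  rw [← matJ_mulVec]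
  exact h.mulVec (projMem_matJ ψ τ) (matJ_isometry ψ τ)

theorem InOrbit.one : InOrbit ψ τ ![0, 1, 0] := InOrbit.zero.rotate

theorem InOrbit.two : InOrbit ψ τ ![0, 0, 1] := InOrbit.one.rotate

theorem InOrbit.refl (h : InOrbit ψ τ v) (hd : diagEntry ψ ≠ 0) (i : Fin 3) :
    InOrbit ψ τ (v + (halfRot ψ * sesq (formH ψ τ) (Pi.single i 1) v) • Pi.single i 1) := by
  have h1 := crefl_mulVec (H := formH ψ τ) (Pi.single i 1) v (Complex.exp (Complex.I * ψ))
  rw [sesq_basis, exp_sub_one_div ψ hd] at h1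
  rw [← h1]
  exact h.mulVec (projMem_crefl τ hd i)
    (crefl_isometry (formH_isHermitian ψ τ) (sesq_basis_ne_zero τ hd i) (norm_exp_I_mul ψ))

theorem InOrbit.refl_inv (h : InOrbit ψ τ v) (hd : diagEntry ψ ≠ 0) (i : Fin 3) :
    InOrbit ψ τ (v + ((halfRot ψ)⁻¹ * sesq (formH ψ τ) (Pi.single i 1) v) • Pi.single i 1) := by
  have h1 := crefl_mulVec (H := formH ψ τ) (Pi.single i 1) v (Complex.exp (-(Complex.I * ψ)))
  rw [sesq_basis, exp_neg_sub_one_div ψ hd] at h1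
  rw [← h1]
  exact h.mulVec (projMem_crefl_inv τ hd i)
    (crefl_isometry (formH_isHermitian ψ τ) (sesq_basis_ne_zero τ hd i) (norm_exp_neg_I_mul ψ))

theorem InOrbit.refl_one (h : InOrbit ψ τ ![v₀, v₁, v₂]) (hd : diagEntry ψ ≠ 0) :
    InOrbit ψ τ ![v₀, v₁ + halfRot ψ *
      (conj (offDiag ψ τ) * v₀ + diagEntry ψ * v₁ + offDiag ψ τ * v₂), v₂] := by
  have := h.refl hd 1
  rw [single_one_eq, sesq_formH] at this
  simpa using this

theorem InOrbit.refl_two (h : InOrbit ψ τ ![v₀, v₁, v₂]) (hd : diagEntry ψ ≠ 0) :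
    InOrbit ψ τ ![v₀, v₁, v₂ + halfRot ψ *
      (offDiag ψ τ * v₀ + conj (offDiag ψ τ) * v₁ + diagEntry ψ * v₂)] := by
  have := h.refl hd 2
  rw [single_two_eq, sesq_formH] at this
  simpa using this

theorem InOrbit.refl_inv_one (h : InOrbit ψ τ ![v₀, v₁, v₂]) (hd : diagEntry ψ ≠ 0) :
    InOrbit ψ τ ![v₀, v₁ + (halfRot ψ)⁻¹ *
      (conj (offDiag ψ τ) * v₀ + diagEntry ψ * v₁ + offDiag ψ τ * v₂), v₂] := by
  have := h.refl_inv hd 1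
  rw [single_one_eq, sesq_formH] at this
  simpa using this

theorem InOrbit.refl_inv_two (h : InOrbit ψ τ ![v₀, v₁, v₂]) (hd : diagEntry ψ ≠ 0) :
    InOrbit ψ τ ![v₀, v₁, v₂ + (halfRot ψ)⁻¹ *
      (offDiag ψ τ * v₀ + conj (offDiag ψ τ) * v₁ + diagEntry ψ * v₂)] := by
  have := h.refl_inv hd 2
  rw [single_two_eq, sesq_formH] at this
  simpa using this

theorem diagEntry_sq_pos (hd : diagEntry ψ ≠ 0) : 0 < 2 - 2 * Real.cos ψ := by
  rw [← diagEntry_sq]; positivity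

theorem normSq_exp_sub_one (ψ : ℝ) :
    Complex.normSq (Complex.exp (Complex.I * ψ) - 1) = 2 - 2 * Real.cos ψ := by
  rw [mul_comm, Complex.normSq_apply, Complex.sub_re, Complex.sub_im,
    Complex.exp_ofReal_mul_I_re, Complex.exp_ofReal_mul_I_im, Complex.one_re, Complex.one_im]
  linear_combination Real.sin_sq_add_cos_sq ψ

/-- The first coordinate of `H v`, for `v` in the orbit of the first basis vector `e`, is
`⟨e, v⟩`; its squared modulus `L` is `s X` in the notation of the two criteria, because
`⟨e, e⟩² = s`. -/
theorem InOrbit.exists_isometry (h : InOrbit ψ τ ![v₀, v₁, v₂]) (hd : diagEntry ψ ≠ 0) {L : ℝ}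
    (hL : Complex.normSq (diagEntry ψ * v₀ + offDiag ψ τ * v₁ + conj (offDiag ψ τ) * v₂) = L) :
    ∃ T, ProjMem (triangleGroup ψ τ) T ∧ Tᴴ * formH ψ τ * T = formH ψ τ ∧
      Complex.normSq (sesq (formH ψ τ) (Pi.single 0 1) (T *ᵥ Pi.single 0 1)) =
        L / (2 - 2 * Real.cos ψ) *
          Complex.normSq (sesq (formH ψ τ) (Pi.single 0 1) (Pi.single 0 1)) := by
  obtain ⟨T, h1, h2, h3⟩ := h
  refine ⟨T, h1, h2, ?_⟩
  rw [h3, sesq_basis, Complex.normSq_ofReal, ← sq, diagEntry_sq,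
    div_mul_cancel₀ _ (diagEntry_sq_pos hd).ne', single_zero_eq, sesq_formH, ← hL]
  simp

/-- The Jørgensen-type criterion for `R₁` and its conjugate by an isometry `T` with `T e = v`. -/
theorem not_discrete_of_orbit_jorgensen (h : InOrbit ψ τ ![v₀, v₁, v₂]) (hd : diagEntry ψ ≠ 0)
    {L : ℝ}
    (hL : Complex.normSq (diagEntry ψ * v₀ + offDiag ψ τ * v₁ + conj (offDiag ψ τ) * v₂) = L)
    (hL0 : 0 < L) (hL1 : L < 1) (hs : 2 - 2 * Real.cos ψ ≤ 1) (hLs : L ≠ 2 - 2 * Real.cos ψ) :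
    ¬ IsDiscreteGroup (triangleGroup ψ τ) := by
  obtain ⟨T, h1, h2, h3⟩ := h.exists_isometry hd hL
  have hpos := diagEntry_sq_pos hd
  have hn := normSq_exp_sub_one ψ
  refine not_discrete_of_jorgensen (formH_isHermitian ψ τ) (norm_exp_I_mul ψ)
    (sesq_basis_ne_zero τ hd 0) (projMem_crefl τ hd 0) h1 h2 h3 (by positivity) ?_ (by rwa [hn])
    ?_ ?_
  · rwa [Ne, div_eq_one_iff_eq hpos.ne']
  · rwa [hn, mul_div_cancel₀ _ hpos.ne']
  · intro h
    rw [h, sub_self, map_zero] at hn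
    exact hpos.ne hn

/-- The product of `R₁` and its conjugate by an isometry `T` with `T e = v` has infinite order as
soon as a Galois conjugate of `|⟨e, v⟩|²` exceeds `4`. -/
theorem not_discrete_of_orbit_irrational (h : InOrbit ψ τ ![v₀, v₁, v₂]) (hd : diagEntry ψ ≠ 0)
    {L L' : ℝ} {φ : algebraicClosure ℚ ℂ →ₐ[ℚ] ℂ}
    (hL : Complex.normSq (diagEntry ψ * v₀ + offDiag ψ τ * v₁ + conj (offDiag ψ τ) * v₂) = L)
    (hL0 : 0 < L) (hL4 : L < 4) (hLs : L ≠ 2 - 2 * Real.cos ψ) (hφ : GalConj φ L L')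
    (hL' : 4 < L') : ¬ IsDiscreteGroup (triangleGroup ψ τ) := by
  obtain ⟨T, h1, h2, h3⟩ := h.exists_isometry hd hL
  have hpos := diagEntry_sq_pos hd
  have hn := normSq_exp_sub_one ψ
  refine not_discrete_of_irrational_angle (formH_isHermitian ψ τ) (norm_exp_I_mul ψ)
    (sesq_basis_ne_zero τ hd 0) (projMem_crefl τ hd 0) h1 h2 h3 ?_ ?_ hL0 hL4
    (hφ.add_inv_ne hL')
  · rwa [Ne, div_eq_one_iff_eq hpos.ne']
  · rw [hn, mul_div_cancel₀ _ hpos.ne']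

end Orbit

/-! ### Some orbit vectors and the invariants `|⟨e, v⟩|²`

All invariants are polynomials in the cosine and the sine of the angle and in `|τ|²`, `Re τ³`,
`Im τ³`. They are verified by expressing these five numbers in terms of `halfRot ψ` and
`offDiag ψ τ`. -/

section Words

variable {ψ : ℝ} {τ : ℂ}

theorem ofReal_diagEntry (ψ : ℝ) : (diagEntry ψ : ℂ) = -(halfRot ψ + (halfRot ψ)⁻¹) :=
  two_sin_half ψ

theorem ofReal_normSq_eq (ψ : ℝ) (τ : ℂ) :
    (Complex.normSq τ : ℂ) = offDiag ψ τ * conj (offDiag ψ τ) := (offDiag_mul_conj ψ τ).symm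

theorem conj_pow_three_eq (ψ : ℝ) (τ : ℂ) :
    conj (τ ^ 3) = -(halfRot ψ)⁻¹ * conj (offDiag ψ τ) ^ 3 := by
  rw [pow_three_eq_offDiag ψ, map_mul, map_neg, conj_halfRot_eq_inv, map_pow]

theorem ofReal_re_pow_three (ψ : ℝ) (τ : ℂ) : ((τ ^ 3).re : ℂ) =
    -(halfRot ψ * offDiag ψ τ ^ 3 + (halfRot ψ)⁻¹ * conj (offDiag ψ τ) ^ 3) / 2 := by
  rw [Complex.re_eq_add_conj, conj_pow_three_eq ψ, pow_three_eq_offDiag ψ]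
  ring

theorem ofReal_im_pow_three (ψ : ℝ) (τ : ℂ) : ((τ ^ 3).im : ℂ) =
    -(halfRot ψ * offDiag ψ τ ^ 3 - (halfRot ψ)⁻¹ * conj (offDiag ψ τ) ^ 3) / (2 * Complex.I) := by
  rw [Complex.im_eq_sub_conj, conj_pow_three_eq ψ, pow_three_eq_offDiag ψ]
  ring

/-- `|⟨e₁, R₂ R₃ e₁⟩|²`. -/
noncomputable def coxeterInv (C S t R I : ℝ) : ℝ :=
  (2 - 2 * C) * (1 - (2 * t - R)) + (4 * t ^ 2 - 4 * t * R + t ^ 3) + 2 * S * I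

theorem exists_orbit_coxeterInv (hd : diagEntry ψ ≠ 0) : ∃ v₀ v₁ v₂, InOrbit ψ τ ![v₀, v₁, v₂] ∧
    Complex.normSq (diagEntry ψ * v₀ + offDiag ψ τ * v₁ + conj (offDiag ψ τ) * v₂) =
      coxeterInv (Real.cos ψ) (Real.sin ψ) (Complex.normSq τ) (τ ^ 3).re (τ ^ 3).im := by
  refine ⟨_, _, _, (InOrbit.zero.refl_two hd).refl_one hd, Complex.ofReal_injective ?_⟩
  unfold coxeterInv
  push_cast
  rw [Complex.normSq_eq_conj_mul_self, complex_cos_eq, complex_sin_eq, ofReal_normSq_eq ψ,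
    ofReal_re_pow_three ψ, ofReal_im_pow_three ψ, ofReal_diagEntry]
  simp only [map_add, map_mul, map_neg, map_inv₀, map_one, map_zero, Complex.conj_conj,
    conj_halfRot_eq_inv, inv_inv]
  have hy := halfRot_ne_zero ψ
  have hI := Complex.I_ne_zero
  field_simp
  ring

/-- The vector `R₃ e₂`. -/
theorem exists_orbit_three_two (hd : diagEntry ψ ≠ 0) : ∃ v₀ v₁ v₂, InOrbit ψ τ ![v₀, v₁, v₂] ∧
    Complex.normSq (diagEntry ψ * v₀ + offDiag ψ τ * v₁ + conj (offDiag ψ τ) * v₂) =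
      Complex.normSq τ + Complex.normSq τ ^ 2 +
        2 * (Real.cos ψ * (τ ^ 3).re + Real.sin ψ * (τ ^ 3).im) := by
  refine ⟨_, _, _, InOrbit.one.refl_two hd, Complex.ofReal_injective ?_⟩
  push_cast
  rw [Complex.normSq_eq_conj_mul_self, complex_cos_eq, complex_sin_eq, ofReal_normSq_eq ψ,
    ofReal_re_pow_three ψ, ofReal_im_pow_three ψ, ofReal_diagEntry]
  simp only [map_add, map_mul, map_neg, map_inv₀, map_one, map_zero, Complex.conj_conj,
    conj_halfRot_eq_inv, inv_inv]
  have hy := halfRot_ne_zero ψ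
  have hI := Complex.I_ne_zero
  field_simp
  ring

/-- The vector `R₃⁻¹ R₂ e₃`. -/
theorem exists_orbit_conj_two_three (hd : diagEntry ψ ≠ 0) :
    ∃ v₀ v₁ v₂, InOrbit ψ τ ![v₀, v₁, v₂] ∧
    Complex.normSq (diagEntry ψ * v₀ + offDiag ψ τ * v₁ + conj (offDiag ψ τ) * v₂) =
      Complex.normSq τ * (1 + 2 * Complex.normSq τ * Real.cos ψ + Complex.normSq τ ^ 2) +
        Complex.normSq τ ^ 2 - 2 * Complex.normSq τ * (τ ^ 3).re -
        2 * (Real.cos ψ * (τ ^ 3).re - Real.sin ψ * (τ ^ 3).im) := by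
  refine ⟨_, _, _, (InOrbit.two.refl_one hd).refl_inv_two hd, Complex.ofReal_injective ?_⟩
  push_cast
  rw [Complex.normSq_eq_conj_mul_self, complex_cos_eq, complex_sin_eq, ofReal_normSq_eq ψ,
    ofReal_re_pow_three ψ, ofReal_im_pow_three ψ, ofReal_diagEntry]
  simp only [map_add, map_mul, map_neg, map_inv₀, map_one, map_zero, Complex.conj_conj,
    conj_halfRot_eq_inv, inv_inv]
  have hy := halfRot_ne_zero ψ
  have hI := Complex.I_ne_zero
  field_simp
  ring

/-- The vector `(R₃⁻¹ R₂⁻¹)² e₃`. -/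
theorem exists_orbit_inv_sq (hd : diagEntry ψ ≠ 0) :
    ∃ v₀ v₁ v₂, InOrbit ψ τ ![v₀, v₁, v₂] ∧
    Complex.normSq (diagEntry ψ * v₀ + offDiag ψ τ * v₁ + conj (offDiag ψ τ) * v₂) =
      Complex.normSq τ * ((2 - Complex.normSq τ) * (1 - Complex.normSq τ) - 1) ^ 2 +
        (2 - Complex.normSq τ) ^ 2 * Complex.normSq τ ^ 2 +
        2 * (2 - Complex.normSq τ) * ((2 - Complex.normSq τ) * (1 - Complex.normSq τ) - 1) *
          (τ ^ 3).re := by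
  refine ⟨_, _, _, (((InOrbit.two.refl_inv_one hd).refl_inv_two hd).refl_inv_one hd).refl_inv_two
    hd, Complex.ofReal_injective ?_⟩
  push_cast
  rw [Complex.normSq_eq_conj_mul_self, ofReal_normSq_eq ψ,
    ofReal_re_pow_three ψ, ofReal_diagEntry]
  simp only [map_add, map_mul, map_neg, map_inv₀, map_one, map_zero, Complex.conj_conj,
    conj_halfRot_eq_inv, inv_inv]
  have hy := halfRot_ne_zero ψ
  have hI := Complex.I_ne_zero
  field_simp
  ring

end Words

/-! ### Complex reflections in a power of `R₁ R₂` -/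

section LineReflection

variable {ψ : ℝ} {τ : ℂ}

/-- A vector orthogonal to the first two basis vectors. -/
noncomputable def polarVec (ψ : ℝ) (τ : ℂ) : Fin 3 → ℂ :=
  ![offDiag ψ τ ^ 2 - conj (offDiag ψ τ) * diagEntry ψ,
    conj (offDiag ψ τ) ^ 2 - offDiag ψ τ * diagEntry ψ,
    diagEntry ψ ^ 2 - offDiag ψ τ * conj (offDiag ψ τ)]

/-- The determinant of `formH ψ τ`, in terms of its entries. -/
noncomputable def formDet (ψ : ℝ) (τ : ℂ) : ℂ :=
  diagEntry ψ ^ 3 + offDiag ψ τ ^ 3 + conj (offDiag ψ τ) ^ 3 -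
    3 * diagEntry ψ * (offDiag ψ τ * conj (offDiag ψ τ))

theorem formDet_eq_det (ψ : ℝ) (τ : ℂ) : (formH ψ τ).det = formDet ψ τ := by
  rw [formH_eq, Matrix.det_fin_three, formDet]
  simp
  ring

theorem sesq_single_zero_polarVec : sesq (formH ψ τ) (Pi.single 0 1) (polarVec ψ τ) = 0 := by
  rw [single_zero_eq, polarVec, sesq_formH]
  simp only [map_one, map_zero]
  ring

theorem sesq_single_one_polarVec : sesq (formH ψ τ) (Pi.single 1 1) (polarVec ψ τ) = 0 := by
  rw [single_one_eq, polarVec, sesq_formH]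
  simp only [map_one, map_zero]
  ring

theorem sesq_polarVec_self : sesq (formH ψ τ) (polarVec ψ τ) (polarVec ψ τ) =
    (diagEntry ψ ^ 2 - offDiag ψ τ * conj (offDiag ψ τ)) * formDet ψ τ := by
  rw [polarVec, sesq_formH, formDet]
  simp only [map_sub, map_mul, map_pow, Complex.conj_conj, Complex.conj_ofReal]
  ring

theorem sesq_polarVec_matJ : sesq (formH ψ τ) (polarVec ψ τ) (matJ *ᵥ polarVec ψ τ) =
    (conj (offDiag ψ τ) ^ 2 - offDiag ψ τ * diagEntry ψ) * formDet ψ τ := by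
  rw [polarVec, matJ_mulVec, sesq_formH, formDet]
  simp only [map_sub, map_mul, map_pow, Complex.conj_conj, Complex.conj_ofReal]
  ring

/-- The value of `X = |⟨c, J c⟩|² / ⟨c, c⟩²` for the vector `c` orthogonal to the first two basis
vectors, as a function of the cosine `C` and the sine `S` of the angle and of
`t = |τ|²`, `R = Re τ³`, `I = Im τ³`. -/
noncomputable def lineInv (C S t R I : ℝ) : ℝ :=
  (t ^ 2 + (2 - 2 * C) * (t - R) + 2 * S * I) / (t - (2 - 2 * C)) ^ 2

theorem formDet_mul_diagEntry (ψ : ℝ) (τ : ℂ) : formDet ψ τ * diagEntry ψ =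
    ((2 - 2 * Real.cos ψ) ^ 2 - 3 * (2 - 2 * Real.cos ψ) * Complex.normSq τ +
      (2 - 2 * Real.cos ψ) * (τ ^ 3).re - 2 * Real.sin ψ * (τ ^ 3).im : ℝ) := by
  unfold formDet
  push_cast
  rw [complex_cos_eq, complex_sin_eq, ofReal_normSq_eq ψ,
    ofReal_re_pow_three ψ, ofReal_im_pow_three ψ, ofReal_diagEntry]
  have hy := halfRot_ne_zero ψ
  have hI := Complex.I_ne_zero
  field_simp
  ring

theorem normSq_sesq_polarVec_matJ :
    Complex.normSq (conj (offDiag ψ τ) ^ 2 - offDiag ψ τ * diagEntry ψ) =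
      Complex.normSq τ ^ 2 + (2 - 2 * Real.cos ψ) * (Complex.normSq τ - (τ ^ 3).re) +
        2 * Real.sin ψ * (τ ^ 3).im := by
  apply Complex.ofReal_injective
  push_cast
  rw [Complex.normSq_eq_conj_mul_self, complex_cos_eq, complex_sin_eq, ofReal_normSq_eq ψ,
    ofReal_re_pow_three ψ, ofReal_im_pow_three ψ, ofReal_diagEntry]
  simp only [map_sub, map_add, map_mul, map_neg, map_inv₀, map_pow, Complex.conj_conj,
    conj_halfRot_eq_inv, inv_inv]
  have hy := halfRot_ne_zero ψ
  have hI := Complex.I_ne_zero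
  field_simp
  ring

theorem minor_eq (ψ : ℝ) (τ : ℂ) : (diagEntry ψ : ℂ) ^ 2 - offDiag ψ τ * conj (offDiag ψ τ) =
    (2 - 2 * Real.cos ψ - Complex.normSq τ : ℝ) := by
  rw [offDiag_mul_conj, ← Complex.ofReal_pow, diagEntry_sq]
  push_cast
  ring

/-- Up to a nonnegative factor, `lineInv - 1` is minus the determinant of the form times its
diagonal entry. -/
theorem lineInv_sub_one (ht : Complex.normSq τ ≠ 2 - 2 * Real.cos ψ) :
    (lineInv (Real.cos ψ) (Real.sin ψ) (Complex.normSq τ) (τ ^ 3).re (τ ^ 3).im - 1) *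
      (Complex.normSq τ - (2 - 2 * Real.cos ψ)) ^ 2 =
    -((2 - 2 * Real.cos ψ) ^ 2 - 3 * (2 - 2 * Real.cos ψ) * Complex.normSq τ +
      (2 - 2 * Real.cos ψ) * (τ ^ 3).re - 2 * Real.sin ψ * (τ ^ 3).im) := by
  have h := sub_ne_zero.2 ht
  rw [lineInv, sub_mul, div_mul_cancel₀ _ (pow_ne_zero 2 h)]
  ring

theorem sesq_polarVec_ne_zero (ht : Complex.normSq τ ≠ 2 - 2 * Real.cos ψ)
    (hX : lineInv (Real.cos ψ) (Real.sin ψ) (Complex.normSq τ) (τ ^ 3).re (τ ^ 3).im ≠ 1) :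
    sesq (formH ψ τ) (polarVec ψ τ) (polarVec ψ τ) ≠ 0 := by
  rw [sesq_polarVec_self, minor_eq]
  refine mul_ne_zero ?_ ?_
  · exact_mod_cast sub_ne_zero.2 ht.symm
  · intro h
    have h1 := formDet_mul_diagEntry ψ τ
    rw [h, zero_mul] at h1
    have h2 := lineInv_sub_one ht
    rw [← Complex.ofReal_zero, Complex.ofReal_inj] at h1
    rw [← h1, neg_zero, mul_eq_zero] at h2
    exact h2.elim (sub_ne_zero.2 hX) (pow_ne_zero 2 (sub_ne_zero.2 ht))

theorem normSq_sesq_polarVec (ht : Complex.normSq τ ≠ 2 - 2 * Real.cos ψ) :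
    Complex.normSq (sesq (formH ψ τ) (polarVec ψ τ) (matJ *ᵥ polarVec ψ τ)) =
      lineInv (Real.cos ψ) (Real.sin ψ) (Complex.normSq τ) (τ ^ 3).re (τ ^ 3).im *
        Complex.normSq (sesq (formH ψ τ) (polarVec ψ τ) (polarVec ψ τ)) := by
  rw [sesq_polarVec_matJ, sesq_polarVec_self, minor_eq, map_mul, map_mul, Complex.normSq_ofReal,
    normSq_sesq_polarVec_matJ, ← mul_assoc, lineInv,
    show ∀ s : ℝ, (s - Complex.normSq τ) * (s - Complex.normSq τ) =
      (Complex.normSq τ - s) ^ 2 from fun s => by ring,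
    div_mul_cancel₀ _ (pow_ne_zero 2 (sub_ne_zero.2 ht))]

/-- The scalar recursion satisfied by the powers of a `2 × 2` matrix of determinant `ζ²` and
trace `ζ r` forces its `n`-th power to be the scalar `κ`. -/
def PowScalar (ζ r κ : ℂ) (n : ℕ) : Prop :=
  ∀ u : ℕ → ℂ, (∀ k, u (k + 2) = ζ * r * u (k + 1) - ζ ^ 2 * u k) → u n = κ * u 0

theorem powScalar_two (ζ : ℂ) : PowScalar ζ 0 (-ζ ^ 2) 2 := by
  intro u hu
  rw [hu 0]
  ring

theorem powScalar_three (ζ : ℂ) : PowScalar ζ (-1) (ζ ^ 3) 3 := by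
  intro u hu
  rw [hu 1, hu 0]
  ring

theorem powScalar_five (ζ : ℂ) {r : ℂ} (hr : r ^ 2 + r = 1) : PowScalar ζ r (ζ ^ 5) 5 := by
  intro u hu
  rw [hu 3, hu 2, hu 1, hu 0]
  linear_combination (ζ ^ 4 * u 1 * (r ^ 2 - r - 1) - ζ ^ 5 * u 0 * (r - 1)) * hr

theorem powScalar_seven (ζ : ℂ) {r : ℂ} (hr : r ^ 3 + r ^ 2 - 2 * r - 1 = 0) :
    PowScalar ζ r (ζ ^ 7) 7 := by
  intro u hu
  rw [hu 5, hu 4, hu 3, hu 2, hu 1, hu 0]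
  linear_combination (ζ ^ 6 * u 1 * (r ^ 3 - r ^ 2 - 2 * r + 1) -
    ζ ^ 7 * u 0 * (r ^ 2 - r - 1)) * hr

theorem mulVec_pow_eq_of_powScalar {ζ r κ : ℂ} {n : ℕ} (h : PowScalar ζ r κ n)
    {M : Matrix (Fin 3) (Fin 3) ℂ} {v : Fin 3 → ℂ}
    (hM : M *ᵥ (M *ᵥ v) = (ζ * r) • (M *ᵥ v) - ζ ^ 2 • v) : M ^ n *ᵥ v = κ • v := by
  ext i
  have hrec : ∀ k, M ^ (k + 2) *ᵥ v = (ζ * r) • (M ^ (k + 1) *ᵥ v) - ζ ^ 2 • (M ^ k *ᵥ v) := by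
    intro k
    rw [pow_add, pow_add, ← Matrix.mulVec_mulVec, ← Matrix.mulVec_mulVec, pow_one, pow_two,
      ← Matrix.mulVec_mulVec, hM, Matrix.mulVec_sub, Matrix.mulVec_smul, Matrix.mulVec_smul]
  have := h (fun k => (M ^ k *ᵥ v) i) (fun k => by
    rw [hrec]; rfl)
  simpa using this

/-- `R₁ R₂` fixes the vector `c` orthogonal to `e₁` and `e₂`. If its `n`-th power acts as a scalar
`κ` on the span of `e₁` and `e₂`, this power is, up to the scalar `κ`, the complex reflection with
normal vector `c` and multiplier `κ⁻¹`. -/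
theorem projMem_crefl_polarVec (hd : diagEntry ψ ≠ 0)
    (ht : Complex.normSq τ ≠ 2 - 2 * Real.cos ψ)
    (hc : sesq (formH ψ τ) (polarVec ψ τ) (polarVec ψ τ) ≠ 0) {n : ℕ} {κ : ℂ} (hκ : ‖κ‖ = 1)
    (hn : PowScalar (Complex.exp (Complex.I * ψ)) (2 - Complex.normSq τ) κ n) :
    ProjMem (triangleGroup ψ τ) (crefl (formH ψ τ) (polarVec ψ τ) κ⁻¹) := by
  have hκ0 : κ ≠ 0 := fun h => by simp [h] at hκ
  have hH := formH_isHermitian ψ τ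
  set ζ := Complex.exp (Complex.I * ψ) with hζ
  set H := formH ψ τ with hHdef
  set c := polarVec ψ τ with hcdef
  set e₁ : Fin 3 → ℂ := Pi.single 0 1 with he₁
  set e₂ : Fin 3 → ℂ := Pi.single 1 1 with he₂
  set M := crefl H e₁ ζ * crefl H e₂ ζ with hM
  have hMΓ : ProjMem (triangleGroup ψ τ) (M ^ n) :=
    ((projMem_crefl τ hd 0).mul (projMem_crefl τ hd 1)).pow n
  set y := halfRot ψ with hy
  set a := offDiag ψ τ with ha
  have hd' : (ζ - 1) / diagEntry ψ = y := exp_sub_one_div ψ hd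
  have hζy : ζ = -y ^ 2 := exp_eq_neg_halfRot_sq ψ
  have hyd : y * diagEntry ψ = ζ - 1 := by
    rw [← hd', div_mul_cancel₀]
    exact_mod_cast hd
  have hab : a * conj a = Complex.normSq τ := offDiag_mul_conj ψ τ
  have h12 : sesq H e₁ e₂ = a := by
    rw [he₁, he₂, single_zero_eq, single_one_eq, hHdef, sesq_formH]; simp [ha]
  have h21 : sesq H e₂ e₁ = conj a := by rw [← sesq_conj hH, h12]
  have h11 : sesq H e₁ e₁ = diagEntry ψ := sesq_basis ψ τ 0
  have h22 : sesq H e₂ e₂ = diagEntry ψ := sesq_basis ψ τ 1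
  have hR1e1 : crefl H e₁ ζ *ᵥ e₁ = ζ • e₁ :=
    crefl_mulVec_self (by rw [h11]; exact_mod_cast hd) ζ
  have hR2e2 : crefl H e₂ ζ *ᵥ e₂ = ζ • e₂ :=
    crefl_mulVec_self (by rw [h22]; exact_mod_cast hd) ζ
  have hR1e2 : crefl H e₁ ζ *ᵥ e₂ = e₂ + (y * a) • e₁ := by
    rw [crefl_mulVec, h11, h12, hd']
  have hR2e1 : crefl H e₂ ζ *ᵥ e₁ = e₁ + (y * conj a) • e₂ := by
    rw [crefl_mulVec, h22, h21, hd']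
  have hMe1 : M *ᵥ e₁ = (ζ * (1 - Complex.normSq τ)) • e₁ + (y * conj a) • e₂ := by
    rw [hM, ← Matrix.mulVec_mulVec, hR2e1, Matrix.mulVec_add, Matrix.mulVec_smul, hR1e1, hR1e2,
      ← hab]
    have : ζ * (1 - a * conj a) = ζ + y * conj a * (y * a) := by
      linear_combination (-(a * conj a)) * hζy
    rw [this]
    module
  have hMe2 : M *ᵥ e₂ = ζ • e₂ + (ζ * (y * a)) • e₁ := by
    rw [hM, ← Matrix.mulVec_mulVec, hR2e2, Matrix.mulVec_smul, hR1e2]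
    module
  -- Cayley–Hamilton on the span of `e₁` and `e₂`
  have hM1 : M *ᵥ (M *ᵥ e₁) = (ζ * (2 - Complex.normSq τ)) • (M *ᵥ e₁) - ζ ^ 2 • e₁ := by
    have e : y * conj a * (ζ * (y * a)) = -(ζ ^ 2 * Complex.normSq τ) := by
      linear_combination (y ^ 2 * ζ) * hab + (ζ * Complex.normSq τ) * hζy
    calc M *ᵥ (M *ᵥ e₁) =
          (ζ * (1 - Complex.normSq τ)) • (M *ᵥ e₁) + (y * conj a) • (M *ᵥ e₂) := by
          conv_lhs => rw [hMe1, Matrix.mulVec_add, Matrix.mulVec_smul, Matrix.mulVec_smul]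
      _ = (ζ * (1 - Complex.normSq τ)) • (M *ᵥ e₁) + (y * conj a * (ζ * (y * a))) • e₁ +
          (y * conj a * ζ) • e₂ := by rw [hMe2]; module
      _ = _ := by rw [e, hMe1]; module
  have hM2 : M *ᵥ (M *ᵥ e₂) = (ζ * (2 - Complex.normSq τ)) • (M *ᵥ e₂) - ζ ^ 2 • e₂ := by
    have e : ζ * (y * a) * (y * conj a) = -(ζ ^ 2 * Complex.normSq τ) := by
      linear_combination (y ^ 2 * ζ) * hab + (ζ * Complex.normSq τ) * hζy
    calc M *ᵥ (M *ᵥ e₂) = ζ • (M *ᵥ e₂) + (ζ * (y * a)) • (M *ᵥ e₁) := by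
          conv_lhs => rw [hMe2, Matrix.mulVec_add, Matrix.mulVec_smul, Matrix.mulVec_smul]
      _ = ζ • (M *ᵥ e₂) + (ζ * (y * a) * (y * conj a)) • e₂ +
          (ζ * (y * a) * (ζ * (1 - Complex.normSq τ))) • e₁ := by rw [hMe1]; module
      _ = _ := by rw [e, hMe2]; module
  have hMc : M *ᵥ c = c := by
    rw [hM, ← Matrix.mulVec_mulVec, crefl_mulVec_of_orthogonal sesq_single_one_polarVec,
      crefl_mulVec_of_orthogonal sesq_single_zero_polarVec]
  have hpc : M ^ n *ᵥ c = c := by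
    clear hMΓ hn
    induction n with
    | zero => simp
    | succ n ih => rw [pow_succ, ← Matrix.mulVec_mulVec, hMc, ih]
  have hp1 : M ^ n *ᵥ e₁ = κ • e₁ := mulVec_pow_eq_of_powScalar hn hM1
  have hp2 : M ^ n *ᵥ e₂ = κ • e₂ := mulVec_pow_eq_of_powScalar hn hM2
  have hc1 : sesq H c e₁ = 0 := by rw [← sesq_conj hH, sesq_single_zero_polarVec, map_zero]
  have hc2 : sesq H c e₂ = 0 := by rw [← sesq_conj hH, sesq_single_one_polarVec, map_zero]
  have hc3 : c 2 ≠ 0 := by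
    have : c 2 = (2 - 2 * Real.cos ψ - Complex.normSq τ : ℝ) := minor_eq ψ τ
    rw [this]
    exact_mod_cast sub_ne_zero.2 ht.symm
  have hkey : M ^ n = κ • crefl H c κ⁻¹ := by
    refine matrix_ext_mulVec fun x => ?_
    have hx : x = (x 0 - x 2 / c 2 * c 0) • e₁ + (x 1 - x 2 / c 2 * c 1) • e₂ +
        (x 2 / c 2) • c := by
      ext i
      fin_cases i
      · simp [he₁, he₂]
      · simp [he₁, he₂]
      · simp [he₁, he₂, hc3]
    rw [hx]
    simp only [Matrix.mulVec_add, Matrix.mulVec_smul, Matrix.smul_mulVec, hp1, hp2, hpc,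
      crefl_mulVec_of_orthogonal hc1, crefl_mulVec_of_orthogonal hc2, crefl_mulVec_self hc]
    rw [smul_inv_smul₀ hκ0]
  rw [hkey] at hMΓ
  exact hMΓ.of_smul hκ

end LineReflection

/-! ### The two criteria for the reflections in a power of `R₁ R₂` -/

section Criteria

variable {τ : ℂ} {p : ℕ}

theorem diagEntry_ne_zero (hp : 2 ≤ p) : diagEntry (2 * Real.pi / p) ≠ 0 := by
  have hp' : (2 : ℝ) ≤ p := by exact_mod_cast hp
  have h1 : 2 * Real.pi / p / 2 = Real.pi / p := by ring
  rw [diagEntry, h1]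
  have : 0 < Real.sin (Real.pi / p) := by
    apply Real.sin_pos_of_pos_of_lt_pi
    · positivity
    · rw [div_lt_iff₀ (by linarith)]
      nlinarith [Real.pi_pos]
  positivity

/-- A power of `e^{2πi j/o}`, with `j` prime to `o`, is `e^{2πi/o}`, which has the least possible
`|κʳ - 1|²`. -/
theorem exists_pow_normSq_sub_one {κ : ℂ} {j o : ℕ} (ho : 2 ≤ o) (hj : j.Coprime o)
    (hκ : κ = Complex.exp (Complex.I * ((2 * Real.pi * (j / o) : ℝ) : ℂ))) :
    ∃ r : ℕ, Complex.normSq (κ ^ r - 1) = 2 - 2 * Real.cos (2 * Real.pi / o) := by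
  obtain ⟨r, -, hr⟩ := Nat.exists_mul_mod_eq_one_of_coprime hj (by omega)
  refine ⟨r, ?_⟩
  obtain ⟨q, hq⟩ : ∃ q, j * r = 1 + o * q := ⟨j * r / o, by
    have := Nat.mod_add_div (j * r) o
    rw [hr] at this
    exact this.symm⟩
  have ho' : (o : ℂ) ≠ 0 := by
    exact_mod_cast (by omega : o ≠ 0)
  have hq' : (j * r : ℂ) = 1 + o * q := by exact_mod_cast hq
  rw [← normSq_exp_sub_one, hκ, ← Complex.exp_nat_mul]
  have e : (r : ℂ) * (Complex.I * ((2 * Real.pi * (j / o) : ℝ) : ℂ)) =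
      Complex.I * ((2 * Real.pi / o : ℝ) : ℂ) + q * (2 * Real.pi * Complex.I) := by
    push_cast
    field_simp
    linear_combination hq'
  rw [e, Complex.exp_add, Complex.exp_nat_mul_two_pi_mul_I, mul_one]

theorem normSq_inv_sub_one {z : ℂ} (hz : ‖z‖ = 1) :
    Complex.normSq (z⁻¹ - 1) = Complex.normSq (z - 1) := by
  have h0 : z ≠ 0 := norm_ne_zero_iff.1 (by rw [hz]; exact one_ne_zero)
  have e : z⁻¹ - 1 = -(z - 1) * z⁻¹ := by
    field_simp
    ring
  rw [e, map_mul, Complex.normSq_neg, Complex.normSq_eq_norm_sq z⁻¹, norm_inv, hz]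
  simp

theorem two_sub_two_mul_cos_pos {o : ℕ} (ho : 2 ≤ o) : 0 < 2 - 2 * Real.cos (2 * Real.pi / o) := by
  rw [← diagEntry_sq]
  have := diagEntry_ne_zero ho
  positivity

/-- The reflection `(R₁ R₂)ⁿ` and its conjugate by `J`, raised to the power that makes the angle
`2π / o`, satisfy the Jørgensen-type criterion. -/
theorem not_discrete_of_line_jorgensen (hp : 2 ≤ p) {t R I : ℝ} (ht : Complex.normSq τ = t)
    (hR : (τ ^ 3).re = R) (hI : (τ ^ 3).im = I) {n : ℕ} {κ : ℂ}
    (hn : PowScalar (Complex.exp (Complex.I * ((2 * Real.pi / p : ℝ) : ℂ))) (2 - t) κ n)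
    {j o : ℕ} (ho : 2 ≤ o) (hj : j.Coprime o)
    (hκ : κ = Complex.exp (Complex.I * ((2 * Real.pi * (j / o) : ℝ) : ℂ)))
    (hts : t ≠ 2 - 2 * Real.cos (2 * Real.pi / p))
    (h1 : 1 < lineInv (Real.cos (2 * Real.pi / p)) (Real.sin (2 * Real.pi / p)) t R I)
    (h2 : (2 - 2 * Real.cos (2 * Real.pi / o)) *
      lineInv (Real.cos (2 * Real.pi / p)) (Real.sin (2 * Real.pi / p)) t R I < 1) :
    ¬ IsDiscreteGroup (triangleGroup (2 * Real.pi / p) τ) := by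
  subst ht hR hI
  obtain ⟨r, hr⟩ := exists_pow_normSq_sub_one ho hj hκ
  have hpos := two_sub_two_mul_cos_pos ho
  have hκn : ‖κ‖ = 1 := by rw [hκ]; exact norm_exp_I_mul _
  have hc := sesq_polarVec_ne_zero hts h1.ne'
  have hcr := (projMem_crefl_polarVec (diagEntry_ne_zero hp) hts hc hκn hn).pow r
  rw [crefl_pow hc] at hcr
  have hμ : Complex.normSq (κ⁻¹ ^ r - 1) = 2 - 2 * Real.cos (2 * Real.pi / o) := by
    rw [inv_pow, normSq_inv_sub_one (by simp [hκn]), hr]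
  refine not_discrete_of_jorgensen (formH_isHermitian _ τ) (by simp [hκn]) hc hcr
    (projMem_matJ _ τ) (matJ_isometry _ τ) (normSq_sesq_polarVec hts) (by linarith) h1.ne' ?_
    (by rwa [hμ]) ?_
  · rw [hμ]
    nlinarith
  · intro h
    rw [h, sub_self, map_zero] at hμ
    exact hpos.ne hμ

/-- The same reflections, when their product has infinite order. -/
theorem not_discrete_of_line_irrational (hp : 2 ≤ p) {t R I : ℝ} (ht : Complex.normSq τ = t)
    (hR : (τ ^ 3).re = R) (hI : (τ ^ 3).im = I) {n : ℕ} {κ : ℂ}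
    (hn : PowScalar (Complex.exp (Complex.I * ((2 * Real.pi / p : ℝ) : ℂ))) (2 - t) κ n)
    {j o : ℕ} (ho : 2 ≤ o) (hj : j.Coprime o)
    (hκ : κ = Complex.exp (Complex.I * ((2 * Real.pi * (j / o) : ℝ) : ℂ)))
    (hts : t ≠ 2 - 2 * Real.cos (2 * Real.pi / p))
    (h1 : 1 < lineInv (Real.cos (2 * Real.pi / p)) (Real.sin (2 * Real.pi / p)) t R I)
    (h2 : (2 - 2 * Real.cos (2 * Real.pi / o)) *
      lineInv (Real.cos (2 * Real.pi / p)) (Real.sin (2 * Real.pi / p)) t R I < 4)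
    {φ : algebraicClosure ℚ ℂ →ₐ[ℚ] ℂ} {L' : ℝ}
    (hφ : GalConj φ ((2 - 2 * Real.cos (2 * Real.pi / o)) *
      lineInv (Real.cos (2 * Real.pi / p)) (Real.sin (2 * Real.pi / p)) t R I) L')
    (hL' : 4 < L') :
    ¬ IsDiscreteGroup (triangleGroup (2 * Real.pi / p) τ) := by
  subst ht hR hI
  obtain ⟨r, hr⟩ := exists_pow_normSq_sub_one ho hj hκ
  have hpos := two_sub_two_mul_cos_pos ho
  have hκn : ‖κ‖ = 1 := by rw [hκ]; exact norm_exp_I_mul _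
  have hc := sesq_polarVec_ne_zero hts h1.ne'
  have hcr := (projMem_crefl_polarVec (diagEntry_ne_zero hp) hts hc hκn hn).pow r
  rw [crefl_pow hc] at hcr
  have hμ : Complex.normSq (κ⁻¹ ^ r - 1) = 2 - 2 * Real.cos (2 * Real.pi / o) := by
    rw [inv_pow, normSq_inv_sub_one (by simp [hκn]), hr]
  exact not_discrete_of_irrational_angle (formH_isHermitian _ τ) (by simp [hκn]) hc hcr
    (projMem_matJ _ τ) (matJ_isometry _ τ) (normSq_sesq_polarVec hts) h1.ne' (by rw [hμ])
    (by nlinarith) h2 (hφ.add_inv_ne hL')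

theorem exp_pow_eq (p n : ℕ) : Complex.exp (Complex.I * ((2 * Real.pi / p : ℝ) : ℂ)) ^ n =
    Complex.exp (Complex.I * ((2 * Real.pi * (n / p) : ℝ) : ℂ)) := by
  rw [← Complex.exp_nat_mul]
  congr 1
  push_cast
  ring

theorem neg_exp_sq_eq (p : ℕ) : -Complex.exp (Complex.I * ((2 * Real.pi / p : ℝ) : ℂ)) ^ 2 =
    Complex.exp (Complex.I * ((2 * Real.pi * (1 / 2 + 2 / p) : ℝ) : ℂ)) := by
  have : Complex.I * ((2 * Real.pi * (1 / 2 + 2 / p) : ℝ) : ℂ) =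
      Real.pi * Complex.I + Complex.I * ((2 * Real.pi * ((2 : ℕ) / p) : ℝ) : ℂ) := by
    push_cast
    ring
  rw [exp_pow_eq, this, Complex.exp_add, Complex.exp_pi_mul_I, neg_one_mul]

end Criteria

/-! ### Numerical approximation of cosines -/

/-- `q` approximates `x` with error at most `ε`. -/
def Near (x q ε : ℝ) : Prop := |x - q| ≤ ε

namespace Near

variable {x y q r δ ε : ℝ}

theorem const (q : ℝ) : Near q q 0 := by simp [Near]

theorem mono (hx : Near x q δ) (h : δ ≤ ε) : Near x q ε := le_trans hx h

theorem add (hx : Near x q δ) (hy : Near y r ε) : Near (x + y) (q + r) (δ + ε) := by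
  unfold Near at *
  rw [show x + y - (q + r) = (x - q) + (y - r) by ring]
  exact (abs_add_le _ _).trans (add_le_add hx hy)

theorem neg (hx : Near x q δ) : Near (-x) (-q) δ := by
  unfold Near at *
  rwa [show -x - -q = -(x - q) by ring, abs_neg]

theorem sub (hx : Near x q δ) (hy : Near y r ε) : Near (x - y) (q - r) (δ + ε) := by
  rw [sub_eq_add_neg, sub_eq_add_neg]
  exact hx.add hy.neg

theorem mul (hx : Near x q δ) (hy : Near y r ε) :
    Near (x * y) (q * r) (|q| * ε + |r| * δ + δ * ε) := by
  unfold Near at *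
  have hδ := (abs_nonneg _).trans hx
  rw [show x * y - q * r = q * (y - r) + r * (x - q) + (x - q) * (y - r) by ring]
  refine (abs_add_le _ _).trans (add_le_add ((abs_add_le _ _).trans (add_le_add ?_ ?_)) ?_)
  · rw [abs_mul]
    gcongr
  · rw [abs_mul]
    gcongr
  · rw [abs_mul]
    gcongr

/-- Rounds the approximation; the default argument checks the rounding error numerically. -/
theorem recenter (hx : Near x q δ) (h : |q - r| + δ ≤ ε := by norm_num) : Near x r ε :=
  (abs_sub_le x q r).trans (by linarith [show |x - q| ≤ δ from hx])

/-- The error of a product, for factors of known size. -/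
theorem mul_of_le (hx : Near x q δ) (hy : Near y r ε) {a b η : ℝ} (hq : |q| ≤ a) (hr : |r| ≤ b)
    (h : a * ε + b * δ + δ * ε ≤ η) : Near (x * y) (q * r) η := by
  have hδ := (abs_nonneg _).trans hx
  have hε := (abs_nonneg _).trans hy
  refine (hx.mul hy).mono (le_trans ?_ h)
  gcongr

theorem lower (hx : Near x q δ) : q - δ ≤ x := by
  have := (abs_le.1 hx).1
  linarith

theorem upper (hx : Near x q δ) : x ≤ q + δ := by
  have := (abs_le.1 hx).2
  linarith

end Near

/-- The cosine of an angle measured in full turns. All cosines and sines below are put in this form,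
in which a Galois conjugation multiplies the argument by an integer. -/
noncomputable def turnCos (x : ℝ) : ℝ := Real.cos (2 * Real.pi * x)

theorem abs_cos_sub_taylor_le {x : ℝ} (hx : |x| ≤ 2) :
    |Real.cos x - (1 - x ^ 2 / 2 + x ^ 4 / 24 - x ^ 6 / 720 + x ^ 8 / 40320 - x ^ 10 / 3628800)| ≤
      |x| ^ 12 / 239500800 := by
  have hn : ‖(x : ℂ) * Complex.I‖ = |x| := by simp
  have h := Complex.exp_bound' (x := (x : ℂ) * Complex.I) (n := 12) (by
    rw [hn]
    norm_num
    linarith)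
  rw [hn] at h
  refine le_trans ?_ (h.trans (le_of_eq ?_))
  · refine le_trans (le_of_eq ?_) (Complex.abs_re_le_norm _)
    congr 1
    rw [Complex.sub_re, Complex.exp_ofReal_mul_I_re]
    congr 1
    have e : ∑ m ∈ Finset.range 12, ((x : ℂ) * Complex.I) ^ m / m.factorial =
        ((1 - x ^ 2 / 2 + x ^ 4 / 24 - x ^ 6 / 720 + x ^ 8 / 40320 - x ^ 10 / 3628800 : ℝ) : ℂ) +
        ((x - x ^ 3 / 6 + x ^ 5 / 120 - x ^ 7 / 5040 + x ^ 9 / 362880 - x ^ 11 / 39916800 : ℝ) : ℂ)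
          * Complex.I := by
      simp only [Finset.sum_range_succ, Finset.sum_range_zero, Nat.factorial, mul_pow]
      have I2 : Complex.I ^ 2 = -1 := Complex.I_sq
      have I3 : Complex.I ^ 3 = -Complex.I := by rw [pow_succ, I2]; ring
      have I4 : Complex.I ^ 4 = 1 := Complex.I_pow_four
      have I5 : Complex.I ^ 5 = Complex.I := by rw [pow_succ, I4]; ring
      have I6 : Complex.I ^ 6 = -1 := by rw [pow_succ, I5, ← I2]; ring
      have I7 : Complex.I ^ 7 = -Complex.I := by rw [pow_succ, I6]; ring
      have I8 : Complex.I ^ 8 = 1 := by rw [pow_succ, I7, ← neg_neg (1 : ℂ), ← I2]; ring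
      have I9 : Complex.I ^ 9 = Complex.I := by rw [pow_succ, I8]; ring
      have I10 : Complex.I ^ 10 = -1 := by rw [pow_succ, I9, ← I2]; ring
      have I11 : Complex.I ^ 11 = -Complex.I := by rw [pow_succ, I10]; ring
      rw [I2, I3, I4, I5, I6, I7, I8, I9, I10, I11]
      push_cast
      ring
    rw [e]
    simp only [Complex.add_re, Complex.ofReal_re, Complex.re_ofReal_mul, Complex.I_re]
    ring
  · norm_num [Nat.factorial]
    ring

/-- The value of the cosine at an angle of `x` turns, reduced to `[-π/2, π/2]` by a multiple `m π`
of `π`. The hypotheses are numerical verifications on the Taylor polynomial. -/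
theorem near_turnCos {x : ℝ} (m : ℤ) (q : ℝ)
    (hy : |x - m / 2| ≤ 1 / 4 := by norm_num [abs_le])
    (h : |(-1) ^ m * (1 - (6.283185 * (x - m / 2)) ^ 2 / 2 + (6.283185 * (x - m / 2)) ^ 4 / 24 -
      (6.283185 * (x - m / 2)) ^ 6 / 720 + (6.283185 * (x - m / 2)) ^ 8 / 40320 -
      (6.283185 * (x - m / 2)) ^ 10 / 3628800) - q| ≤ 0.000006 := by norm_num [abs_le]) :
    Near (turnCos x) q 0.00001 := by
  have hm : x = x - m / 2 + m / 2 := by ring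
  have e1 : turnCos x = (-1) ^ m * Real.cos (2 * Real.pi * (x - m / 2)) := by
    rw [turnCos]
    nth_rewrite 1 [hm]
    rw [mul_add, show 2 * Real.pi * (m / 2) = m * Real.pi by ring, Real.cos_add_int_mul_pi]
  generalize x - m / 2 = y at *
  have hπ1 := Real.pi_gt_d6
  have hπ2 := Real.pi_lt_d6
  have e2 : |Real.cos (2 * Real.pi * y) - Real.cos (6.283185 * y)| ≤ 0.000002 := by
    have h1 := Real.abs_cos_sub_cos_le (2 * Real.pi * y) (6.283185 * y)
    refine h1.trans ?_
    rw [← sub_mul, abs_mul]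
    calc |2 * Real.pi - 6.283185| * |y| ≤ 0.000002 * (1 / 4) := by
          gcongr
          rw [abs_le]
          constructor <;> linarith
      _ ≤ _ := by norm_num
  have h12 : |6.283185 * y| ≤ 1.6 := by
    rw [abs_mul, abs_of_pos (by norm_num)]
    linarith
  have e3 := abs_cos_sub_taylor_le (x := 6.283185 * y) (by linarith)
  have e4 : |6.283185 * y| ^ 12 / 239500800 ≤ 0.000002 := by
    calc |6.283185 * y| ^ 12 / 239500800 ≤ 1.6 ^ 12 / 239500800 := by gcongr
      _ ≤ _ := by norm_num
  have hs : |((-1 : ℝ)) ^ m| = 1 := by simp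
  generalize (1 - (6.283185 * y) ^ 2 / 2 + (6.283185 * y) ^ 4 / 24 -
      (6.283185 * y) ^ 6 / 720 + (6.283185 * y) ^ 8 / 40320 - (6.283185 * y) ^ 10 / 3628800) = P
    at h e3
  have e5 : |(-1) ^ m * Real.cos (2 * Real.pi * y) - (-1) ^ m * P| ≤ 0.000004 := by
    rw [← mul_sub, abs_mul, hs, one_mul]
    refine (abs_sub_le _ (Real.cos (6.283185 * y)) _).trans ?_
    linarith [e3.trans e4]
  rw [Near, e1]
  refine (abs_sub_le _ ((-1) ^ m * P) _).trans ?_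
  linarith

theorem turnCos_neg (x : ℝ) : turnCos (-x) = turnCos x := by
  rw [turnCos, mul_neg, Real.cos_neg, turnCos]

theorem turnCos_add_int (x : ℝ) (m : ℤ) : turnCos (x + m) = turnCos x := by
  rw [turnCos, turnCos, show 2 * Real.pi * (x + m) = 2 * Real.pi * x + m * (2 * Real.pi) by ring,
    Real.cos_add_int_mul_two_pi]

theorem cos_two_pi_div (p : ℝ) : Real.cos (2 * Real.pi / p) = turnCos (1 / p) := by
  rw [turnCos]
  congr 1
  ring

theorem sin_two_pi_div (p : ℝ) : Real.sin (2 * Real.pi / p) = turnCos (1 / 4 - 1 / p) := by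
  rw [turnCos, ← Real.cos_pi_div_two_sub]
  congr 1
  ring

namespace Near

theorem abs_mul_le {x y a b c : ℝ} (hx : |x| ≤ a) (hy : |y| ≤ b) (h : a * b ≤ c) :
    |x * y| ≤ c := by
  rw [abs_mul]
  exact le_trans (mul_le_mul hx hy (abs_nonneg _) ((abs_nonneg _).trans hx)) h

theorem abs_add_le_of_le {x y a b c : ℝ} (hx : |x| ≤ a) (hy : |y| ≤ b) (h : a + b ≤ c) :
    |x + y| ≤ c :=
  (abs_add_le _ _).trans (le_trans (add_le_add hx hy) h)

theorem abs_sub_le_of_le {x y a b c : ℝ} (hx : |x| ≤ a) (hy : |y| ≤ b) (h : a + b ≤ c) :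
    |x - y| ≤ c :=
  (abs_sub _ _).trans (le_trans (add_le_add hx hy) h)

end Near

/-- Decimal approximations of the parameters of a triangle group: the cosine and the sine of the
angle, and `|τ|²`, `Re τ³`, `Im τ³`. The error bounds and sizes are uniform over
all the groups considered, so that the error of `lineInv` is estimated once. -/
structure ParamApprox (C S t R I C₀ S₀ t₀ R₀ I₀ : ℝ) : Prop where
  nearC : Near C C₀ 0.00001
  nearS : Near S S₀ 0.00001
  near_t : Near t t₀ 0.0002
  nearR : Near R R₀ 0.0005
  nearI : Near I I₀ 0.0005
  absC : |C₀| ≤ 1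
  absS : |S₀| ≤ 1
  abs_t : |t₀| ≤ 4
  absR : |R₀| ≤ 8
  absI : |I₀| ≤ 3

namespace ParamApprox

open Near

variable {C C₀ S S₀ t t₀ R R₀ I I₀ s s₀ : ℝ}

/-- Approximations of the numerator and the denominator of `lineInv`. -/
theorem lineInv_num_den (d : ParamApprox C S t R I C₀ S₀ t₀ R₀ I₀) :
    Near (t ^ 2 + (2 - 2 * C) * (t - R) + 2 * S * I)
      (t₀ ^ 2 + (2 - 2 * C₀) * (t₀ - R₀) + 2 * S₀ * I₀) 0.01 ∧
    Near ((t - (2 - 2 * C)) ^ 2) ((t₀ - (2 - 2 * C₀)) ^ 2) 0.005 ∧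
    |t₀ ^ 2 + (2 - 2 * C₀) * (t₀ - R₀) + 2 * S₀ * I₀| ≤ 70 := by
  obtain ⟨hC, hS, ht, hR, hI, bC, bS, bt, bR, bI⟩ := d
  have h2 : |(2 : ℝ)| ≤ 2 := by norm_num
  have nC : Near (2 - 2 * C) (2 - 2 * C₀) 0.00003 :=
    ((const 2).sub ((const 2).mul_of_le hC (η := 0.00003) h2 bC (by norm_num))).mono (by norm_num)
  have bC' : |2 - 2 * C₀| ≤ 4 := abs_sub_le_of_le h2 (abs_mul_le h2 bC le_rfl) (by norm_num)
  have nS : Near (2 * S) (2 * S₀) 0.00003 := (const 2).mul_of_le hS h2 bS (by norm_num)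
  have bS' : |2 * S₀| ≤ 2 := abs_mul_le h2 bS (by norm_num)
  refine ⟨?_, ?_, ?_⟩
  · rw [pow_two, pow_two]
    exact (((ht.mul_of_le ht (η := 0.0017) bt bt (by norm_num)).add
      (nC.mul_of_le (ht.sub hR) (η := 0.005) bC' (abs_sub_le_of_le bt bR le_rfl)
        (by norm_num))).add (nS.mul_of_le hI (η := 0.002) bS' bI (by norm_num))).mono (by norm_num)
  · rw [pow_two, pow_two]
    have b := abs_sub_le_of_le bt bC' le_rfl
    exact (ht.sub nC).mul_of_le (ht.sub nC) b b (by norm_num)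
  · rw [pow_two]
    exact abs_add_le_of_le (abs_add_le_of_le (abs_mul_le bt bt le_rfl)
      (abs_mul_le bC' (abs_sub_le_of_le bt bR le_rfl) le_rfl) le_rfl)
      (abs_mul_le bS' bI le_rfl) (by norm_num)

theorem lineInv_lt (d : ParamApprox C S t R I C₀ S₀ t₀ R₀ I₀) (hs : Near s s₀ 0.0001)
    (bs : |s₀| ≤ 4)
    (hpos : 0.005 < (t₀ - (2 - 2 * C₀)) ^ 2)
    (h : s₀ * (t₀ ^ 2 + (2 - 2 * C₀) * (t₀ - R₀) + 2 * S₀ * I₀) + 0.1 <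
      4 * (t₀ - (2 - 2 * C₀)) ^ 2) : s * lineInv C S t R I < 4 := by
  obtain ⟨h1, h2, h3⟩ := d.lineInv_num_den
  have h4 := (hs.mul_of_le h1 (η := 0.05) bs h3 (by norm_num)).upper
  have h5 := h2.lower
  rw [lineInv, ← mul_div_assoc, div_lt_iff₀ (by linarith)]
  linarith

theorem lineInv_lt_one (d : ParamApprox C S t R I C₀ S₀ t₀ R₀ I₀) (hs : Near s s₀ 0.0001)
    (bs : |s₀| ≤ 4) (hpos : 0.005 < (t₀ - (2 - 2 * C₀)) ^ 2)
    (h : s₀ * (t₀ ^ 2 + (2 - 2 * C₀) * (t₀ - R₀) + 2 * S₀ * I₀) + 0.06 <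
      (t₀ - (2 - 2 * C₀)) ^ 2) : s * lineInv C S t R I < 1 := by
  obtain ⟨h1, h2, h3⟩ := d.lineInv_num_den
  have h4 := (hs.mul_of_le h1 (η := 0.05) bs h3 (by norm_num)).upper
  have h5 := h2.lower
  rw [lineInv, ← mul_div_assoc, div_lt_iff₀ (by linarith)]
  linarith

theorem lt_lineInv (d : ParamApprox C S t R I C₀ S₀ t₀ R₀ I₀) (hs : Near s s₀ 0.0001)
    (bs : |s₀| ≤ 4)
    (hpos : 0.005 < (t₀ - (2 - 2 * C₀)) ^ 2)
    (h : 4 * (t₀ - (2 - 2 * C₀)) ^ 2 + 0.1 <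
      s₀ * (t₀ ^ 2 + (2 - 2 * C₀) * (t₀ - R₀) + 2 * S₀ * I₀)) : 4 < s * lineInv C S t R I := by
  obtain ⟨h1, h2, h3⟩ := d.lineInv_num_den
  have h4 := (hs.mul_of_le h1 (η := 0.05) bs h3 (by norm_num)).lower
  have h5 := h2.upper
  have h6 := h2.lower
  rw [lineInv, ← mul_div_assoc, lt_div_iff₀ (by linarith)]
  linarith

theorem one_lt_lineInv (d : ParamApprox C S t R I C₀ S₀ t₀ R₀ I₀)
    (hpos : 0.005 < (t₀ - (2 - 2 * C₀)) ^ 2)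
    (h : (t₀ - (2 - 2 * C₀)) ^ 2 + 0.02 <
      t₀ ^ 2 + (2 - 2 * C₀) * (t₀ - R₀) + 2 * S₀ * I₀) : 1 < lineInv C S t R I := by
  obtain ⟨h1, h2, h3⟩ := d.lineInv_num_den
  have h4 := h1.lower
  have h5 := h2.upper
  have h6 := h2.lower
  rw [lineInv, lt_div_iff₀ (by linarith)]
  linarith

theorem ne (d : ParamApprox C S t R I C₀ S₀ t₀ R₀ I₀) (hpos : 0.005 < (t₀ - (2 - 2 * C₀)) ^ 2) :
    t ≠ 2 - 2 * C := by
  intro h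
  have h2 := d.lineInv_num_den.2.1.lower
  rw [h, sub_self] at h2
  linarith

end ParamApprox

/-! ### Galois conjugation of the parameters -/

/-- A Galois conjugation acting on the cosines of the multiples of `2π / N` by `k`. -/
theorem exists_galConj_turnCos (N k : ℕ) (hN : 0 < N) (hk : k.Coprime N) :
    ∃ φ : algebraicClosure ℚ ℂ →ₐ[ℚ] ℂ, ∀ (j : ℤ) {x x' : ℝ}, x = j / N → x' = k * j / N →
      GalConj φ (turnCos x) (turnCos x') := by
  obtain ⟨φ, h⟩ := exists_galConj_cos N k hN hk
  refine ⟨φ, fun j x x' hx hx' => ?_⟩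
  rw [hx, hx']
  exact h j

namespace GalConj

variable {φ : algebraicClosure ℚ ℂ →ₐ[ℚ] ℂ} {C C' S S' t t' R R' I I' : ℝ}

theorem lineInv (hC : GalConj φ C C') (hS : GalConj φ S S') (ht : GalConj φ t t')
    (hR : GalConj φ R R') (hI : GalConj φ I I') :
    GalConj φ (lineInv C S t R I) (lineInv C' S' t' R' I') :=
  (((ht.pow 2).add (((ofNat 2).sub ((ofNat 2).mul hC)).mul (ht.sub hR))).add
    (((ofNat 2).mul hS).mul hI)).div ((ht.sub ((ofNat 2).sub ((ofNat 2).mul hC))).pow 2)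

end GalConj

/-! ### The parameters of the sporadic values -/

theorem expI_add (x y : ℝ) : expI (x + y) = expI x * expI y := by
  simp only [expI, ← Complex.exp_add]
  congr 1
  push_cast
  ring

theorem expI_re (x : ℝ) : (expI x).re = Real.cos x := Complex.exp_ofReal_mul_I_re x

theorem expI_im (x : ℝ) : (expI x).im = Real.sin x := Complex.exp_ofReal_mul_I_im x

theorem normSq_expI (x : ℝ) : Complex.normSq (expI x) = 1 := by
  rw [Complex.normSq_eq_norm_sq, expI, Complex.norm_exp_ofReal_mul_I, one_pow]

theorem expI_pow_three (x : ℝ) : expI x ^ 3 = expI (3 * x) := by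
  rw [expI, expI, ← Complex.exp_nat_mul]
  congr 1
  push_cast
  ring

/-- `|τ|² = t` and `τ³ = R + i I`. -/
structure HasParams (τ : ℂ) (t R I : ℝ) : Prop where
  normSq : Complex.normSq τ = t
  re : (τ ^ 3).re = R
  im : (τ ^ 3).im = I

theorem HasParams.conj {τ : ℂ} {t R I : ℝ} (h : HasParams τ t R I) :
    HasParams (conj τ) t R (-I) where
  normSq := by rw [Complex.normSq_conj, h.normSq]
  re := by rw [← map_pow, Complex.conj_re, h.re]
  im := by rw [← map_pow, Complex.conj_im, h.im]

theorem turnCos_twelfth : turnCos (1 / 12) = √3 / 2 := by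
  rw [turnCos, ← Real.cos_pi_div_six]
  congr 1
  ring

theorem turnCos_twelfth_sq : turnCos (1 / 12) ^ 2 = 3 / 4 := by
  rw [turnCos_twelfth, div_pow, Real.sq_sqrt (by norm_num)]
  norm_num

theorem ofReal_add_mul_I_re (a b : ℝ) : ((a : ℂ) + b * Complex.I).re = a := by simp

theorem ofReal_add_mul_I_im (a b : ℝ) : ((a : ℂ) + b * Complex.I).im = b := by simp

/-- The values `e^{iπ/3} + c e^{-iπ/6}`. -/
theorem hasParams_sixth (c : ℝ) :
    HasParams (expI (Real.pi / 3) + expI (-Real.pi / 6) * c) (c ^ 2 + 1) (3 * c ^ 2 - 1)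
      (3 * c - c ^ 3) := by
  have h1 : expI (Real.pi / 3) = expI (-Real.pi / 6) * Complex.I := by
    rw [show Real.pi / 3 = -Real.pi / 6 + Real.pi / 2 by ring, expI_add]
    congr 1
    rw [expI]
    push_cast
    exact Complex.exp_pi_div_two_mul_I
  have h2 : expI (-Real.pi / 6) ^ 3 = -Complex.I := by
    rw [expI_pow_three, show 3 * (-Real.pi / 6) = -(Real.pi / 2) by ring]
    apply Complex.ext
    · simp [expI_re]
    · simp [expI_im]
  have h3 : expI (Real.pi / 3) + expI (-Real.pi / 6) * c =
      expI (-Real.pi / 6) * (c + Complex.I) := by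
    rw [h1]
    ring
  have h4 : -Complex.I * ((c : ℂ) + Complex.I) ^ 3 =
      ((3 * c ^ 2 - 1 : ℝ) : ℂ) + ((3 * c - c ^ 3 : ℝ) : ℂ) * Complex.I := by
    push_cast
    linear_combination (-3 * c ^ 2 - 3 * c * Complex.I - Complex.I ^ 2 + 1) * Complex.I_sq
  rw [h3]
  constructor
  · rw [map_mul, normSq_expI, Complex.normSq_apply]
    simp
    ring
  · rw [mul_pow, h2, h4, ofReal_add_mul_I_re]
  · rw [mul_pow, h2, h4, ofReal_add_mul_I_im]

/-- The values `e^{2πi/9} + c e^{-iπ/9}`. -/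
theorem hasParams_ninth (c : ℝ) :
    HasParams (expI (2 * Real.pi / 9) + expI (-Real.pi / 9) * c) (1 + c + c ^ 2)
      (-(1 - c ^ 3) / 2 + 3 * c / 2 + 3 * c ^ 2) (turnCos (1 / 12) * (1 - c ^ 3 + 3 * c)) := by
  set h := turnCos (1 / 12) with hh
  have hsq : h ^ 2 = 3 / 4 := turnCos_twelfth_sq
  have hs3 : Real.sin (Real.pi / 3) = h := by
    rw [Real.sin_pi_div_three, hh, turnCos_twelfth]
  have e1 : expI (Real.pi / 3) = 1 / 2 + h * Complex.I := by
    apply Complex.ext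
    · simp [expI_re]
    · simp [expI_im, hs3]
  have h1 : expI (2 * Real.pi / 9) = expI (-Real.pi / 9) * (1 / 2 + h * Complex.I) := by
    rw [show 2 * Real.pi / 9 = -Real.pi / 9 + Real.pi / 3 by ring, expI_add, e1]
  have h2 : expI (-Real.pi / 9) ^ 3 = 1 / 2 - h * Complex.I := by
    rw [expI_pow_three, show 3 * (-Real.pi / 9) = -(Real.pi / 3) by ring]
    apply Complex.ext
    · simp [expI_re]
    · simp [expI_im, hs3]
  have h3 : expI (2 * Real.pi / 9) + expI (-Real.pi / 9) * c =
      expI (-Real.pi / 9) * (((c + 1 / 2 : ℝ) : ℂ) + (h : ℝ) * Complex.I) := by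
    rw [h1]
    push_cast
    ring
  have h4 : (1 / 2 - h * Complex.I) * (((c + 1 / 2 : ℝ) : ℂ) + (h : ℝ) * Complex.I) ^ 3 =
      ((-(1 - c ^ 3) / 2 + 3 * c / 2 + 3 * c ^ 2 : ℝ) : ℂ) +
        ((h * (1 - c ^ 3 + 3 * c) : ℝ) : ℂ) * Complex.I := by
    apply Complex.ext
    · simp [pow_succ]
      ring_nf
      rw [show h ^ 4 = (h ^ 2) ^ 2 by ring, hsq]
      ring
    · simp [pow_succ]
      ring_nf
      rw [show h ^ 3 = h ^ 2 * h by ring, hsq]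
      ring
  rw [h3]
  constructor
  · rw [map_mul, normSq_expI, Complex.normSq_add_mul_I, hsq]
    ring
  · rw [mul_pow, h2, h4, ofReal_add_mul_I_re]
  · rw [mul_pow, h2, h4, ofReal_add_mul_I_im]

theorem two_turnCos_tenth_sq : (2 * turnCos (1 / 10)) ^ 2 = 2 * turnCos (1 / 10) + 1 := by
  rw [turnCos, show 2 * Real.pi * (1 / 10) = Real.pi / 5 by ring, Real.cos_pi_div_five]
  have := Real.sq_sqrt (show (0 : ℝ) ≤ 5 by norm_num)
  linear_combination this / 4

theorem two_turnCos_two_mul (x : ℝ) : 2 * turnCos (2 * x) = (2 * turnCos x) ^ 2 - 2 := by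
  rw [turnCos, turnCos, show 2 * Real.pi * (2 * x) = 2 * (2 * Real.pi * x) by ring,
    Real.cos_two_mul]
  ring

theorem two_turnCos_three_mul (x : ℝ) :
    2 * turnCos (3 * x) = (2 * turnCos x) ^ 3 - 3 * (2 * turnCos x) := by
  rw [turnCos, turnCos, show 2 * Real.pi * (3 * x) = 3 * (2 * Real.pi * x) by ring,
    Real.cos_three_mul]
  ring

theorem two_turnCos_fifth : 2 * turnCos (1 / 5) = 2 * turnCos (1 / 10) - 1 := by
  rw [show (1 / 5 : ℝ) = 2 * (1 / 10) by norm_num, two_turnCos_two_mul, two_turnCos_tenth_sq]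
  ring

theorem two_turnCos_fifth_sq : (2 * turnCos (1 / 5)) ^ 2 + 2 * turnCos (1 / 5) = 1 := by
  rw [two_turnCos_fifth]
  linear_combination two_turnCos_tenth_sq

theorem two_turnCos_two_fifths_sq : (2 * turnCos (2 / 5)) ^ 2 + 2 * turnCos (2 / 5) = 1 := by
  rw [show (2 / 5 : ℝ) = 2 * (1 / 5) by norm_num, two_turnCos_two_mul]
  linear_combination ((2 * turnCos (1 / 5)) ^ 2 - 2 * turnCos (1 / 5) - 1) * two_turnCos_fifth_sq

theorem two_turnCos_seventh_pow_three {k : ℕ} (h0 : 0 < k) (h7 : k < 7) :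
    (2 * turnCos (k / 7)) ^ 3 + (2 * turnCos (k / 7)) ^ 2 - 2 * (2 * turnCos (k / 7)) - 1 = 0 := by
  have h1 := two_turnCos_three_mul (k / 7)
  have h2 := two_turnCos_two_mul (k / 7)
  have h3 := two_turnCos_two_mul (2 * (k / 7))
  have h4 : turnCos (2 * (2 * (k / 7))) = turnCos (3 * (k / 7)) := by
    rw [← turnCos_neg, ← turnCos_add_int _ k]
    congr 1
    push_cast
    ring
  rw [h4, h1, h2] at h3
  have hne : 2 * turnCos (k / 7) - 2 ≠ 0 := by
    intro h
    have h5 : Real.cos (2 * Real.pi * (k / 7)) = 1 := by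
      rw [turnCos] at h
      linarith
    have hk : (k : ℝ) < 7 := by exact_mod_cast h7
    have hk0 : (0 : ℝ) < k := by exact_mod_cast h0
    rw [Real.cos_eq_one_iff_of_lt_of_lt] at h5
    · have := Real.pi_pos
      have : 0 < 2 * Real.pi * (k / 7) := by positivity
      linarith
    · have := Real.pi_pos
      have : 0 < 2 * Real.pi * (k / 7) := by positivity
      linarith
    · have := Real.pi_pos
      nlinarith
  refine (mul_eq_zero.1 ?_).resolve_left hne
  linear_combination -h3

theorem hasParams_σ₁ : HasParams σ₁ 3 5 (2 * turnCos (1 / 8)) := by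
  have hc : (2 * turnCos (1 / 8)) ^ 2 = 2 := by
    rw [turnCos, show 2 * Real.pi * (1 / 8) = Real.pi / 4 by ring, Real.cos_pi_div_four]
    rw [mul_pow, div_pow, Real.sq_sqrt (by norm_num)]
    norm_num
  have h := hasParams_sixth (2 * turnCos (1 / 8))
  have e : σ₁ = expI (Real.pi / 3) + expI (-Real.pi / 6) * (2 * turnCos (1 / 8) : ℝ) := by
    rw [σ₁, turnCos, show 2 * Real.pi * (1 / 8) = Real.pi / 4 by ring]
    push_cast
    rfl
  rw [← e] at h
  exact ⟨by rw [h.normSq]; linarith, by rw [h.re]; linarith,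
    by rw [h.im]; linear_combination -(2 * turnCos (1 / 8)) * hc⟩

theorem hasParams_σ₂ : HasParams σ₂ (2 * turnCos (1 / 10) + 2) (3 * (2 * turnCos (1 / 10)) + 2)
    (2 * turnCos (1 / 10) - 1) := by
  have hc := two_turnCos_tenth_sq
  have h := hasParams_sixth (2 * turnCos (1 / 10))
  have e : σ₂ = expI (Real.pi / 3) + expI (-Real.pi / 6) * (2 * turnCos (1 / 10) : ℝ) := by
    rw [σ₂, turnCos, show 2 * Real.pi * (1 / 10) = Real.pi / 5 by ring]
    push_cast
    rfl
  rw [← e] at h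
  exact ⟨by rw [h.normSq]; linarith, by rw [h.re]; linarith,
    by rw [h.im]; linear_combination -(2 * turnCos (1 / 10) + 1) * hc⟩

theorem hasParams_σ₃ : HasParams σ₃ (2 - 2 * turnCos (1 / 5)) (2 - 3 * (2 * turnCos (1 / 5)))
    (2 * turnCos (1 / 5) + 1) := by
  have hc := two_turnCos_fifth_sq
  have h := hasParams_sixth (2 * turnCos (1 / 5))
  have e : σ₃ = expI (Real.pi / 3) + expI (-Real.pi / 6) * (2 * turnCos (1 / 5) : ℝ) := by
    rw [σ₃, turnCos, show 2 * Real.pi * (1 / 5) = 2 * Real.pi / 5 by ring]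
    push_cast
    rfl
  rw [← e] at h
  exact ⟨by rw [h.normSq]; linarith, by rw [h.re]; linarith,
    by rw [h.im]; linear_combination (1 - 2 * turnCos (1 / 5)) * hc⟩

theorem HasParams.of_sq_add {τ : ℂ} {c : ℝ} (hc : c ^ 2 + c = 1)
    (h : HasParams τ (1 + c + c ^ 2) (-(1 - c ^ 3) / 2 + 3 * c / 2 + 3 * c ^ 2)
      (turnCos (1 / 12) * (1 - c ^ 3 + 3 * c))) :
    HasParams τ 2 (2 - c / 2) (turnCos (1 / 12) * (2 + c)) := by
  have h3 : c ^ 3 = 2 * c - 1 := by linear_combination (c - 1) * hc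
  refine ⟨by rw [h.normSq]; linarith, ?_, ?_⟩
  · rw [h.re, h3]
    linarith
  · rw [h.im, h3]
    ring

theorem hasParams_σ₅ : HasParams σ₅ 2 (2 - (2 * turnCos (1 / 5)) / 2)
    (turnCos (1 / 12) * (2 + 2 * turnCos (1 / 5))) := by
  refine HasParams.of_sq_add two_turnCos_fifth_sq ?_
  convert hasParams_ninth (2 * turnCos (1 / 5)) using 1
  rw [σ₅, turnCos, show 2 * Real.pi * (1 / 5) = 2 * Real.pi / 5 by ring]
  push_cast
  rfl

theorem hasParams_σ₆ : HasParams σ₆ 2 (2 - (2 * turnCos (2 / 5)) / 2)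
    (turnCos (1 / 12) * (2 + 2 * turnCos (2 / 5))) := by
  refine HasParams.of_sq_add two_turnCos_two_fifths_sq ?_
  convert hasParams_ninth (2 * turnCos (2 / 5)) using 1
  rw [σ₆, turnCos, show 2 * Real.pi * (2 / 5) = 4 * Real.pi / 5 by ring]
  push_cast
  rfl

theorem hasParams_σ₇ : HasParams σ₇ (1 + 2 * turnCos (1 / 7) + (2 * turnCos (1 / 7)) ^ 2)
    (-(1 - (2 * turnCos (1 / 7)) ^ 3) / 2 + 3 * (2 * turnCos (1 / 7)) / 2 +
      3 * (2 * turnCos (1 / 7)) ^ 2)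
    (turnCos (1 / 12) * (1 - (2 * turnCos (1 / 7)) ^ 3 + 3 * (2 * turnCos (1 / 7)))) := by
  convert hasParams_ninth (2 * turnCos (1 / 7)) using 1
  rw [σ₇, turnCos, show 2 * Real.pi * (1 / 7) = 2 * Real.pi / 7 by ring]
  push_cast
  rfl

theorem hasParams_σ₈ : HasParams σ₈ (1 + 2 * turnCos (2 / 7) + (2 * turnCos (2 / 7)) ^ 2)
    (-(1 - (2 * turnCos (2 / 7)) ^ 3) / 2 + 3 * (2 * turnCos (2 / 7)) / 2 +
      3 * (2 * turnCos (2 / 7)) ^ 2)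
    (turnCos (1 / 12) * (1 - (2 * turnCos (2 / 7)) ^ 3 + 3 * (2 * turnCos (2 / 7)))) := by
  convert hasParams_ninth (2 * turnCos (2 / 7)) using 1
  rw [σ₈, turnCos, show 2 * Real.pi * (2 / 7) = 4 * Real.pi / 7 by ring]
  push_cast
  rfl

theorem hasParams_σ₉ : HasParams σ₉ (1 + 2 * turnCos (3 / 7) + (2 * turnCos (3 / 7)) ^ 2)
    (-(1 - (2 * turnCos (3 / 7)) ^ 3) / 2 + 3 * (2 * turnCos (3 / 7)) / 2 +
      3 * (2 * turnCos (3 / 7)) ^ 2)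
    (turnCos (1 / 12) * (1 - (2 * turnCos (3 / 7)) ^ 3 + 3 * (2 * turnCos (3 / 7)))) := by
  convert hasParams_ninth (2 * turnCos (3 / 7)) using 1
  rw [σ₉, turnCos, show 2 * Real.pi * (3 / 7) = 6 * Real.pi / 7 by ring]
  push_cast
  rfl

/-- `σ₄` is a root of `X² + X + 2`, as a Gaussian period. -/
theorem hasParams_σ₄ : HasParams σ₄ 2 (5 / 2)
    (-(turnCos (3 / 28) + turnCos (1 / 28) + turnCos (9 / 28))) := by
  set z := expI (2 * Real.pi / 7) with hz
  have z7 : z ^ 7 = 1 := by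
    rw [hz, expI, ← Complex.exp_nat_mul, ← Complex.exp_two_pi_mul_I]
    congr 1
    push_cast
    ring
  have e : σ₄ = z + z ^ 2 + z ^ 4 := by
    have h2 : expI (4 * Real.pi / 7) = z ^ 2 := by
      rw [show 4 * Real.pi / 7 = 2 * Real.pi / 7 + 2 * Real.pi / 7 by ring, expI_add, pow_two]
    have h4 : expI (8 * Real.pi / 7) = z ^ 4 := by
      rw [show 8 * Real.pi / 7 = 4 * Real.pi / 7 + 4 * Real.pi / 7 by ring, expI_add, h2]
      ring
    rw [σ₄, h2, h4]
  have z1 : z ≠ 1 := by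
    intro h
    have h5 : Real.cos (2 * Real.pi / 7) = 1 := by
      rw [← expI_re, ← hz, h, Complex.one_re]
    have := Real.pi_pos
    rw [Real.cos_eq_one_iff_of_lt_of_lt (by linarith) (by linarith)] at h5
    linarith
  have hsum : 1 + z + z ^ 2 + z ^ 3 + z ^ 4 + z ^ 5 + z ^ 6 = 0 := by
    refine (mul_eq_zero.1 ?_).resolve_left (sub_ne_zero.2 z1)
    linear_combination z7
  have hquad : σ₄ ^ 2 + σ₄ + 2 = 0 := by
    rw [e]
    linear_combination 2 * hsum + z * z7
  have him : σ₄.im = turnCos (3 / 28) + turnCos (1 / 28) + turnCos (9 / 28) := by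
    rw [σ₄, Complex.add_im, Complex.add_im, expI_im, expI_im, expI_im]
    simp only [← Real.cos_pi_div_two_sub]
    rw [turnCos, turnCos, turnCos]
    congr 1
    · congr 1
      · congr 1
        ring
      · rw [← Real.cos_neg]
        congr 1
        ring
    · rw [← Real.cos_neg]
      congr 1
      ring
  have hre := congrArg Complex.re hquad
  have him2 := congrArg Complex.im hquad
  simp only [pow_two, Complex.add_re, Complex.mul_re, Complex.re_ofNat, Complex.zero_re] at hre
  simp only [pow_two, Complex.add_im, Complex.mul_im, Complex.im_ofNat, Complex.zero_im] at him2
  have hre' : σ₄.re = -(1 / 2) := by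
    have h0 : σ₄.im * (2 * σ₄.re + 1) = 0 := by linarith
    rcases mul_eq_zero.1 h0 with h | h
    · rw [h] at hre
      nlinarith [sq_nonneg (2 * σ₄.re + 1)]
    · linarith
  have hcube : σ₄ ^ 3 = 2 - σ₄ := by linear_combination (σ₄ - 1) * hquad
  rw [hre'] at hre
  refine ⟨?_, ?_, ?_⟩
  · rw [Complex.normSq_apply, hre']
    linarith
  · rw [hcube, Complex.sub_re, hre', Complex.re_ofNat]
    norm_num
  · rw [hcube, Complex.sub_im, him, Complex.im_ofNat]
    ring

/-! ### The criterion of infinite order on decimal approximations -/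

/-- The criterion `not_discrete_of_line_irrational` with an explicit conjugation `e^{2πi/N} ↦
e^{2πik/N}`, the inequalities being verified on decimal approximations. -/
theorem not_discrete_of_line_galois {τ : ℂ} {p : ℕ} (hp : 2 ≤ p) {t R I : ℝ}
    (hτ : HasParams τ t R I) {n : ℕ} {κ : ℂ}
    (hn : PowScalar (Complex.exp (Complex.I * ((2 * Real.pi / p : ℝ) : ℂ))) (2 - t) κ n)
    {j o : ℕ} (ho : 2 ≤ o) (hj : j.Coprime o)
    (hκ : κ = Complex.exp (Complex.I * ((2 * Real.pi * (j / o) : ℝ) : ℂ)))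
    {φ : algebraicClosure ℚ ℂ →ₐ[ℚ] ℂ} {C' S' s' t' R' I' : ℝ}
    (hC : GalConj φ (turnCos (1 / p)) C') (hS : GalConj φ (turnCos (1 / 4 - 1 / p)) S')
    (hs : GalConj φ (turnCos (1 / o)) s')
    (gt : GalConj φ t t') (gR : GalConj φ R R') (gI : GalConj φ I I')
    {C₀ S₀ t₀ R₀ I₀ s₀ C₁ S₁ t₁ R₁ I₁ s₁ : ℝ}
    (d₀ : ParamApprox (turnCos (1 / p)) (turnCos (1 / 4 - 1 / p)) t R I C₀ S₀ t₀ R₀ I₀)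
    (d₁ : ParamApprox C' S' t' R' I' C₁ S₁ t₁ R₁ I₁)
    (n₀ : Near (turnCos (1 / o)) s₀ 0.00001) (n₁ : Near s' s₁ 0.00001)
    (b₀ : |2 - 2 * s₀| ≤ 4 := by norm_num [abs_le])
    (b₁ : |2 - 2 * s₁| ≤ 4 := by norm_num [abs_le])
    (p₀ : 0.005 < (t₀ - (2 - 2 * C₀)) ^ 2 := by norm_num [abs_le])
    (p₁ : 0.005 < (t₁ - (2 - 2 * C₁)) ^ 2 := by norm_num [abs_le])
    (h1 : (t₀ - (2 - 2 * C₀)) ^ 2 + 0.02 < t₀ ^ 2 + (2 - 2 * C₀) * (t₀ - R₀) + 2 * S₀ * I₀ := by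
      norm_num)
    (h2 : (2 - 2 * s₀) * (t₀ ^ 2 + (2 - 2 * C₀) * (t₀ - R₀) + 2 * S₀ * I₀) + 0.1 <
      4 * (t₀ - (2 - 2 * C₀)) ^ 2 := by norm_num)
    (h3 : 4 * (t₁ - (2 - 2 * C₁)) ^ 2 + 0.1 <
      (2 - 2 * s₁) * (t₁ ^ 2 + (2 - 2 * C₁) * (t₁ - R₁) + 2 * S₁ * I₁) := by norm_num) :
    ¬ IsDiscreteGroup (triangleGroup (2 * Real.pi / p) τ) := by
  have two_sub : ∀ {x q : ℝ}, Near x q 0.00001 → Near (2 - 2 * x) (2 - 2 * q) 0.0001 := by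
    intro x q h
    refine ((Near.const 2).sub ((Near.const 2).mul h)).mono ?_
    norm_num
  refine not_discrete_of_line_irrational hp hτ.normSq hτ.re hτ.im hn ho hj hκ ?_ ?_ ?_ (φ := φ)
    (L' := (2 - 2 * s') * lineInv C' S' t' R' I') ?_ ?_
  · rw [cos_two_pi_div]
    exact d₀.ne p₀
  · rw [cos_two_pi_div, sin_two_pi_div]
    exact d₀.one_lt_lineInv p₀ h1
  · rw [cos_two_pi_div, sin_two_pi_div, cos_two_pi_div]
    exact d₀.lineInv_lt (two_sub n₀) b₀ p₀ h2
  · rw [cos_two_pi_div, sin_two_pi_div, cos_two_pi_div]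
    exact ((GalConj.ofNat 2).sub ((GalConj.ofNat 2).mul hs)).mul (hC.lineInv hS gt gR gI)
  · exact d₁.lt_lineInv (two_sub n₁) b₁ p₁ h3

theorem powScalar_of_two (ζ : ℂ) : PowScalar ζ (2 - ((2 : ℝ) : ℂ)) (-ζ ^ 2) 2 := by
  convert powScalar_two ζ using 1
  norm_num

theorem powScalar_of_three (ζ : ℂ) : PowScalar ζ (2 - ((3 : ℝ) : ℂ)) (ζ ^ 3) 3 := by
  convert powScalar_three ζ using 1
  norm_num

theorem powScalar_of_fifth_sixth (ζ : ℂ) :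
    PowScalar ζ (2 - ((2 * turnCos (1 / 10) + 2 : ℝ) : ℂ)) (ζ ^ 5) 5 := by
  refine powScalar_five ζ ?_
  have h : (2 - (2 * turnCos (1 / 10) + 2)) ^ 2 + (2 - (2 * turnCos (1 / 10) + 2)) = 1 := by
    linear_combination two_turnCos_tenth_sq
  exact_mod_cast congrArg (fun x : ℝ => (x : ℂ)) h

theorem powScalar_of_two_fifths_sixth (ζ : ℂ) :
    PowScalar ζ (2 - ((2 - 2 * turnCos (1 / 5) : ℝ) : ℂ)) (ζ ^ 5) 5 := by
  refine powScalar_five ζ ?_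
  have h : (2 - (2 - 2 * turnCos (1 / 5))) ^ 2 + (2 - (2 - 2 * turnCos (1 / 5))) = 1 := by
    linear_combination two_turnCos_fifth_sq
  exact_mod_cast congrArg (fun x : ℝ => (x : ℂ)) h

theorem powScalar_of_seventh (ζ : ℂ) {c : ℝ} (hc : c ^ 3 + c ^ 2 - 2 * c - 1 = 0) :
    PowScalar ζ (2 - ((1 + c + c ^ 2 : ℝ) : ℂ)) (ζ ^ 7) 7 := by
  refine powScalar_seven ζ ?_
  have h : (2 - (1 + c + c ^ 2)) ^ 3 + (2 - (1 + c + c ^ 2)) ^ 2 - 2 * (2 - (1 + c + c ^ 2)) - 1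
      = 0 := by
    linear_combination (-c ^ 3 - 2 * c ^ 2 + c + 1) * hc
  exact_mod_cast congrArg (fun x : ℝ => (x : ℂ)) h

/-! ### Approximations of the parameters of the sporadic values and of their Galois conjugates -/

section Approx

variable {C S C₀ S₀ a b c h a₀ b₀ c₀ h₀ : ℝ}

theorem paramApprox_σ₁ (hC : Near C C₀ 0.00001) (hS : Near S S₀ 0.00001) (hc : Near c c₀ 0.00001)
    (bC : |C₀| ≤ 1 := by norm_num [abs_le]) (bS : |S₀| ≤ 1 := by norm_num [abs_le])
    (bc : |2 * c₀| ≤ 3 := by norm_num [abs_le]) :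
    ParamApprox C S 3 5 (2 * c) C₀ S₀ 3 5 (2 * c₀) :=
  ⟨hC, hS, (Near.const 3).mono (by norm_num), (Near.const 5).mono (by norm_num),
    ((Near.const 2).mul hc).mono (by norm_num), bC, bS, by norm_num [abs_le],
    by norm_num [abs_le], bc⟩

theorem paramApprox_σ₄ (hC : Near C C₀ 0.00001) (hS : Near S S₀ 0.00001) (ha : Near a a₀ 0.00001)
    (hb : Near b b₀ 0.00001) (hc : Near c c₀ 0.00001)
    (bC : |C₀| ≤ 1 := by norm_num [abs_le]) (bS : |S₀| ≤ 1 := by norm_num [abs_le])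
    (bI : |-(a₀ + b₀ + c₀)| ≤ 3 := by norm_num [abs_le]) :
    ParamApprox C S 2 (5 / 2) (-(a + b + c)) C₀ S₀ 2 (5 / 2) (-(a₀ + b₀ + c₀)) :=
  ⟨hC, hS, (Near.const 2).mono (by norm_num), (Near.const _).mono (by norm_num),
    (((ha.add hb).add hc).neg).mono (by norm_num), bC, bS, by norm_num [abs_le],
    by norm_num [abs_le], bI⟩

theorem paramApprox_fifth (hC : Near C C₀ 0.00001) (hS : Near S S₀ 0.00001)
    (hc : Near c c₀ 0.00001) (hh : Near h h₀ 0.00001)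
    (bC : |C₀| ≤ 1 := by norm_num [abs_le]) (bS : |S₀| ≤ 1 := by norm_num [abs_le])
    (bc : |c₀| ≤ 1 := by norm_num [abs_le]) (bh : |h₀| ≤ 1 := by norm_num [abs_le])
    (bI : |h₀ * (2 + 2 * c₀)| ≤ 3 := by norm_num [abs_le]) :
    ParamApprox C S 2 (2 - 2 * c / 2) (h * (2 + 2 * c)) C₀ S₀ 2 (2 - c₀) (h₀ * (2 + 2 * c₀)) where
  nearC := hC
  nearS := hS
  near_t := (Near.const 2).mono (by norm_num)
  nearR := by
    rw [mul_div_cancel_left₀ _ two_ne_zero]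
    exact ((Near.const 2).sub hc).mono (by norm_num)
  nearI := hh.mul_of_le (((Near.const 2).add ((Near.const 2).mul hc)).mono (ε := 0.00002)
    (by norm_num)) bh (Near.abs_add_le_of_le (a := 2) (b := 2) (by norm_num)
      (Near.abs_mul_le (a := 2) (by norm_num) bc (by norm_num)) le_rfl) (by norm_num)
  absC := bC
  absS := bS
  abs_t := by norm_num [abs_le]
  absR := Near.abs_sub_le_of_le (a := 2) (by norm_num) bc (by norm_num)
  absI := bI

theorem paramApprox_seventh (hC : Near C C₀ 0.00001) (hS : Near S S₀ 0.00001)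
    (hc : Near c c₀ 0.00001) (hh : Near h h₀ 0.00001)
    (bC : |C₀| ≤ 1 := by norm_num [abs_le]) (bS : |S₀| ≤ 1 := by norm_num [abs_le])
    (bc : |c₀| ≤ 1 := by norm_num [abs_le]) (bh : |h₀| ≤ 1 := by norm_num [abs_le])
    (bt : |1 + 2 * c₀ + (2 * c₀) ^ 2| ≤ 4 := by norm_num [abs_le])
    (bR : |-(1 - (2 * c₀) ^ 3) / 2 + 3 * (2 * c₀) / 2 + 3 * (2 * c₀) ^ 2| ≤ 8 := by
      norm_num [abs_le])
    (bI : |h₀ * (1 - (2 * c₀) ^ 3 + 3 * (2 * c₀))| ≤ 3 := by norm_num [abs_le]) :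
    ParamApprox C S (1 + 2 * c + (2 * c) ^ 2)
      (-(1 - (2 * c) ^ 3) / 2 + 3 * (2 * c) / 2 + 3 * (2 * c) ^ 2)
      (h * (1 - (2 * c) ^ 3 + 3 * (2 * c))) C₀ S₀ (1 + 2 * c₀ + (2 * c₀) ^ 2)
      (-(1 - (2 * c₀) ^ 3) / 2 + 3 * (2 * c₀) / 2 + 3 * (2 * c₀) ^ 2)
      (h₀ * (1 - (2 * c₀) ^ 3 + 3 * (2 * c₀))) := by
  have n1 : Near (2 * c) (2 * c₀) 0.00002 := ((Near.const 2).mul hc).mono (by norm_num)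
  have b1 : |2 * c₀| ≤ 2 := Near.abs_mul_le (a := 2) (by norm_num) bc (by norm_num)
  have n2 : Near ((2 * c) ^ 2) ((2 * c₀) ^ 2) 0.00009 := by
    rw [pow_two, pow_two]
    exact n1.mul_of_le n1 b1 b1 (by norm_num)
  have b2 : |(2 * c₀) ^ 2| ≤ 4 := by
    rw [pow_two]
    exact Near.abs_mul_le b1 b1 (by norm_num)
  have n3 : Near ((2 * c) ^ 3) ((2 * c₀) ^ 3) 0.00027 := by
    rw [pow_succ, pow_succ]
    exact n2.mul_of_le n1 b2 b1 (by norm_num)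
  have b3 : |(2 * c₀) ^ 3| ≤ 8 := by
    rw [pow_succ]
    exact Near.abs_mul_le b2 b1 (by norm_num)
  refine ⟨hC, hS, (((Near.const 1).add n1).add n2).mono (by norm_num), ?_, ?_, bC, bS, bt, bR, bI⟩
  · have m1 := (((Near.const 1).sub n3).mul (Near.const (-1 / 2))).add
      (((Near.const (3 / 2)).mul n1).add ((Near.const 3).mul n2))
    refine Near.mono (δ := 0.0005) ?_ le_rfl
    convert m1.mono (ε := 0.0005) _ using 1
    · ring
    · ring
    · norm_num [abs_div, abs_of_pos]
  · exact hh.mul_of_le ((((Near.const 1).sub n3).add ((Near.const 3).mul n1)).mono (ε := 0.00033)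
      (by norm_num)) bh (Near.abs_add_le_of_le (Near.abs_sub_le_of_le (a := 1) (by norm_num) b3
        le_rfl) (Near.abs_mul_le (a := 3) (by norm_num) b1 le_rfl) le_rfl) (by norm_num)

theorem ParamApprox.conj {t R I t₀ R₀ I₀ : ℝ} (d : ParamApprox C S t R I C₀ S₀ t₀ R₀ I₀) :
    ParamApprox C S t R (-I) C₀ S₀ t₀ R₀ (-I₀) :=
  { d with nearI := d.nearI.neg, absI := by rw [abs_neg]; exact d.absI }

end Approx

namespace GalConj

variable {φ : algebraicClosure ℚ ℂ →ₐ[ℚ] ℂ} {c c' h h' : ℝ}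

theorem seventh_normSq (hc : GalConj φ c c') :
    GalConj φ (1 + 2 * c + (2 * c) ^ 2) (1 + 2 * c' + (2 * c') ^ 2) :=
  (one.add ((ofNat 2).mul hc)).add (((ofNat 2).mul hc).pow 2)

theorem seventh_re (hc : GalConj φ c c') :
    GalConj φ (-(1 - (2 * c) ^ 3) / 2 + 3 * (2 * c) / 2 + 3 * (2 * c) ^ 2)
      (-(1 - (2 * c') ^ 3) / 2 + 3 * (2 * c') / 2 + 3 * (2 * c') ^ 2) :=
  have h2 := (ofNat 2).mul hc
  (((one.sub (h2.pow 3)).neg.div (ofNat 2)).add (((ofNat 3).mul h2).div (ofNat 2))).add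
    ((ofNat 3).mul (h2.pow 2))

theorem seventh_im (hc : GalConj φ c c') (hh : GalConj φ h h') :
    GalConj φ (h * (1 - (2 * c) ^ 3 + 3 * (2 * c))) (h' * (1 - (2 * c') ^ 3 + 3 * (2 * c'))) :=
  have h2 := (ofNat 2).mul hc
  hh.mul ((one.sub (h2.pow 3)).add ((ofNat 3).mul h2))

end GalConj

/-! ### Groups containing two line reflections with a product of infinite order

The line reflection has multiplier `e^{2πij/o}`. The conjugation multiplies the arguments of the
cosines by the second argument `k` of `exists_galConj_turnCos`, an exponent for which the conjugate
of `(2 - 2 cos (2π/o)) lineInv` exceeds `4`; its first argument is a common denominator of the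
arguments of the cosines. -/

theorem two_turnCos_one_seventh_pow_three :
    (2 * turnCos (1 / 7)) ^ 3 + (2 * turnCos (1 / 7)) ^ 2 - 2 * (2 * turnCos (1 / 7)) - 1 = 0 := by
  exact_mod_cast two_turnCos_seventh_pow_three (k := 1) (by norm_num) (by norm_num)

theorem not_discrete_σ₁_seven :
    ¬ IsDiscreteGroup (triangleGroup (2 * Real.pi / (7 : ℕ)) σ₁) := by
  obtain ⟨φ, hφ⟩ := exists_galConj_turnCos 56 5 (by norm_num) (by norm_num)
  exact not_discrete_of_line_galois (p := 7) (by norm_num) hasParams_σ₁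
    (powScalar_of_three _) (j := 3) (o := 7)
    (by norm_num) (by norm_num) (exp_pow_eq _ 3)
    (hφ 8 (by norm_num) rfl) (hφ 6 (by norm_num) rfl) (hφ 8 (by norm_num) rfl)
    (.ofNat 3) (.ofNat 5)
    (.mul (.ofNat 2) (hφ 7 (by norm_num) rfl))
    (paramApprox_σ₁ (near_turnCos 0 0.62349) (near_turnCos 0 0.781831)
      (near_turnCos 0 0.707107))
    (paramApprox_σ₁ (near_turnCos 1 (-0.222521)) (near_turnCos 1 (-0.974928))
      (near_turnCos 1 (-0.707107)))
    (near_turnCos 0 0.62349) (near_turnCos 1 (-0.222521))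

theorem not_discrete_σ₁_twelve :
    ¬ IsDiscreteGroup (triangleGroup (2 * Real.pi / (12 : ℕ)) σ₁) := by
  obtain ⟨φ, hφ⟩ := exists_galConj_turnCos 24 7 (by norm_num) (by norm_num)
  exact not_discrete_of_line_galois (p := 12) (by norm_num) hasParams_σ₁
    (powScalar_of_three _) (j := 1) (o := 4)
    (by norm_num) (by norm_num) (by rw [exp_pow_eq]; norm_num)
    (hφ 2 (by norm_num) rfl) (hφ 4 (by norm_num) rfl) (hφ 6 (by norm_num) rfl)
    (.ofNat 3) (.ofNat 5)
    (.mul (.ofNat 2) (hφ 3 (by norm_num) rfl))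
    (paramApprox_σ₁ (near_turnCos 0 0.866025) (near_turnCos 0 0.5)
      (near_turnCos 0 0.707107))
    (paramApprox_σ₁ (near_turnCos 1 (-0.866025)) (near_turnCos 2 0.5)
      (near_turnCos 2 0.707107))
    (near_turnCos 0 0) (near_turnCos 4 0)

theorem not_discrete_σ₁_fifteen :
    ¬ IsDiscreteGroup (triangleGroup (2 * Real.pi / (15 : ℕ)) σ₁) := by
  obtain ⟨φ, hφ⟩ := exists_galConj_turnCos 120 19 (by norm_num) (by norm_num)
  exact not_discrete_of_line_galois (p := 15) (by norm_num) hasParams_σ₁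
    (powScalar_of_three _) (j := 1) (o := 5)
    (by norm_num) (by norm_num) (by rw [exp_pow_eq]; norm_num)
    (hφ 8 (by norm_num) rfl) (hφ 22 (by norm_num) rfl) (hφ 24 (by norm_num) rfl)
    (.ofNat 3) (.ofNat 5)
    (.mul (.ofNat 2) (hφ 15 (by norm_num) rfl))
    (paramApprox_σ₁ (near_turnCos 0 0.913545) (near_turnCos 0 0.406737)
      (near_turnCos 0 0.707107))
    (paramApprox_σ₁ (near_turnCos 3 (-0.104528)) (near_turnCos 7 (-0.994522))
      (near_turnCos 5 (-0.707107)))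
    (near_turnCos 0 0.309017) (near_turnCos 8 0.309017)

theorem not_discrete_σ₁_eighteen :
    ¬ IsDiscreteGroup (triangleGroup (2 * Real.pi / (18 : ℕ)) σ₁) := by
  obtain ⟨φ, hφ⟩ := exists_galConj_turnCos 72 13 (by norm_num) (by norm_num)
  exact not_discrete_of_line_galois (p := 18) (by norm_num) hasParams_σ₁
    (powScalar_of_three _) (j := 1) (o := 6)
    (by norm_num) (by norm_num) (by rw [exp_pow_eq]; norm_num)
    (hφ 4 (by norm_num) rfl) (hφ 14 (by norm_num) rfl) (hφ 12 (by norm_num) rfl)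
    (.ofNat 3) (.ofNat 5)
    (.mul (.ofNat 2) (hφ 9 (by norm_num) rfl))
    (paramApprox_σ₁ (near_turnCos 0 0.939693) (near_turnCos 0 0.34202)
      (near_turnCos 0 0.707107))
    (paramApprox_σ₁ (near_turnCos 1 (-0.173648)) (near_turnCos 5 (-0.984808))
      (near_turnCos 3 (-0.707107)))
    (near_turnCos 0 0.5) (near_turnCos 4 0.5)

theorem not_discrete_conj_σ₁_five :
    ¬ IsDiscreteGroup (triangleGroup (2 * Real.pi / (5 : ℕ)) (conj σ₁)) := by
  obtain ⟨φ, hφ⟩ := exists_galConj_turnCos 40 7 (by norm_num) (by norm_num)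
  exact not_discrete_of_line_galois (p := 5) (by norm_num) hasParams_σ₁.conj
    (powScalar_of_three _) (j := 3) (o := 5)
    (by norm_num) (by norm_num) (exp_pow_eq _ 3)
    (hφ 8 (by norm_num) rfl) (hφ 2 (by norm_num) rfl) (hφ 8 (by norm_num) rfl)
    (.ofNat 3) (.ofNat 5)
    (.neg (.mul (.ofNat 2) (hφ 5 (by norm_num) rfl)))
    (paramApprox_σ₁ (near_turnCos 0 0.309017) (near_turnCos 0 0.951057)
      (near_turnCos 0 0.707107)).conj
    (paramApprox_σ₁ (near_turnCos 3 (-0.809017)) (near_turnCos 1 (-0.587785))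
      (near_turnCos 2 0.707107)).conj
    (near_turnCos 0 0.309017) (near_turnCos 3 (-0.809017))

theorem not_discrete_σ₄_six :
    ¬ IsDiscreteGroup (triangleGroup (2 * Real.pi / (6 : ℕ)) σ₄) := by
  obtain ⟨φ, hφ⟩ := exists_galConj_turnCos 84 11 (by norm_num) (by norm_num)
  exact not_discrete_of_line_galois (p := 6) (by norm_num) hasParams_σ₄
    (powScalar_of_two _) (j := 5) (o := 6)
    (by norm_num) (by norm_num) (by rw [neg_exp_sq_eq]; norm_num)
    (hφ 14 (by norm_num) rfl) (hφ 7 (by norm_num) rfl) (hφ 14 (by norm_num) rfl)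
    (.ofNat 2) (.div (.ofNat 5) (.ofNat 2))
    (.neg (.add (.add (hφ 9 (by norm_num) rfl) (hφ 3 (by norm_num) rfl))
      (hφ 27 (by norm_num) rfl)))
    (paramApprox_σ₄ (near_turnCos 0 0.5) (near_turnCos 0 0.866025)
      (near_turnCos 0 0.781831) (near_turnCos 0 0.974928)
      (near_turnCos 1 (-0.433884)))
    (paramApprox_σ₄ (near_turnCos 4 0.5) (near_turnCos 2 0.866025)
      (near_turnCos 2 0.433884) (near_turnCos 1 (-0.781831))
      (near_turnCos 7 (-0.974928)))
    (near_turnCos 0 0.5) (near_turnCos 4 0.5)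

theorem not_discrete_conj_σ₄_twenty :
    ¬ IsDiscreteGroup (triangleGroup (2 * Real.pi / (20 : ℕ)) (conj σ₄)) := by
  obtain ⟨φ, hφ⟩ := exists_galConj_turnCos 140 17 (by norm_num) (by norm_num)
  exact not_discrete_of_line_galois (p := 20) (by norm_num) hasParams_σ₄.conj
    (powScalar_of_two _) (j := 3) (o := 5)
    (by norm_num) (by norm_num) (by rw [neg_exp_sq_eq]; norm_num)
    (hφ 7 (by norm_num) rfl) (hφ 28 (by norm_num) rfl) (hφ 28 (by norm_num) rfl)
    (.ofNat 2) (.div (.ofNat 5) (.ofNat 2))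
    (.neg (.neg (.add (.add (hφ 15 (by norm_num) rfl) (hφ 5 (by norm_num) rfl))
      (hφ 45 (by norm_num) rfl))))
    (paramApprox_σ₄ (near_turnCos 0 0.951057) (near_turnCos 0 0.309017)
      (near_turnCos 0 0.781831) (near_turnCos 0 0.974928)
      (near_turnCos 1 (-0.433884))).conj
    (paramApprox_σ₄ (near_turnCos 2 0.587785) (near_turnCos 7 (-0.809017))
      (near_turnCos 4 0.433884) (near_turnCos 1 (-0.781831))
      (near_turnCos 11 (-0.974928))).conj
    (near_turnCos 0 0.309017) (near_turnCos 7 (-0.809017))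

theorem not_discrete_σ₅_twenty :
    ¬ IsDiscreteGroup (triangleGroup (2 * Real.pi / (20 : ℕ)) σ₅) := by
  obtain ⟨φ, hφ⟩ := exists_galConj_turnCos 60 17 (by norm_num) (by norm_num)
  have hc := hφ 12 (x := 1/5) (by norm_num) rfl
  exact not_discrete_of_line_galois (p := 20) (by norm_num) hasParams_σ₅
    (powScalar_of_two _) (j := 3) (o := 5)
    (by norm_num) (by norm_num) (by rw [neg_exp_sq_eq]; norm_num)
    (hφ 3 (by norm_num) rfl) (hφ 12 (by norm_num) rfl) (hφ 12 (by norm_num) rfl)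
    (.ofNat 2) (.sub (.ofNat 2) (.div (.mul (.ofNat 2) hc) (.ofNat 2)))
    (.mul (hφ 5 (by norm_num) rfl) (.add (.ofNat 2) (.mul (.ofNat 2) hc)))
    (paramApprox_fifth (near_turnCos 0 0.951057) (near_turnCos 0 0.309017)
      (near_turnCos 0 0.309017) (near_turnCos 0 0.866025))
    (paramApprox_fifth (near_turnCos 2 0.587785) (near_turnCos 7 (-0.809017))
      (near_turnCos 7 (-0.809017)) (near_turnCos 3 (-0.866025)))
    (near_turnCos 0 0.309017) (near_turnCos 7 (-0.809017))

theorem not_discrete_σ₆_five :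
    ¬ IsDiscreteGroup (triangleGroup (2 * Real.pi / (5 : ℕ)) σ₆) := by
  obtain ⟨φ, hφ⟩ := exists_galConj_turnCos 60 7 (by norm_num) (by norm_num)
  have hc := hφ 24 (x := 2/5) (by norm_num) rfl
  exact not_discrete_of_line_galois (p := 5) (by norm_num) hasParams_σ₆
    (powScalar_of_two _) (j := 9) (o := 10)
    (by norm_num) (by norm_num) (by rw [neg_exp_sq_eq]; norm_num)
    (hφ 12 (by norm_num) rfl) (hφ 3 (by norm_num) rfl) (hφ 6 (by norm_num) rfl)
    (.ofNat 2) (.sub (.ofNat 2) (.div (.mul (.ofNat 2) hc) (.ofNat 2)))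
    (.mul (hφ 5 (by norm_num) rfl) (.add (.ofNat 2) (.mul (.ofNat 2) hc)))
    (paramApprox_fifth (near_turnCos 0 0.309017) (near_turnCos 0 0.951057)
      (near_turnCos 1 (-0.809017)) (near_turnCos 0 0.866025))
    (paramApprox_fifth (near_turnCos 3 (-0.809017)) (near_turnCos 1 (-0.587785))
      (near_turnCos 6 0.309017) (near_turnCos 1 (-0.866025)))
    (near_turnCos 0 0.809017) (near_turnCos 1 (-0.309017))

theorem not_discrete_conj_σ₆_five :
    ¬ IsDiscreteGroup (triangleGroup (2 * Real.pi / (5 : ℕ)) (conj σ₆)) := by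
  obtain ⟨φ, hφ⟩ := exists_galConj_turnCos 60 13 (by norm_num) (by norm_num)
  have hc := hφ 24 (x := 2/5) (by norm_num) rfl
  exact not_discrete_of_line_galois (p := 5) (by norm_num) hasParams_σ₆.conj
    (powScalar_of_two _) (j := 9) (o := 10)
    (by norm_num) (by norm_num) (by rw [neg_exp_sq_eq]; norm_num)
    (hφ 12 (by norm_num) rfl) (hφ 3 (by norm_num) rfl) (hφ 6 (by norm_num) rfl)
    (.ofNat 2) (.sub (.ofNat 2) (.div (.mul (.ofNat 2) hc) (.ofNat 2)))
    (.neg (.mul (hφ 5 (by norm_num) rfl) (.add (.ofNat 2) (.mul (.ofNat 2) hc))))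
    (paramApprox_fifth (near_turnCos 0 0.309017) (near_turnCos 0 0.951057)
      (near_turnCos 1 (-0.809017)) (near_turnCos 0 0.866025)).conj
    (paramApprox_fifth (near_turnCos 5 (-0.809017)) (near_turnCos 1 (-0.587785))
      (near_turnCos 10 0.309017) (near_turnCos 2 0.866025)).conj
    (near_turnCos 0 0.809017) (near_turnCos 3 (-0.309017))

theorem not_discrete_σ₇_five :
    ¬ IsDiscreteGroup (triangleGroup (2 * Real.pi / (5 : ℕ)) σ₇) := by
  obtain ⟨φ, hφ⟩ := exists_galConj_turnCos 420 83 (by norm_num) (by norm_num)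
  have hc := hφ 60 (x := 1 / 7) (by norm_num) rfl
  exact not_discrete_of_line_galois (p := 5) (by norm_num) hasParams_σ₇
    (powScalar_of_seventh _ two_turnCos_one_seventh_pow_three) (j := 7) (o := 5)
    (by norm_num) (by norm_num) (exp_pow_eq _ 7)
    (hφ 84 (by norm_num) rfl) (hφ 21 (by norm_num) rfl) (hφ 84 (by norm_num) rfl)
    hc.seventh_normSq hc.seventh_re (hc.seventh_im (hφ 35 (by norm_num) rfl))
    (paramApprox_seventh (near_turnCos 0 0.309017) (near_turnCos 0 0.951057)
      (near_turnCos 0 0.62349) (near_turnCos 0 0.866025))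
    (paramApprox_seventh (near_turnCos 33 (-0.809017)) (near_turnCos 8 0.587785)
      (near_turnCos 24 0.62349) (near_turnCos 14 0.866025))
    (near_turnCos 0 0.309017) (near_turnCos 33 (-0.809017))

theorem not_discrete_σ₇_six :
    ¬ IsDiscreteGroup (triangleGroup (2 * Real.pi / (6 : ℕ)) σ₇) := by
  obtain ⟨φ, hφ⟩ := exists_galConj_turnCos 84 5 (by norm_num) (by norm_num)
  have hc := hφ 12 (x := 1 / 7) (by norm_num) rfl
  exact not_discrete_of_line_galois (p := 6) (by norm_num) hasParams_σ₇
    (powScalar_of_seventh _ two_turnCos_one_seventh_pow_three) (j := 7) (o := 6)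
    (by norm_num) (by norm_num) (exp_pow_eq _ 7)
    (hφ 14 (by norm_num) rfl) (hφ 7 (by norm_num) rfl) (hφ 14 (by norm_num) rfl)
    hc.seventh_normSq hc.seventh_re (hc.seventh_im (hφ 7 (by norm_num) rfl))
    (paramApprox_seventh (near_turnCos 0 0.5) (near_turnCos 0 0.866025)
      (near_turnCos 0 0.62349) (near_turnCos 0 0.866025))
    (paramApprox_seventh (near_turnCos 2 0.5) (near_turnCos 1 (-0.866025))
      (near_turnCos 1 (-0.222521)) (near_turnCos 1 (-0.866025)))
    (near_turnCos 0 0.5) (near_turnCos 2 0.5)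

theorem not_discrete_σ₇_twenty_one :
    ¬ IsDiscreteGroup (triangleGroup (2 * Real.pi / (21 : ℕ)) σ₇) := by
  obtain ⟨φ, hφ⟩ := exists_galConj_turnCos 84 19 (by norm_num) (by norm_num)
  have hc := hφ 12 (x := 1 / 7) (by norm_num) rfl
  exact not_discrete_of_line_galois (p := 21) (by norm_num) hasParams_σ₇
    (powScalar_of_seventh _ two_turnCos_one_seventh_pow_three) (j := 1) (o := 3)
    (by norm_num) (by norm_num) (by rw [exp_pow_eq]; norm_num)
    (hφ 4 (by norm_num) rfl) (hφ 17 (by norm_num) rfl) (hφ 28 (by norm_num) rfl)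
    hc.seventh_normSq hc.seventh_re (hc.seventh_im (hφ 7 (by norm_num) rfl))
    (paramApprox_seventh (near_turnCos 0 0.955573) (near_turnCos 0 0.294755)
      (near_turnCos 0 0.62349) (near_turnCos 0 0.866025))
    (paramApprox_seventh (near_turnCos 2 0.826239) (near_turnCos 8 0.56332)
      (near_turnCos 5 (-0.222521)) (near_turnCos 3 (-0.866025)))
    (near_turnCos 1 (-0.5)) (near_turnCos 13 (-0.5))

theorem not_discrete_σ₇_twenty_eight :
    ¬ IsDiscreteGroup (triangleGroup (2 * Real.pi / (28 : ℕ)) σ₇) := by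
  obtain ⟨φ, hφ⟩ := exists_galConj_turnCos 84 13 (by norm_num) (by norm_num)
  have hc := hφ 12 (x := 1 / 7) (by norm_num) rfl
  exact not_discrete_of_line_galois (p := 28) (by norm_num) hasParams_σ₇
    (powScalar_of_seventh _ two_turnCos_one_seventh_pow_three) (j := 1) (o := 4)
    (by norm_num) (by norm_num) (by rw [exp_pow_eq]; norm_num)
    (hφ 3 (by norm_num) rfl) (hφ 18 (by norm_num) rfl) (hφ 21 (by norm_num) rfl)
    hc.seventh_normSq hc.seventh_re (hc.seventh_im (hφ 7 (by norm_num) rfl))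
    (paramApprox_seventh (near_turnCos 0 0.974928) (near_turnCos 0 0.222521)
      (near_turnCos 0 0.62349) (near_turnCos 0 0.866025))
    (paramApprox_seventh (near_turnCos 1 (-0.974928)) (near_turnCos 6 0.222521)
      (near_turnCos 4 0.62349) (near_turnCos 2 0.866025))
    (near_turnCos 0 0) (near_turnCos 6 0)

theorem not_discrete_σ₇_thirty_five :
    ¬ IsDiscreteGroup (triangleGroup (2 * Real.pi / (35 : ℕ)) σ₇) := by
  obtain ⟨φ, hφ⟩ := exists_galConj_turnCos 420 13 (by norm_num) (by norm_num)
  have hc := hφ 60 (x := 1 / 7) (by norm_num) rfl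
  exact not_discrete_of_line_galois (p := 35) (by norm_num) hasParams_σ₇
    (powScalar_of_seventh _ two_turnCos_one_seventh_pow_three) (j := 1) (o := 5)
    (by norm_num) (by norm_num) (by rw [exp_pow_eq]; norm_num)
    (hφ 12 (by norm_num) rfl) (hφ 93 (by norm_num) rfl) (hφ 84 (by norm_num) rfl)
    hc.seventh_normSq hc.seventh_re (hc.seventh_im (hφ 35 (by norm_num) rfl))
    (paramApprox_seventh (near_turnCos 0 0.98393) (near_turnCos 0 0.178557)
      (near_turnCos 0 0.62349) (near_turnCos 0 0.866025))
    (paramApprox_seventh (near_turnCos 1 (-0.691063)) (near_turnCos 6 0.722795)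
      (near_turnCos 4 0.62349) (near_turnCos 2 0.866025))
    (near_turnCos 0 0.309017) (near_turnCos 5 (-0.809017))

theorem not_discrete_σ₇_forty_two :
    ¬ IsDiscreteGroup (triangleGroup (2 * Real.pi / (42 : ℕ)) σ₇) := by
  obtain ⟨φ, hφ⟩ := exists_galConj_turnCos 84 5 (by norm_num) (by norm_num)
  have hc := hφ 12 (x := 1 / 7) (by norm_num) rfl
  exact not_discrete_of_line_galois (p := 42) (by norm_num) hasParams_σ₇
    (powScalar_of_seventh _ two_turnCos_one_seventh_pow_three) (j := 1) (o := 6)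
    (by norm_num) (by norm_num) (by rw [exp_pow_eq]; norm_num)
    (hφ 2 (by norm_num) rfl) (hφ 19 (by norm_num) rfl) (hφ 14 (by norm_num) rfl)
    hc.seventh_normSq hc.seventh_re (hc.seventh_im (hφ 7 (by norm_num) rfl))
    (paramApprox_seventh (near_turnCos 0 0.988831) (near_turnCos 0 0.149042)
      (near_turnCos 0 0.62349) (near_turnCos 0 0.866025))
    (paramApprox_seventh (near_turnCos 0 0.733052) (near_turnCos 2 0.680173)
      (near_turnCos 1 (-0.222521)) (near_turnCos 1 (-0.866025)))
    (near_turnCos 0 0.5) (near_turnCos 2 0.5)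

/-! ### Line reflections satisfying the Jørgensen-type inequality, for all large orders -/

theorem turnCos_le_cos {q : ℝ} {p : ℕ} (hq : 2 ≤ q) (hp : q ≤ p) :
    turnCos (1 / q) ≤ Real.cos (2 * Real.pi / p) := by
  have hπ := Real.pi_pos
  have hp0 : (0 : ℝ) < p := by linarith
  rw [turnCos]
  apply Real.cos_le_cos_of_nonneg_of_le_pi
  · positivity
  · rw [mul_one_div, div_le_iff₀ (by linarith)]
    nlinarith
  · rw [mul_one_div]
    gcongr

theorem sin_le_turnCos {q : ℝ} {p : ℕ} (hq : 4 ≤ q) (hp : q ≤ p) :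
    Real.sin (2 * Real.pi / p) ≤ turnCos (1 / 4 - 1 / q) := by
  have hπ := Real.pi_pos
  have hp0 : (0 : ℝ) < p := by linarith
  rw [← sin_two_pi_div]
  apply Real.sin_le_sin_of_le_of_le_pi_div_two
  · have : 0 < 2 * Real.pi / p := by positivity
    linarith
  · rw [div_le_iff₀ (by linarith)]
    nlinarith
  · gcongr

theorem sin_two_pi_div_pos {p : ℕ} (hp : 4 ≤ p) : 0 < Real.sin (2 * Real.pi / p) := by
  have hπ := Real.pi_pos
  have hp0 : (4 : ℝ) ≤ p := by exact_mod_cast hp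
  apply Real.sin_pos_of_pos_of_lt_pi
  · positivity
  · rw [div_lt_iff₀ (by linarith)]
    nlinarith

section Bounds

variable {C S t R I s : ℝ}

/-- The determinant of the form is negative when `Im τ³ > 0` and `2 - 2 cos ψ + Re τ³ ≤ 3 |τ|²`. -/
theorem one_lt_lineInv (hC : C < 1) (hS : 0 < S) (hI : 0 < I) (ht : 2 - 2 * C ≠ t)
    (hR : 2 - 2 * C + R ≤ 3 * t) : 1 < lineInv C S t R I := by
  have h : 0 < (t - (2 - 2 * C)) ^ 2 := by
    have := sub_ne_zero.2 ht.symm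
    positivity
  rw [lineInv, lt_div_iff₀ h]
  have h1 : 0 < S * I := mul_pos hS hI
  nlinarith [mul_nonneg (sub_nonneg.2 hC.le) (sub_nonneg.2 hR)]

variable {C₀ S₀ t₀ t₁ R₀ I₀ K s₀ : ℝ}

/-- The numerator of `lineInv` is bounded above, and its denominator below, by the values at the
largest angle. -/
theorem mul_lineInv_lt_one (hC0 : C₀ ≤ C) (hC1 : C ≤ 1) (hS0 : 0 ≤ S) (hS : S ≤ S₀)
    (hI0 : 0 ≤ I) (hI : I ≤ I₀) (ht0 : t₀ ≤ t) (ht1 : t ≤ t₁) (ht : 2 - 2 * C₀ < t₀)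
    (hK : t - R ≤ K) (hK0 : 0 ≤ K) (hs0 : 0 ≤ s) (hs : s ≤ s₀)
    (h : s₀ * (t₁ ^ 2 + (2 - 2 * C₀) * K + 2 * S₀ * I₀) < (t₀ - (2 - 2 * C₀)) ^ 2) :
    s * lineInv C S t R I < 1 := by
  have hpos : 0 < t - (2 - 2 * C) := by linarith
  rw [lineInv, ← mul_div_assoc, div_lt_one (by positivity)]
  have h1 : t ^ 2 ≤ t₁ ^ 2 := pow_le_pow_left₀ (by linarith) ht1 2
  have h2 : (2 - 2 * C) * (t - R) ≤ (2 - 2 * C₀) * K :=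
    (mul_le_mul_of_nonneg_left hK (by linarith)).trans
      (mul_le_mul_of_nonneg_right (by linarith) hK0)
  have h3 : 2 * S * I ≤ 2 * S₀ * I₀ := by
    have : 0 ≤ S₀ := hS0.trans hS
    gcongr
  have h4 : (t₀ - (2 - 2 * C₀)) ^ 2 ≤ (t - (2 - 2 * C)) ^ 2 :=
    pow_le_pow_left₀ (by linarith) (by linarith) 2
  have h5 : 0 ≤ t₁ ^ 2 + (2 - 2 * C₀) * K + 2 * S₀ * I₀ := by
    have := mul_nonneg (by linarith : 0 ≤ 2 - 2 * C₀) hK0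
    have := mul_nonneg (hS0.trans hS) (hI0.trans hI)
    nlinarith [sq_nonneg t₁]
  calc s * (t ^ 2 + (2 - 2 * C) * (t - R) + 2 * S * I)
      ≤ s * (t₁ ^ 2 + (2 - 2 * C₀) * K + 2 * S₀ * I₀) :=
        mul_le_mul_of_nonneg_left (by linarith) hs0
    _ ≤ s₀ * (t₁ ^ 2 + (2 - 2 * C₀) * K + 2 * S₀ * I₀) := mul_le_mul_of_nonneg_right hs h5
    _ < _ := h.trans_le h4

/-- The case where the line reflection has the same order as the generators; the inequality is
then quadratic in `2 - 2 cos ψ`. -/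
theorem angle_mul_lineInv_lt_one (hC0 : C₀ ≤ C) (hC1 : C ≤ 1) (hS0 : 0 ≤ S) (hS : S ≤ S₀)
    (hI0 : 0 ≤ I) (hI : I ≤ I₀) (ht0 : t₀ ≤ t) (ht1 : t ≤ t₁) (ht : 2 - 2 * C₀ < t₀)
    (hR : R₀ ≤ R) (hK : 2 * (2 - 2 * C₀) * (R₀ - t₁ + 1) ≤ t₁ ^ 2 + 2 * t₁)
    (hR1 : 0 ≤ R₀ - t₁ + 1)
    (h : (2 - 2 * C₀) * (t₁ ^ 2 + 2 * t₁) - (2 - 2 * C₀) ^ 2 * (R₀ - t₁ + 1) +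
      2 * (2 - 2 * C₀) * S₀ * I₀ < t₀ ^ 2) :
    (2 - 2 * C) * lineInv C S t R I < 1 := by
  have hpos : 0 < t - (2 - 2 * C) := by linarith
  rw [lineInv, ← mul_div_assoc, div_lt_one (by positivity)]
  set u := 2 - 2 * C with hu
  set u₀ := 2 - 2 * C₀ with hu₀
  have hu0 : 0 ≤ u := by linarith
  have huu : u ≤ u₀ := by linarith
  have h1 : t₀ ^ 2 ≤ t ^ 2 := pow_le_pow_left₀ (by linarith) ht0 2
  have h2 : t ^ 2 + 2 * t ≤ t₁ ^ 2 + 2 * t₁ := by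
    have := pow_le_pow_left₀ (by linarith) ht1 2
    linarith
  have h3 : u * S * I ≤ u₀ * S₀ * I₀ := by
    have : 0 ≤ u₀ := hu0.trans huu
    have : 0 ≤ S₀ := hS0.trans hS
    gcongr
  have h4 : u * (t₁ ^ 2 + 2 * t₁) - u ^ 2 * (R₀ - t₁ + 1) ≤
      u₀ * (t₁ ^ 2 + 2 * t₁) - u₀ ^ 2 * (R₀ - t₁ + 1) := by
    have h5 : 0 ≤ t₁ ^ 2 + 2 * t₁ - (u + u₀) * (R₀ - t₁ + 1) := by
      nlinarith [mul_le_mul_of_nonneg_right huu hR1]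
    nlinarith [mul_nonneg (sub_nonneg.2 huu) h5]
  have h6 : u ^ 2 * (R₀ - t₁ + 1) ≤ u ^ 2 * (R - t + 1) :=
    mul_le_mul_of_nonneg_left (by linarith) (sq_nonneg u)
  nlinarith [mul_le_mul_of_nonneg_left h2 hu0]

end Bounds

section Families

variable {τ : ℂ} {t R I t₀ t₁ R₀ I₀ : ℝ} {n p o j : ℕ} {κ : ℂ}

/-- The Jørgensen-type criterion for all `p ≥ q` and line reflections of order `o ≥ r`. -/
theorem not_discrete_of_line_family {q r : ℕ} (hq : 4 ≤ q) (hp : q ≤ p) (hr : 2 ≤ r)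
    (hτ : HasParams τ t R I)
    (hn : PowScalar (Complex.exp (Complex.I * ((2 * Real.pi / p : ℝ) : ℂ))) (2 - t) κ n)
    (ho : r ≤ o) (hj : j.Coprime o)
    (hκ : κ = Complex.exp (Complex.I * ((2 * Real.pi * (j / o) : ℝ) : ℂ)))
    {C₀ S₀ c₀ K : ℝ} (nC : Near (turnCos (1 / q)) C₀ 0.00001)
    (nS : Near (turnCos (1 / 4 - 1 / q)) S₀ 0.00001) (nc : Near (turnCos (1 / r)) c₀ 0.00001)
    (hI0 : 0 < I) (hI : I ≤ I₀) (ht0 : t₀ ≤ t) (ht1 : t ≤ t₁) (hK : t - R ≤ K) (hK0 : 0 ≤ K)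
    (hR : 2.00002 - 2 * C₀ + R ≤ 3 * t)
    (ht : 2.00002 - 2 * C₀ < t₀ := by norm_num)
    (h : (2.00002 - 2 * c₀) * (t₁ ^ 2 + (2.00002 - 2 * C₀) * K + 2 * (S₀ + 0.00001) * I₀) <
      (t₀ - (2.00002 - 2 * C₀)) ^ 2 := by norm_num) :
    ¬ IsDiscreteGroup (triangleGroup (2 * Real.pi / p) τ) := by
  have hq' : (4 : ℝ) ≤ q := by exact_mod_cast hq
  have hp' : (q : ℝ) ≤ p := by exact_mod_cast hp
  have ho' : (r : ℝ) ≤ o := by exact_mod_cast ho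
  have hr' : (2 : ℝ) ≤ r := by exact_mod_cast hr
  have hC := nC.lower.trans (turnCos_le_cos (by linarith) hp')
  have hc := nc.lower.trans (turnCos_le_cos hr' ho')
  have hS := (sin_le_turnCos hq' hp').trans nS.upper
  have hpos := two_sub_two_mul_cos_pos (o := p) (by omega)
  have hpos' := two_sub_two_mul_cos_pos (o := o) (by omega)
  have hS0 := sin_two_pi_div_pos (p := p) (by omega)
  refine not_discrete_of_line_jorgensen (by omega) hτ.normSq hτ.re hτ.im hn (by omega) hj hκ
    (by linarith) (one_lt_lineInv (by linarith) hS0 hI0 (by linarith) (by linarith)) ?_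
  refine mul_lineInv_lt_one (C₀ := C₀ - 0.00001) hC (by linarith) hS0.le hS hI0.le hI ht0 ht1
    (by linarith) hK hK0 hpos'.le (s₀ := 2.00002 - 2 * c₀) (by linarith) ?_
  rw [show 2 - 2 * (C₀ - 0.00001) = 2.00002 - 2 * C₀ by ring]
  exact h

/-- The Jørgensen-type criterion for all `p ≥ q` and line reflections of order `p`. -/
theorem not_discrete_of_line_family_same {q : ℕ} (hq : 4 ≤ q) (hp : q ≤ p)
    (hτ : HasParams τ t R I)
    (hn : PowScalar (Complex.exp (Complex.I * ((2 * Real.pi / p : ℝ) : ℂ))) (2 - t) κ n)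
    (hj : j.Coprime p)
    (hκ : κ = Complex.exp (Complex.I * ((2 * Real.pi * (j / p) : ℝ) : ℂ)))
    {C₀ S₀ : ℝ} (nC : Near (turnCos (1 / q)) C₀ 0.00001)
    (nS : Near (turnCos (1 / 4 - 1 / q)) S₀ 0.00001)
    (hI0 : 0 < I) (hI : I ≤ I₀) (ht0 : t₀ ≤ t) (ht1 : t ≤ t₁) (hR0 : R₀ ≤ R)
    (hR : 2.00002 - 2 * C₀ + R ≤ 3 * t)
    (ht : 2.00002 - 2 * C₀ < t₀ := by norm_num)
    (hK : 2 * (2.00002 - 2 * C₀) * (R₀ - t₁ + 1) ≤ t₁ ^ 2 + 2 * t₁ := by norm_num)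
    (hR1 : 0 ≤ R₀ - t₁ + 1 := by norm_num)
    (h : (2.00002 - 2 * C₀) * (t₁ ^ 2 + 2 * t₁) - (2.00002 - 2 * C₀) ^ 2 * (R₀ - t₁ + 1) +
      2 * (2.00002 - 2 * C₀) * (S₀ + 0.00001) * I₀ < t₀ ^ 2 := by norm_num) :
    ¬ IsDiscreteGroup (triangleGroup (2 * Real.pi / p) τ) := by
  have hq' : (4 : ℝ) ≤ q := by exact_mod_cast hq
  have hp' : (q : ℝ) ≤ p := by exact_mod_cast hp
  have hC := nC.lower.trans (turnCos_le_cos (by linarith) hp')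
  have hS := (sin_le_turnCos hq' hp').trans nS.upper
  have hpos := two_sub_two_mul_cos_pos (o := p) (by omega)
  have hS0 := sin_two_pi_div_pos (p := p) (by omega)
  refine not_discrete_of_line_jorgensen (by omega) hτ.normSq hτ.re hτ.im hn (by omega) hj hκ
    (by linarith) (one_lt_lineInv (by linarith) hS0 hI0 (by linarith) (by linarith)) ?_
  have e : 2 - 2 * (C₀ - 0.00001) = 2.00002 - 2 * C₀ := by ring
  refine angle_mul_lineInv_lt_one (C₀ := C₀ - 0.00001) (R₀ := R₀) hC (by linarith) hS0.le hS
    hI0.le hI ht0 ht1 (by linarith) hR0 ?_ hR1 ?_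
  · rwa [e]
  · rwa [e]

end Families

/-! ### The individual families -/

/-- The line reflections have order `p` or `p / 3`. The value `p = 9`, for which they have
order `3`, is excluded. -/
theorem not_discrete_σ₁_of_le {p : ℕ} (hp : 7 ≤ p) (h9 : p ≠ 9) :
    ¬ IsDiscreteGroup (triangleGroup (2 * Real.pi / p) σ₁) := by
  have hn : Near (2 * turnCos (1 / 8)) (2 * 0.707107) 0.0001 :=
    ((Near.const 2).mul (near_turnCos 0 0.707107)).mono (by norm_num)
  have hI0 : 0 < 2 * turnCos (1 / 8) := by
    have := hn.lower
    linarith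
  have hI : 2 * turnCos (1 / 8) ≤ 1.4144 := by
    have := hn.upper
    linarith
  by_cases h3 : 3 ∣ p
  · obtain ⟨m, rfl⟩ := h3
    by_cases hm : 7 ≤ m
    · refine not_discrete_of_line_family (q := 21) (r := 7) (t₀ := 3) (t₁ := 3) (K := 0)
        (by norm_num) (by omega) (by norm_num) hasParams_σ₁ (powScalar_of_three _) hm
        (Nat.coprime_one_left m) ?_ (near_turnCos 0 0.955573) (near_turnCos 0 0.294755)
        (near_turnCos 0 0.62349) hI0 hI le_rfl le_rfl (by norm_num) le_rfl (by norm_num)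
      have : (m : ℝ) ≠ 0 := by
        have : m ≠ 0 := by omega
        exact_mod_cast this
      rw [exp_pow_eq, show ((3 : ℕ) : ℝ) / ((3 * m : ℕ) : ℝ) = ((1 : ℕ) : ℝ) / (m : ℕ) by
        push_cast
        field_simp]
    · obtain rfl | rfl | rfl : m = 4 ∨ m = 5 ∨ m = 6 := by omega
      · exact not_discrete_σ₁_twelve
      · exact not_discrete_σ₁_fifteen
      · exact not_discrete_σ₁_eighteen
  · obtain rfl | h8 := hp.eq_or_lt
    · exact not_discrete_σ₁_seven
    · exact not_discrete_of_line_family_same (q := 8) (t₀ := 3) (t₁ := 3) (R₀ := 5)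
        (by norm_num) h8 hasParams_σ₁ (powScalar_of_three _)
        ((Nat.Prime.coprime_iff_not_dvd Nat.prime_three).2 h3) (exp_pow_eq p 3)
        (near_turnCos 0 0.707107) (near_turnCos 0 0.707107) hI0 hI le_rfl le_rfl le_rfl
        (by norm_num)

/-- The line reflections have order `p` or `p / 7`. The values `p = 7` and `p = 14` are excluded, as
the line reflections have order `1` and `2`. -/
theorem not_discrete_σ₇_of_le {p : ℕ} (hp : 5 ≤ p) (h7 : p ≠ 7) (h14 : p ≠ 14) :
    ¬ IsDiscreteGroup (triangleGroup (2 * Real.pi / p) σ₇) := by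
  have d := paramApprox_seventh (C := 0) (S := 0) (Near.const 0 |>.mono (by norm_num))
    (Near.const 0 |>.mono (by norm_num)) (near_turnCos (x := 1 / 7) 0 0.62349)
    (near_turnCos (x := 1 / 12) 0 0.866025)
  have ht0 := d.near_t.lower
  have ht1 := d.near_t.upper
  have hR0 := d.nearR.lower
  have hR1 := d.nearR.upper
  have hI0 := d.nearI.lower
  have hI1 := d.nearI.upper
  norm_num at ht0 ht1 hR0 hR1 hI0 hI1
  by_cases h : 7 ∣ p
  · obtain ⟨m, rfl⟩ := h
    by_cases hm : 7 ≤ m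
    · refine not_discrete_of_line_family (q := 49) (r := 7) (t₀ := 3.8) (t₁ := 3.803) (K := 0)
        (I₀ := 2.43) (by norm_num) (by omega) (by norm_num) hasParams_σ₇
        (powScalar_of_seventh _ two_turnCos_one_seventh_pow_three) hm
        (Nat.coprime_one_left m) ?_ (near_turnCos 0 0.99179) (near_turnCos 0 0.127877)
        (near_turnCos 0 0.62349) ?_ ?_ ?_ ?_ ?_ le_rfl ?_
      · have : (m : ℝ) ≠ 0 := by
          have : m ≠ 0 := by omega
          exact_mod_cast this
        rw [exp_pow_eq, show ((7 : ℕ) : ℝ) / ((7 * m : ℕ) : ℝ) = ((1 : ℕ) : ℝ) / (m : ℕ) by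
          push_cast
          field_simp]
      all_goals linarith
    · obtain rfl | rfl | rfl | rfl : m = 3 ∨ m = 4 ∨ m = 5 ∨ m = 6 := by omega
      · exact not_discrete_σ₇_twenty_one
      · exact not_discrete_σ₇_twenty_eight
      · exact not_discrete_σ₇_thirty_five
      · exact not_discrete_σ₇_forty_two
  · by_cases h8 : 8 ≤ p
    · refine not_discrete_of_line_family_same (q := 8) (t₀ := 3.8) (t₁ := 3.803) (R₀ := 7)
        (I₀ := 2.43) (by norm_num) h8 hasParams_σ₇
        (powScalar_of_seventh _ two_turnCos_one_seventh_pow_three)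
        ((Nat.Prime.coprime_iff_not_dvd (by norm_num)).2 h) (exp_pow_eq p 7)
        (near_turnCos 0 0.707107) (near_turnCos 0 0.707107) ?_ ?_ ?_ ?_ ?_ ?_
      all_goals linarith
    · obtain rfl | rfl : p = 5 ∨ p = 6 := by omega
      · exact not_discrete_σ₇_five
      · exact not_discrete_σ₇_six

/-- The line reflections of `Γ(2π/p, τ)`, `|τ|² = 2`, have multiplier `e^{2πi(p+4)/(2p)}` and
therefore order `2p`, `p`, `p / 2` or `p / 4`, depending on `p` modulo `8`. For each of these four
classes there is one hypothesis, the Jørgensen-type inequality for the smallest `p` to be treated,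
which its name records. -/
theorem not_discrete_of_normSq_two {τ : ℂ} {R I I₀ K : ℝ} (hτ : HasParams τ 2 R I) (hI0 : 0 < I)
    (hI : I ≤ I₀) (hR : R ≤ 3) (hK : 2 - R ≤ K) (hK0 : 0 ≤ K)
    (h7 : (2.00002 - 2 * 0.900969) * (2 ^ 2 + (2.00002 - 2 * 0.62349) * K +
      2 * (0.781831 + 0.00001) * I₀) < (2 - (2.00002 - 2 * 0.62349)) ^ 2)
    (h10 : (2.00002 - 2 * 0.809017) * (2 ^ 2 + (2.00002 - 2 * 0.809017) * K +
      2 * (0.587785 + 0.00001) * I₀) < (2 - (2.00002 - 2 * 0.809017)) ^ 2)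
    (h16 : (2.00002 - 2 * 0.707107) * (2 ^ 2 + (2.00002 - 2 * 0.92388) * K +
      2 * (0.382683 + 0.00001) * I₀) < (2 - (2.00002 - 2 * 0.92388)) ^ 2)
    (h28 : (2.00002 - 2 * 0.62349) * (2 ^ 2 + (2.00002 - 2 * 0.974928) * K +
      2 * (0.222521 + 0.00001) * I₀) < (2 - (2.00002 - 2 * 0.974928)) ^ 2)
    {p : ℕ} (hp : 7 ≤ p) (h8 : p ≠ 8) (h12 : p ≠ 12) (h20 : p ≠ 20) :
    ¬ IsDiscreteGroup (triangleGroup (2 * Real.pi / p) τ) := by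
  have hp0 : (p : ℝ) ≠ 0 := by
    have : p ≠ 0 := by omega
    exact_mod_cast this
  have key : ∀ j o : ℕ, 0 < o → o * (p + 4) = j * (2 * p) →
      -Complex.exp (Complex.I * ((2 * Real.pi / p : ℝ) : ℂ)) ^ 2 =
        Complex.exp (Complex.I * ((2 * Real.pi * (j / o) : ℝ) : ℂ)) := by
    intro j o ho h
    have ho' : (o : ℝ) ≠ 0 := by exact_mod_cast ho.ne'
    have h' : (o : ℝ) * (p + 4) = j * (2 * p) := by exact_mod_cast h
    rw [neg_exp_sq_eq, show (1 / 2 + 2 / p : ℝ) = j / o by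
      field_simp
      linear_combination h']
  obtain h | ⟨m, h⟩ : p % 2 = 1 ∨ ∃ m, p = 2 * m := by
    rcases Nat.mod_two_eq_zero_or_one p with h | h
    · exact Or.inr ⟨p / 2, by omega⟩
    · exact Or.inl h
  · refine not_discrete_of_line_family (q := 7) (r := 14) (o := 2 * p) (j := p + 4) (by norm_num)
      hp (by norm_num) hτ (powScalar_of_two _) (by omega) ?_ (key _ _ (by omega) (by ring))
      (near_turnCos 0 0.62349) (near_turnCos 0 0.781831) (near_turnCos 0 0.900969) hI0 hI
      le_rfl le_rfl hK hK0 (by linarith) (by norm_num) h7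
    have hodd : Odd p := Nat.odd_iff.2 h
    apply Nat.Coprime.mul_right
    · rw [Nat.coprime_two_right]
      exact hodd.add_even (by decide)
    · rw [Nat.coprime_self_add_left]
      exact Nat.Coprime.pow_left 2 (Nat.coprime_two_left.2 hodd)
  obtain h' | ⟨k, h'⟩ : m % 2 = 1 ∨ ∃ k, m = 2 * k := by
    rcases Nat.mod_two_eq_zero_or_one m with h | h
    · exact Or.inr ⟨m / 2, by omega⟩
    · exact Or.inl h
  · refine not_discrete_of_line_family (q := 10) (r := 10) (o := p) (j := m + 2) (by norm_num)
      (by omega) (by norm_num) hτ (powScalar_of_two _) (by omega) ?_ (key _ _ (by omega) ?_)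
      (near_turnCos 0 0.809017) (near_turnCos 0 0.587785) (near_turnCos 0 0.809017) hI0 hI
      le_rfl le_rfl hK hK0 (by linarith) (by norm_num) h10
    · have hodd : Odd m := Nat.odd_iff.2 h'
      rw [h]
      apply Nat.Coprime.mul_right
      · rw [Nat.coprime_two_right]
        exact hodd.add_even (by decide)
      · rw [Nat.coprime_self_add_left]
        exact Nat.coprime_two_left.2 hodd
    · rw [h]
      ring
  obtain h'' | ⟨l, h''⟩ : k % 2 = 0 ∨ ∃ l, k = 2 * l + 1 := by
    rcases Nat.mod_two_eq_zero_or_one k with h | h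
    · exact Or.inl h
    · exact Or.inr ⟨k / 2, by omega⟩
  · refine not_discrete_of_line_family (q := 16) (r := 8) (o := m) (j := k + 1) (by norm_num)
      (by omega) (by norm_num) hτ (powScalar_of_two _) (by omega) ?_ (key _ _ (by omega) ?_)
      (near_turnCos 0 0.92388) (near_turnCos 0 0.382683) (near_turnCos 0 0.707107) hI0 hI
      le_rfl le_rfl hK hK0 (by linarith) (by norm_num) h16
    · rw [h']
      apply Nat.Coprime.mul_right
      · rw [Nat.coprime_two_right]
        exact (Nat.even_iff.2 h'').add_odd (by decide)
      · simp
    · rw [h, h']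
      ring
  · refine not_discrete_of_line_family (q := 28) (r := 7) (o := k) (j := l + 1) (by norm_num)
      (by omega) (by norm_num) hτ (powScalar_of_two _) (by omega) ?_ (key _ _ (by omega) ?_)
      (near_turnCos 0 0.974928) (near_turnCos 0 0.222521) (near_turnCos 0 0.62349) hI0 hI
      le_rfl le_rfl hK hK0 (by linarith) (by norm_num) h28
    · rw [h'', show 2 * l + 1 = l + (l + 1) by ring]
      simp
    · rw [h, h', h'']
      ring

theorem not_discrete_conj_σ₄_of_le {p : ℕ} (hp : 7 ≤ p) (h8 : p ≠ 8) (h12 : p ≠ 12) :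
    ¬ IsDiscreteGroup (triangleGroup (2 * Real.pi / p) (conj σ₄)) := by
  by_cases h20 : p = 20
  · subst h20
    exact not_discrete_conj_σ₄_twenty
  have d := (paramApprox_σ₄ (C := 0) (S := 0) (Near.const 0 |>.mono (by norm_num))
    (Near.const 0 |>.mono (by norm_num)) (near_turnCos (x := 3 / 28) 0 0.781831)
    (near_turnCos (x := 1 / 28) 0 0.974928) (near_turnCos (x := 9 / 28) 1 (-0.433884))).conj
  have hI0 := d.nearI.lower
  have hI1 := d.nearI.upper
  norm_num at hI0 hI1
  refine not_discrete_of_normSq_two (I₀ := 1.324) (K := 0) hasParams_σ₄.conj (by linarith)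
    (by linarith) (by norm_num) (by norm_num) le_rfl ?_ ?_ ?_ ?_ hp h8 h12 h20
  all_goals norm_num

theorem not_discrete_σ₅_of_le {p : ℕ} (hp : 7 ≤ p) (h8 : p ≠ 8) (h12 : p ≠ 12) :
    ¬ IsDiscreteGroup (triangleGroup (2 * Real.pi / p) σ₅) := by
  by_cases h20 : p = 20
  · subst h20
    exact not_discrete_σ₅_twenty
  have d := paramApprox_fifth (C := 0) (S := 0) (Near.const 0 |>.mono (by norm_num))
    (Near.const 0 |>.mono (by norm_num)) (near_turnCos (x := 1 / 5) 0 0.309017)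
    (near_turnCos (x := 1 / 12) 0 0.866025)
  have hI0 := d.nearI.lower
  have hI1 := d.nearI.upper
  have hR0 := d.nearR.lower
  have hR1 := d.nearR.upper
  norm_num at hI0 hI1 hR0 hR1
  refine not_discrete_of_normSq_two (I₀ := 2.2678) (K := 0.3096) hasParams_σ₅ (by linarith)
    (by linarith) (by linarith) (by linarith) (by norm_num) ?_ ?_ ?_ ?_ hp h8 h12 h20
  all_goals norm_num

/-! ### A word in a basis reflection and a line reflection -/

section LineOrbit

variable {ψ : ℝ} {τ : ℂ} {v₀ v₁ v₂ : ℂ}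

theorem InOrbit.refl_zero (h : InOrbit ψ τ ![v₀, v₁, v₂]) (hd : diagEntry ψ ≠ 0) :
    InOrbit ψ τ ![v₀ + halfRot ψ *
      (diagEntry ψ * v₀ + offDiag ψ τ * v₁ + conj (offDiag ψ τ) * v₂), v₁, v₂] := by
  have := h.refl hd 0
  rw [single_zero_eq, sesq_formH] at this
  simpa using this

theorem sesq_polarVec : sesq (formH ψ τ) (polarVec ψ τ) ![v₀, v₁, v₂] = formDet ψ τ * v₂ := by
  rw [polarVec, sesq_formH, formDet]
  simp only [map_sub, map_mul, map_pow, Complex.conj_conj, Complex.conj_ofReal]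
  ring

/-- The image of an orbit vector under a power of `R₁ R₂` that is a complex reflection. -/
theorem InOrbit.line (h : InOrbit ψ τ ![v₀, v₁, v₂]) (hd : diagEntry ψ ≠ 0)
    (ht : Complex.normSq τ ≠ 2 - 2 * Real.cos ψ)
    (hc : sesq (formH ψ τ) (polarVec ψ τ) (polarVec ψ τ) ≠ 0) {n : ℕ} {κ : ℂ} (hκ : ‖κ‖ = 1)
    (hn : PowScalar (Complex.exp (Complex.I * ψ)) (2 - Complex.normSq τ) κ n) :
    InOrbit ψ τ (![v₀, v₁, v₂] + ((κ⁻¹ - 1) /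
      (diagEntry ψ ^ 2 - offDiag ψ τ * conj (offDiag ψ τ)) * v₂) • polarVec ψ τ) := by
  have h1 := crefl_mulVec (H := formH ψ τ) (polarVec ψ τ) ![v₀, v₁, v₂] κ⁻¹
  rw [sesq_polarVec, sesq_polarVec_self] at h1
  have h2 := h.mulVec (projMem_crefl_polarVec hd ht hc hκ hn)
    (crefl_isometry (formH_isHermitian ψ τ) hc (by rw [norm_inv, hκ, inv_one]))
  rw [h1] at h2
  convert h2 using 3
  rw [sesq_polarVec_self] at hc
  have := left_ne_zero_of_mul hc
  have := right_ne_zero_of_mul hc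
  field_simp

/-- `|⟨e₃, (R₁ R₂)³ R₁ R₂ R₁ e₃⟩|²` for `|τ|² = 3` and `Re τ³ = 5`. -/
noncomputable def lineOrbitInv (C S I : ℝ) : ℝ :=
  4 * S ^ 2 + 4 * S * I * (1 + C) + I ^ 2 * (2 + 2 * C) +
    (4 * (2 - 2 * C) + 2 * S * I - (2 - 2 * C) ^ 2) ^ 2 -
    2 * (4 * (2 - 2 * C) + 2 * S * I - (2 - 2 * C) ^ 2) *
      (4 * C - 4 * C ^ 3 + I * S * (4 * C ^ 2 + 2 * C - 1))

theorem exists_orbit_lineOrbitInv (hd : diagEntry ψ ≠ 0) (h3 : Complex.normSq τ = 3)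
    (h5 : (τ ^ 3).re = 5) (ht : Complex.normSq τ ≠ 2 - 2 * Real.cos ψ)
    (hc : sesq (formH ψ τ) (polarVec ψ τ) (polarVec ψ τ) ≠ 0) :
    ∃ v₀ v₁ v₂, InOrbit ψ τ ![v₀, v₁, v₂] ∧
    Complex.normSq (diagEntry ψ * v₀ + offDiag ψ τ * v₁ + conj (offDiag ψ τ) * v₂) =
      lineOrbitInv (Real.cos ψ) (Real.sin ψ) (τ ^ 3).im := by
  have hn : PowScalar (Complex.exp (Complex.I * ψ)) (2 - Complex.normSq τ)
      (Complex.exp (Complex.I * ψ) ^ 3) 3 := by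
    rw [h3]
    exact powScalar_of_three _
  have h := (((InOrbit.two.refl_zero hd).refl_one hd).refl_zero hd).line hd ht hc
    (by rw [norm_pow, norm_exp_I_mul, one_pow]) hn
  rw [polarVec, Matrix.smul_cons, Matrix.smul_cons, Matrix.smul_cons, Matrix.cons_add_cons,
    Matrix.cons_add_cons, Matrix.cons_add_cons] at h
  simp only [Matrix.smul_empty, Matrix.empty_add_empty, smul_eq_mul] at h
  refine ⟨_, _, _, h.rotate, ?_⟩
  have hm : (diagEntry ψ : ℂ) ^ 2 - offDiag ψ τ * conj (offDiag ψ τ) ≠ 0 := by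
    rw [minor_eq]
    exact_mod_cast sub_ne_zero.2 ht.symm
  have hab : offDiag ψ τ * conj (offDiag ψ τ) = 3 := by
    rw [offDiag_mul_conj, h3]
    norm_num
  have hdy := ofReal_diagEntry ψ
  have hy := halfRot_ne_zero ψ
  set y := halfRot ψ with hydef
  set a := offDiag ψ τ with hadef
  set b := conj a with hbdef
  set w : ℂ := ((τ ^ 3).im : ℂ) with hw
  -- `a³` and `b³` are determined by `τ³ = 5 + i w`
  have hτ3 : τ ^ 3 = 5 + Complex.I * w := by
    conv_lhs => rw [← Complex.re_add_im (τ ^ 3), h5]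
    push_cast
    ring
  have ha3 : a ^ 3 = -y⁻¹ * (5 + Complex.I * w) := by
    have := pow_three_eq_offDiag ψ τ
    rw [hτ3] at this
    rw [this, ← hydef, ← hadef]
    field_simp
  have hb3 : b ^ 3 = -y * (5 - Complex.I * w) := by
    have h1 := conj_pow_three_eq ψ τ
    have h2 : conj (5 + Complex.I * w) = 5 - Complex.I * w := by
      rw [map_add, map_mul, Complex.conj_I, hw, Complex.conj_ofReal, map_ofNat]
      ring
    rw [hτ3, h2] at h1
    rw [h1, ← hydef, ← hadef, ← hbdef]
    field_simp
  set κ := Complex.exp (Complex.I * ψ) ^ 3 with hκ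
  have hκy : κ⁻¹ = -(y⁻¹) ^ 6 := by
    rw [hκ, exp_eq_neg_halfRot_sq, ← hydef]
    field_simp
  set d : ℂ := (diagEntry ψ : ℂ) with hdd
  set Q : ℂ := 4 * d ^ 2 + Complex.I * (y ^ 2 - y⁻¹ ^ 2) * w - d ^ 4 with hQ
  have hm' : d ^ 2 - 3 ≠ 0 := by rwa [← hab]
  have hdet : (κ⁻¹ - 1) / (d ^ 2 - a * b) * (d ^ 3 + a ^ 3 + b ^ 3 - 3 * d * (a * b)) =
      -(y⁻¹ ^ 3 * Q) := by
    rw [hab, div_mul_eq_mul_div, div_eq_iff hm', hκy, ha3, hb3, hQ, hdy]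
    field_simp
    ring
  have hA : d + a * (y * b + y * (d * (y * b) + a * (y * (b * (y * b) + a)) + b)) +
      b * (y * (b * (y * b) + a)) = -y⁻¹ + y ^ 3 + Complex.I * w * (y ^ 3 - y) := by
    have e : d + a * (y * b + y * (d * (y * b) + a * (y * (b * (y * b) + a)) + b)) +
      b * (y * (b * (y * b) + a)) = d + 3 * y * (a * b) + d * y ^ 2 * (a * b) +
        y ^ 3 * (a * b) ^ 2 + y ^ 2 * (a ^ 3 + b ^ 3) := by ring
    rw [e, hab, ha3, hb3, hdy]
    field_simp
    ring
  have hval : ∀ k : ℂ,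
      d * (1 + k * 1 * (d ^ 2 - a * b)) + a * (0 + y * (d * 0 + a * 0 + b * 1) + y * (d * (0 + y *
        (d * 0 + a * 0 + b * 1)) + a * (0 + y * (b * (0 + y * (d * 0 + a * 0 + b * 1)) + d * 0 +
        a * 1)) + b * 1) + k * 1 * (a ^ 2 - b * d)) + b * (0 + y * (b * (0 + y * (d * 0 + a * 0 +
        b * 1)) + d * 0 + a * 1) + k * 1 * (b ^ 2 - a * d)) =
      (d + a * (y * b + y * (d * (y * b) + a * (y * (b * (y * b) + a)) + b)) +
        b * (y * (b * (y * b) + a))) + k * (d ^ 3 + a ^ 3 + b ^ 3 - 3 * d * (a * b)) := by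
    intro k
    ring
  rw [hval, hdet, hA]
  apply Complex.ofReal_injective
  unfold lineOrbitInv
  have hconjw : conj w = w := Complex.conj_ofReal _
  have hconjd : conj d = d := Complex.conj_ofReal _
  have hconjy : conj y = y⁻¹ := conj_halfRot_eq_inv ψ
  push_cast
  rw [Complex.normSq_eq_conj_mul_self, complex_cos_eq, complex_sin_eq, ← hydef, ← hw, hQ]
  simp only [map_sub, map_add, map_mul, map_neg, map_inv₀, map_pow, map_ofNat, Complex.conj_I,
    hconjw, hconjd, hconjy, inv_inv]
  rw [hdy]
  field_simp
  ring_nf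
  simp only [Complex.I_sq]
  ring

end LineOrbit

/-! ### Groups handled by the orbit of a basis vector -/

theorem cos_two_pi_div_le_turnCos {q : ℝ} {p : ℕ} (hp0 : 2 ≤ p) (hp : p ≤ q) :
    Real.cos (2 * Real.pi / p) ≤ turnCos (1 / q) := by
  have hπ := Real.pi_pos
  have hp2 : (2 : ℝ) ≤ p := by exact_mod_cast hp0
  have hq : 0 < q := by linarith
  rw [turnCos, mul_one_div]
  apply Real.cos_le_cos_of_nonneg_of_le_pi
  · positivity
  · rw [div_le_iff₀ (by linarith)]
    nlinarith
  · gcongr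

theorem turnCos_le_sin {q : ℝ} {p : ℕ} (hp0 : 4 ≤ p) (hp : p ≤ q) :
    turnCos (1 / 4 - 1 / q) ≤ Real.sin (2 * Real.pi / p) := by
  have hπ := Real.pi_pos
  have hp2 : (4 : ℝ) ≤ p := by exact_mod_cast hp0
  have hq : 0 < q := by linarith
  rw [← sin_two_pi_div]
  apply Real.sin_le_sin_of_le_of_le_pi_div_two
  · have : 0 < 2 * Real.pi / q := by positivity
    linarith
  · rw [div_le_iff₀ (by linarith)]
    nlinarith
  · gcongr

/-- The vector `(R₁ R₂)³ R₁ R₂ R₁ e₃` has a small invariant. -/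
theorem not_discrete_σ₁_nine :
    ¬ IsDiscreteGroup (triangleGroup (2 * Real.pi / (9 : ℕ)) σ₁) := by
  have nC : Near (turnCos (1 / (9 : ℕ))) 0.766044 0.00001 := near_turnCos 0 0.766044
  have nS : Near (turnCos (1 / 4 - 1 / (9 : ℕ))) 0.642788 0.00001 := near_turnCos 0 0.642788
  have nI : Near (2 * turnCos (1 / 8)) 1.414214 0.00003 :=
    ((Near.const 2).mul (near_turnCos 0 0.707107)).recenter
  have hpos := two_sub_two_mul_cos_pos (o := 9) (by norm_num)
  have hd := diagEntry_ne_zero (p := 9) (by norm_num)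
  have ht : Complex.normSq σ₁ ≠ 2 - 2 * Real.cos (2 * Real.pi / (9 : ℕ)) := by
    rw [hasParams_σ₁.normSq, cos_two_pi_div]
    have := nC.lower
    norm_num at this ⊢
    linarith
  have h1 : 1 < lineInv (Real.cos (2 * Real.pi / (9 : ℕ))) (Real.sin (2 * Real.pi / (9 : ℕ)))
      (Complex.normSq σ₁) (σ₁ ^ 3).re (σ₁ ^ 3).im := by
    rw [hasParams_σ₁.normSq, hasParams_σ₁.re, hasParams_σ₁.im]
    rw [hasParams_σ₁.normSq] at ht
    refine one_lt_lineInv (by linarith) (sin_two_pi_div_pos (by norm_num)) ?_ ht.symm ?_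
    · have := nI.lower
      linarith
    · rw [cos_two_pi_div]
      have := nC.lower
      linarith
  obtain ⟨v₀, v₁, v₂, hv, hL⟩ := exists_orbit_lineOrbitInv hd hasParams_σ₁.normSq
    hasParams_σ₁.re ht (sesq_polarVec_ne_zero ht h1.ne')
  rw [hasParams_σ₁.im, cos_two_pi_div, sin_two_pi_div] at hL
  set C := turnCos (1 / (9 : ℕ)) with hCdef
  set S := turnCos (1 / 4 - 1 / (9 : ℕ)) with hSdef
  set I := 2 * turnCos (1 / 8) with hIdef
  have ns : Near (2 - 2 * C) 0.467912 0.00003 :=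
    ((Near.const 2).sub ((Near.const 2).mul nC)).recenter
  have nSI : Near (S * I) 0.90904 0.0001 := (nS.mul nI).recenter
  have nC2 : Near (C * C) 0.586824 0.0001 := (nC.mul nC).recenter
  have nQ : Near (4 * (2 - 2 * C) + 2 * (S * I) - (2 - 2 * C) * (2 - 2 * C)) 3.470786 0.0005 :=
    ((((Near.const 4).mul ns).add ((Near.const 2).mul nSI)).sub (ns.mul ns)).recenter
  have nM : Near (4 * C - 4 * (C * (C * C)) + S * I * (4 * (C * C) + 2 * C - 1)) 3.88352 0.002 :=
    ((((Near.const 4).mul nC).sub ((Near.const 4).mul (nC.mul nC2))).add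
      (nSI.mul ((((Near.const 4).mul nC2).add ((Near.const 2).mul nC)).sub
        (Near.const 1)))).recenter
  have nL : Near (lineOrbitInv C S I) 0.2271 0.1 := by
    have n := ((((Near.const 4).mul (nS.mul nS)).add (((Near.const 4).mul nSI).mul
      ((Near.const 1).add nC))).add ((nI.mul nI).mul ((Near.const 2).add
        ((Near.const 2).mul nC)))).add ((nQ.mul nQ).sub (((Near.const 2).mul nQ).mul nM))
    have n' := n.recenter (r := 0.2271) (ε := 0.1)
    convert n' using 1
    rw [lineOrbitInv]
    ring
  have h0 := nL.lower
  have h2 := nL.upper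
  have h3 := ns.lower
  have h4 := ns.upper
  refine not_discrete_of_orbit_jorgensen hv hd hL ?_ ?_ ?_ ?_
  · linarith
  · linarith
  · rw [cos_two_pi_div]
    linarith
  · rw [cos_two_pi_div]
    intro h
    rw [← hCdef] at h
    linarith

/-- The invariant `2 - 2 cos (π / 5)` of the vector `(R₃⁻¹ R₂⁻¹)² e₃` does not depend on `p`. For
`p = 10` it is equal to `2 - 2 cos ψ`, which both criteria exclude, and the vector `R₂ R₃ e₁` is
used instead. -/
theorem not_discrete_σ₂_of_le {p : ℕ} (hp : 6 ≤ p) :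
    ¬ IsDiscreteGroup (triangleGroup (2 * Real.pi / p) σ₂) := by
  have hd := diagEntry_ne_zero (p := p) (by omega)
  have hsq := two_turnCos_tenth_sq
  by_cases h10 : p = 10
  · subst h10
    obtain ⟨φ, hφ⟩ := exists_galConj_turnCos 20 3 (by norm_num) (by norm_num)
    obtain ⟨v₀, v₁, v₂, hv, hL⟩ := exists_orbit_coxeterInv (τ := σ₂) hd
    have e : ∀ {c C S : ℝ}, c ^ 2 = c + 1 → coxeterInv C S (c + 2) (3 * c + 2) (c - 1) =
        5 - 2 * c - 2 * (c - 1) * (C - S) := by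
      intro c C S hc
      rw [coxeterInv]
      linear_combination (c - 1) * hc
    rw [hasParams_σ₂.normSq, hasParams_σ₂.re, hasParams_σ₂.im, e hsq, cos_two_pi_div,
      sin_two_pi_div] at hL
    have hc := hφ 2 (x := 1 / 10) (by norm_num) rfl
    have hC := hφ 2 (x := 1 / (10 : ℕ)) (by norm_num) rfl
    have hS := hφ 3 (x := 1 / 4 - 1 / (10 : ℕ)) (by norm_num) rfl
    have g : GalConj φ (5 - 2 * (2 * turnCos (1 / 10)) - 2 * (2 * turnCos (1 / 10) - 1) *
        (turnCos (1 / (10 : ℕ)) - turnCos (1 / 4 - 1 / (10 : ℕ)))) _ :=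
      ((GalConj.ofNat 5).sub ((GalConj.ofNat 2).mul ((GalConj.ofNat 2).mul hc))).sub
        (((GalConj.ofNat 2).mul (((GalConj.ofNat 2).mul hc).sub .one)).mul (hC.sub hS))
    have n : Near (5 - 2 * (2 * turnCos (1 / 10)) - 2 * (2 * turnCos (1 / 10) - 1) *
        (turnCos (1 / (10 : ℕ)) - turnCos (1 / 4 - 1 / (10 : ℕ)))) 1.4905 0.01 :=
      (((Near.const 5).sub ((Near.const 2).mul ((Near.const 2).mul (near_turnCos 0 0.809017)))).sub
        (((Near.const 2).mul (((Near.const 2).mul (near_turnCos 0 0.809017)).sub (.const 1))).mul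
          ((near_turnCos 0 0.809017).sub (near_turnCos 0 0.587785)))).recenter
    have n' := (((Near.const 5).sub ((Near.const 2).mul ((Near.const 2).mul
      (near_turnCos (x := (3 : ℕ) * (2 : ℤ) / (20 : ℕ)) 1 (-0.309017))))).sub
        (((Near.const 2).mul (((Near.const 2).mul
          (near_turnCos (x := (3 : ℕ) * (2 : ℤ) / (20 : ℕ)) 1 (-0.309017))).sub (.const 1))).mul
          ((near_turnCos (x := (3 : ℕ) * (2 : ℤ) / (20 : ℕ)) 1 (-0.309017)).sub
            (near_turnCos (x := (3 : ℕ) * (3 : ℤ) / (20 : ℕ)) 1 (-0.951057))))).recenter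
              (r := 8.3138) (ε := 0.01)
    have h1 := n.lower
    have h2 := n.upper
    have h3 := n'.lower
    have hs := (near_turnCos (x := 1 / (10 : ℕ)) 0 0.809017).lower
    refine not_discrete_of_orbit_irrational hv hd hL (by linarith) (by linarith) ?_ g ?_
    · rw [cos_two_pi_div]
      intro h
      linarith
    · exact lt_of_lt_of_le (by norm_num) h3
  · obtain ⟨v₀, v₁, v₂, hv, hL⟩ := exists_orbit_inv_sq (τ := σ₂) hd
    have e : ∀ {c : ℝ}, c ^ 2 = c + 1 → (c + 2) * ((2 - (c + 2)) * (1 - (c + 2)) - 1) ^ 2 +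
        (2 - (c + 2)) ^ 2 * (c + 2) ^ 2 + 2 * (2 - (c + 2)) * ((2 - (c + 2)) * (1 - (c + 2)) - 1) *
          (3 * c + 2) = 2 - c := by
      intro c hc
      have h1 : (2 - (c + 2)) * (1 - (c + 2)) - 1 = 2 * c := by linear_combination hc
      rw [h1]
      linear_combination (c ^ 2 - 3 * c + 2) * hc
    rw [hasParams_σ₂.normSq, hasParams_σ₂.re, e hsq] at hL
    have hn := near_turnCos (x := 1 / 10) 0 0.809017
    have h1 := hn.lower
    have h2 := hn.upper
    have h6 : turnCos (1 / 6) ≤ Real.cos (2 * Real.pi / p) :=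
      turnCos_le_cos (by norm_num) (by exact_mod_cast hp)
    have h6' : turnCos (1 / 6) = 1 / 2 := by
      rw [turnCos, show 2 * Real.pi * (1 / 6) = Real.pi / 3 by ring, Real.cos_pi_div_three]
    refine not_discrete_of_orbit_jorgensen hv hd hL ?_ ?_ ?_ ?_
    · linarith
    · linarith
    · linarith
    · intro h
      have h7 : Real.cos (2 * Real.pi / p) = Real.cos (2 * Real.pi / 10) := by
        rw [cos_two_pi_div 10]
        linarith
      have hp0 : (6 : ℝ) ≤ p := by exact_mod_cast hp
      have h8 := Real.injOn_cos ⟨by positivity, ?_⟩ ⟨by positivity, ?_⟩ h7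
      · apply h10
        have : (p : ℝ) = 10 := by
          have := Real.pi_pos
          field_simp at h8
          linarith
        exact_mod_cast this
      · rw [div_le_iff₀ (by linarith)]
        nlinarith [Real.pi_pos]
      · rw [div_le_iff₀ (by norm_num)]
        nlinarith [Real.pi_pos]

theorem not_discrete_conj_σ₂_of_le {p : ℕ} (hp : 6 ≤ p) (hp' : p ≤ 19) :
    ¬ IsDiscreteGroup (triangleGroup (2 * Real.pi / p) (conj σ₂)) := by
  have hd := diagEntry_ne_zero (p := p) (by omega)
  obtain ⟨v₀, v₁, v₂, hv, hL⟩ := exists_orbit_coxeterInv (τ := conj σ₂) hd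
  have e : ∀ {c C S : ℝ}, c ^ 2 = c + 1 → coxeterInv C S (c + 2) (3 * c + 2) (-(c - 1)) =
      5 - 2 * c - 2 * (c - 1) * (C + S) := by
    intro c C S hc
    rw [coxeterInv]
    linear_combination (c - 1) * hc
  rw [hasParams_σ₂.conj.normSq, hasParams_σ₂.conj.re, hasParams_σ₂.conj.im,
    e two_turnCos_tenth_sq] at hL
  set C := Real.cos (2 * Real.pi / p)
  set S := Real.sin (2 * Real.pi / p)
  have hn := near_turnCos (x := 1 / 10) 0 0.809017
  have h1 := hn.lower
  have h2 := hn.upper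
  set c := turnCos (1 / 10)
  have hC6 : 1 / 2 ≤ C := by
    have : turnCos (1 / 6) = 1 / 2 := by
      rw [turnCos, show 2 * Real.pi * (1 / 6) = Real.pi / 3 by ring, Real.cos_pi_div_three]
    rw [← this]
    exact turnCos_le_cos (by norm_num) (by exact_mod_cast hp)
  have hS19 : 0.3 ≤ S := by
    have h := turnCos_le_sin (q := 19) (p := p) (by omega) (by exact_mod_cast hp')
    have := (near_turnCos (x := 1 / 4 - 1 / 19) 0 0.324699).lower
    linarith
  have hCS : C + S ≤ 1.4143 := by
    have : C ^ 2 + S ^ 2 = 1 := Real.cos_sq_add_sin_sq _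
    nlinarith [sq_nonneg (C - S)]
  refine not_discrete_of_orbit_jorgensen hv hd hL ?_ ?_ ?_ ?_
  · nlinarith
  · nlinarith
  · linarith
  · -- the two sides agree for an angle between `2π / 17` and `2π / 16`
    rcases le_or_gt p 16 with h16 | h17
    · have hS := turnCos_le_sin (q := 16) (p := p) (by omega) (by exact_mod_cast h16)
      have hC := cos_two_pi_div_le_turnCos (q := 16) (p := p) (by omega) (by exact_mod_cast h16)
      have h3 := (near_turnCos (x := 1 / 4 - 1 / 16) 0 0.382683).lower
      have h4 := (near_turnCos (x := 1 / 16) 0 0.92388).upper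
      have h5 : C ≤ 0.9239 := by linarith
      have h6 : 0.3826 ≤ S := by linarith
      apply ne_of_lt
      nlinarith
    · have hS := sin_le_turnCos (q := 17) (by norm_num) (p := p) (by exact_mod_cast h17)
      have hC := turnCos_le_cos (q := 17) (by norm_num) (p := p) (by exact_mod_cast h17)
      have h3 := (near_turnCos (x := 1 / 4 - 1 / 17) 0 0.361242).upper
      have h4 := (near_turnCos (x := 1 / 17) 0 0.932472).lower
      have h5 : 0.9324 ≤ C := by linarith
      have h6 : S ≤ 0.3613 := by linarith
      apply ne_of_gt
      nlinarith

theorem not_discrete_conj_σ₁_three :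
    ¬ IsDiscreteGroup (triangleGroup (2 * Real.pi / (3 : ℕ)) (conj σ₁)) := by
  have hd := diagEntry_ne_zero (p := 3) (by norm_num)
  obtain ⟨v₀, v₁, v₂, hv, hL⟩ := exists_orbit_conj_two_three (τ := conj σ₁) hd
  obtain ⟨φ, hφ⟩ := exists_galConj_turnCos 24 11 (by norm_num) (by norm_num)
  have e : ∀ C S c : ℝ, 3 * (1 + 2 * 3 * C + 3 ^ 2) + 3 ^ 2 - 2 * 3 * 5 -
      2 * (C * 5 - S * -(2 * c)) = 9 + 8 * C - 4 * (S * c) := by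
    intro C S c
    ring
  rw [hasParams_σ₁.conj.normSq, hasParams_σ₁.conj.re, hasParams_σ₁.conj.im, cos_two_pi_div,
    sin_two_pi_div, e] at hL
  have hC := hφ 8 (x := 1 / (3 : ℕ)) (by norm_num) rfl
  have hS := hφ (-2) (x := 1 / 4 - 1 / (3 : ℕ)) (by norm_num) rfl
  have hc := hφ 3 (x := 1 / 8) (by norm_num) rfl
  have n := (((Near.const 9).add ((Near.const 8).mul
    (near_turnCos (x := 1 / (3 : ℕ)) 1 (-0.5)))).sub ((Near.const 4).mul
      ((near_turnCos (x := 1 / 4 - 1 / (3 : ℕ)) 0 0.866025).mul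
        (near_turnCos (x := 1 / 8) 0 0.707107)))).recenter (r := 2.5505) (ε := 0.01)
  have n' := (((Near.const 9).add ((Near.const 8).mul
    (near_turnCos (x := (11 : ℕ) * (8 : ℤ) / (24 : ℕ)) 7 (-0.5)))).sub ((Near.const 4).mul
      ((near_turnCos (x := (11 : ℕ) * (-2 : ℤ) / (24 : ℕ)) (-2) 0.866025).mul
        (near_turnCos (x := (11 : ℕ) * (3 : ℤ) / (24 : ℕ)) 3 (-0.707107))))).recenter
          (r := 7.4495) (ε := 0.01)
  have h1 := n.lower
  have h2 := n.upper
  have h3 := n'.lower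
  have h4 := (near_turnCos (x := 1 / (3 : ℕ)) 1 (-0.5)).upper
  refine not_discrete_of_orbit_irrational hv hd hL (by linarith) (by linarith) ?_
    (((GalConj.ofNat 9).add ((GalConj.ofNat 8).mul hC)).sub
      ((GalConj.ofNat 4).mul (hS.mul hc))) ?_
  · rw [cos_two_pi_div]
    apply ne_of_lt
    linarith
  · exact lt_of_lt_of_le (by norm_num) h3

/-- The invariant of the vector `R₂ R₃ e₁` is `3 - 2√2 sin ψ`; the last hypothesis separates it from
the excluded value `2 - 2 cos ψ`. -/
theorem not_discrete_conj_σ₁_of_orbit {p : ℕ} (hp : 6 ≤ p) {S₀ : ℝ}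
    (nS : Near (turnCos (1 / 4 - 1 / p)) S₀ 0.00001) (h0 : 0.71 ≤ S₀) (h1 : S₀ ≤ 1)
    {C₀ : ℝ} (nC : Near (turnCos (1 / p)) C₀ 0.00001)
    (h : 2 - 2 * C₀ + 0.001 < 3 - 2 * 1.414214 * S₀ ∨
      3 - 2 * 1.414214 * S₀ + 0.001 < 2 - 2 * C₀) :
    ¬ IsDiscreteGroup (triangleGroup (2 * Real.pi / p) (conj σ₁)) := by
  have hd := diagEntry_ne_zero (p := p) (by omega)
  obtain ⟨v₀, v₁, v₂, hv, hL⟩ := exists_orbit_coxeterInv (τ := conj σ₁) hd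
  have e : ∀ C S c : ℝ, coxeterInv C S 3 5 (-c) = 3 - 2 * S * c := by
    intro C S c
    rw [coxeterInv]
    ring
  rw [hasParams_σ₁.conj.normSq, hasParams_σ₁.conj.re, hasParams_σ₁.conj.im, e,
    sin_two_pi_div] at hL
  have hC6 : 1 / 2 ≤ Real.cos (2 * Real.pi / p) := by
    have : turnCos (1 / 6) = 1 / 2 := by
      rw [turnCos, show 2 * Real.pi * (1 / 6) = Real.pi / 3 by ring, Real.cos_pi_div_three]
    rw [← this]
    exact turnCos_le_cos (by norm_num) (by exact_mod_cast hp)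
  have nI : Near (2 * turnCos (1 / 8)) 1.414214 0.00003 :=
    ((Near.const 2).mul (near_turnCos (x := 1 / 8) 0 0.707107)).recenter
  have n : Near (3 - 2 * turnCos (1 / 4 - 1 / p) * (2 * turnCos (1 / 8)))
      (3 - 2 * S₀ * 1.414214) 0.0005 := by
    have hS2 : Near (2 * turnCos (1 / 4 - 1 / p)) (2 * S₀) 0.00002 :=
      ((Near.const 2).mul nS).mono (by norm_num)
    have hS1 : |2 * S₀| ≤ 2 := by
      rw [abs_le]
      constructor <;> linarith
    exact ((Near.const 3).sub (hS2.mul_of_le nI (η := 0.0004) hS1 (b := 2) (by norm_num)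
      (by norm_num))).mono (by norm_num)
  have h2 := n.lower
  have h3 := n.upper
  have h4 := nC.lower
  have h5 := nC.upper
  refine not_discrete_of_orbit_jorgensen hv hd hL (by linarith) (by linarith) (by linarith) ?_
  rw [cos_two_pi_div]
  rcases h with h | h
  · apply ne_of_gt
    linarith
  · apply ne_of_lt
    linarith

theorem not_discrete_σ₄_four :
    ¬ IsDiscreteGroup (triangleGroup (2 * Real.pi / (4 : ℕ)) σ₄) := by
  have hd := diagEntry_ne_zero (p := 4) (by norm_num)
  obtain ⟨v₀, v₁, v₂, hv, hL⟩ := exists_orbit_three_two (τ := σ₄) hd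
  obtain ⟨φ, hφ⟩ := exists_galConj_turnCos 28 5 (by norm_num) (by norm_num)
  have hcos : Real.cos (2 * Real.pi / (4 : ℕ)) = 0 := by
    rw [show 2 * Real.pi / (4 : ℕ) = Real.pi / 2 by push_cast; ring, Real.cos_pi_div_two]
  have hsin : Real.sin (2 * Real.pi / (4 : ℕ)) = 1 := by
    rw [show 2 * Real.pi / (4 : ℕ) = Real.pi / 2 by push_cast; ring, Real.sin_pi_div_two]
  have e : ∀ I : ℝ, 2 + 2 ^ 2 + 2 * (0 * (5 / 2) + 1 * I) = 6 + 2 * I := by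
    intro I
    ring
  rw [hasParams_σ₄.normSq, hasParams_σ₄.re, hasParams_σ₄.im, hcos, hsin, e] at hL
  have ha := hφ 3 (x := 3 / 28) (by norm_num) rfl
  have hb := hφ 1 (x := 1 / 28) (by norm_num) rfl
  have hc := hφ 9 (x := 9 / 28) (by norm_num) rfl
  have n := ((Near.const 6).add ((Near.const 2).mul
    (((near_turnCos (x := 3 / 28) 0 0.781831).add (near_turnCos (x := 1 / 28) 0 0.974928)).add
      (near_turnCos (x := 9 / 28) 1 (-0.433884))).neg)).recenter (r := 3.354) (ε := 0.01)
  have n' := ((Near.const 6).add ((Near.const 2).mul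
    (((near_turnCos (x := (5 : ℕ) * (3 : ℤ) / (28 : ℕ)) 1 (-0.974928)).add
      (near_turnCos (x := (5 : ℕ) * (1 : ℤ) / (28 : ℕ)) 0 0.433884)).add
      (near_turnCos (x := (5 : ℕ) * (9 : ℤ) / (28 : ℕ)) 3 (-0.781831))).neg)).recenter
        (r := 8.646) (ε := 0.01)
  have h1 := n.lower
  have h2 := n.upper
  have h3 := n'.lower
  refine not_discrete_of_orbit_irrational hv hd hL (by linarith) (by linarith) ?_
    ((GalConj.ofNat 6).add ((GalConj.ofNat 2).mul ((ha.add hb).add hc).neg)) ?_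
  · rw [hcos]
    apply ne_of_gt
    linarith
  · exact lt_of_lt_of_le (by norm_num) h3

theorem not_discrete_conj_σ₅_four :
    ¬ IsDiscreteGroup (triangleGroup (2 * Real.pi / (4 : ℕ)) (conj σ₅)) := by
  have hd := diagEntry_ne_zero (p := 4) (by norm_num)
  obtain ⟨v₀, v₁, v₂, hv, hL⟩ := exists_orbit_three_two (τ := conj σ₅) hd
  obtain ⟨φ, hφ⟩ := exists_galConj_turnCos 60 19 (by norm_num) (by norm_num)
  have hcos : Real.cos (2 * Real.pi / (4 : ℕ)) = 0 := by
    rw [show 2 * Real.pi / (4 : ℕ) = Real.pi / 2 by push_cast; ring, Real.cos_pi_div_two]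
  have hsin : Real.sin (2 * Real.pi / (4 : ℕ)) = 1 := by
    rw [show 2 * Real.pi / (4 : ℕ) = Real.pi / 2 by push_cast; ring, Real.sin_pi_div_two]
  have e : ∀ R I : ℝ, 2 + 2 ^ 2 + 2 * (0 * R + 1 * -I) = 6 - 2 * I := by
    intro R I
    ring
  rw [hasParams_σ₅.conj.normSq, hasParams_σ₅.conj.re, hasParams_σ₅.conj.im, hcos, hsin, e] at hL
  have hh := hφ 5 (x := 1 / 12) (by norm_num) rfl
  have hc := hφ 12 (x := 1 / 5) (by norm_num) rfl
  have n := ((Near.const 6).sub ((Near.const 2).mul ((near_turnCos (x := 1 / 12) 0 0.866025).mul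
    ((Near.const 2).add ((Near.const 2).mul (near_turnCos (x := 1 / 5) 0 0.309017)))))).recenter
      (r := 1.4654) (ε := 0.01)
  have n' := ((Near.const 6).sub ((Near.const 2).mul
    ((near_turnCos (x := (19 : ℕ) * (5 : ℤ) / (60 : ℕ)) 3 (-0.866025)).mul
      ((Near.const 2).add ((Near.const 2).mul
        (near_turnCos (x := (19 : ℕ) * (12 : ℤ) / (60 : ℕ)) 8 0.309017)))))).recenter
      (r := 10.5346) (ε := 0.01)
  have h1 := n.lower
  have h2 := n.upper
  have h3 := n'.lower
  refine not_discrete_of_orbit_irrational hv hd hL (by linarith) (by linarith) ?_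
    ((GalConj.ofNat 6).sub ((GalConj.ofNat 2).mul
      (hh.mul ((GalConj.ofNat 2).add ((GalConj.ofNat 2).mul hc))))) ?_
  · rw [hcos]
    apply ne_of_lt
    linarith
  · exact lt_of_lt_of_le (by norm_num) h3

theorem not_discrete_σ₄_five :
    ¬ IsDiscreteGroup (triangleGroup (2 * Real.pi / (5 : ℕ)) σ₄) := by
  have d := paramApprox_σ₄ (C := turnCos (1 / (5 : ℕ))) (S := turnCos (1 / 4 - 1 / (5 : ℕ)))
    (near_turnCos 0 0.309017) (near_turnCos 0 0.951057) (near_turnCos (x := 3 / 28) 0 0.781831)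
    (near_turnCos (x := 1 / 28) 0 0.974928) (near_turnCos (x := 9 / 28) 1 (-0.433884))
  have hs : Near (2 - 2 * turnCos (1 / (10 : ℕ))) (2 - 2 * 0.809017) 0.0001 :=
    ((Near.const 2).sub ((Near.const 2).mul (near_turnCos 0 0.809017))).mono (by norm_num)
  refine not_discrete_of_line_jorgensen (by norm_num) hasParams_σ₄.normSq hasParams_σ₄.re
    hasParams_σ₄.im (powScalar_of_two _) (j := 9) (o := 10) (by norm_num) (by norm_num)
    (by rw [neg_exp_sq_eq]; norm_num) ?_ ?_ ?_
  · rw [cos_two_pi_div]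
    exact d.ne (by norm_num)
  · rw [cos_two_pi_div, sin_two_pi_div]
    exact d.one_lt_lineInv (by norm_num) (by norm_num)
  · rw [cos_two_pi_div, sin_two_pi_div, cos_two_pi_div]
    exact d.lineInv_lt_one hs (by norm_num [abs_le]) (by norm_num) (by norm_num)

/-! ### Hyperbolicity and discreteness for large orders -/

theorem HasSignatureTwoOne.normSq_mul_det {H : Matrix (Fin 3) (Fin 3) ℂ}
    (h : HasSignatureTwoOne H) : ∃ x : ℝ, 0 ≤ x ∧ (x : ℂ) * H.det = -1 := by
  obtain ⟨P, -, h⟩ := h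
  refine ⟨Complex.normSq P.det, Complex.normSq_nonneg _, ?_⟩
  have h1 := congrArg Matrix.det h
  rw [Matrix.det_mul, Matrix.det_mul, Matrix.det_conjTranspose, Matrix.det_diagonal] at h1
  simp [Fin.prod_univ_three] at h1
  rw [← h1, Complex.normSq_eq_conj_mul_self]
  ring

/-- The determinant of the form, up to a positive factor, is negative for a hyperbolic group. -/
theorem IsHyperbolicTriangleGroup.det_neg {τ : ℂ} {t R I : ℝ} (hτ : HasParams τ t R I) {p : ℕ}
    (hp : 2 ≤ p) (h : IsHyperbolicTriangleGroup (2 * Real.pi / p) τ) :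
    (2 - 2 * Real.cos (2 * Real.pi / p)) * (2 - 2 * Real.cos (2 * Real.pi / p) - 3 * t + R) <
      2 * Real.sin (2 * Real.pi / p) * I := by
  obtain ⟨x, hx, hdet⟩ := h.normSq_mul_det
  have hd : 0 < diagEntry (2 * Real.pi / p) := by
    refine lt_of_le_of_ne ?_ (diagEntry_ne_zero hp).symm
    have hp' : (2 : ℝ) ≤ p := by exact_mod_cast hp
    rw [diagEntry, show 2 * Real.pi / p / 2 = Real.pi / p by ring]
    have : 0 ≤ Real.sin (Real.pi / p) := by
      apply Real.sin_nonneg_of_nonneg_of_le_pi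
      · positivity
      · rw [div_le_iff₀ (by linarith)]
        nlinarith [Real.pi_pos]
    positivity
  rw [formDet_eq_det] at hdet
  have h1 := formDet_mul_diagEntry (2 * Real.pi / p) τ
  rw [hτ.normSq, hτ.re, hτ.im] at h1
  set E := (2 - 2 * Real.cos (2 * Real.pi / p)) ^ 2 - 3 * (2 - 2 * Real.cos (2 * Real.pi / p)) * t +
    (2 - 2 * Real.cos (2 * Real.pi / p)) * R - 2 * Real.sin (2 * Real.pi / p) * I with hE
  have h2 : x * E = -diagEntry (2 * Real.pi / p) := by
    have h3 : (x : ℂ) * (E : ℝ) = -(diagEntry (2 * Real.pi / p) : ℝ) := by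
      rw [← h1, ← mul_assoc, hdet, neg_one_mul]
    exact_mod_cast h3
  have h4 : E < 0 := by
    by_contra hcon
    have := mul_nonneg hx (not_lt.1 hcon)
    linarith
  linarith

open Filter Topology in
theorem tendsto_two_pi_div : Tendsto (fun p : ℕ => 2 * Real.pi / (p : ℝ)) atTop (𝓝 0) :=
  tendsto_const_div_atTop_nhds_zero_nat _

open Filter Topology in
/-- For small angles `ψ`, the sign of the determinant of the form is the one of `-Im τ³`, since
`2 - 2 cos ψ` is negligible compared to `sin ψ`. -/
theorem eventually_abs_lt (t R : ℝ) {I : ℝ} (hI : I ≠ 0) : ∀ᶠ p : ℕ in atTop,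
    |(2 - 2 * Real.cos (2 * Real.pi / p)) * (2 - 2 * Real.cos (2 * Real.pi / p) - 3 * t + R)| <
      2 * Real.sin (2 * Real.pi / p) * |I| := by
  have hM : 0 < 4 + 3 * |t| + |R| := by positivity
  have hsmall : ∀ᶠ p : ℕ in atTop, 2 * Real.pi / (p : ℝ) < |I| / (4 + 3 * |t| + |R|) :=
    tendsto_two_pi_div.eventually_lt_const (by positivity)
  filter_upwards [hsmall, eventually_ge_atTop 4] with p hp hp4
  have hS := sin_two_pi_div_pos hp4
  have hC : 0 ≤ Real.cos (2 * Real.pi / p) := by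
    have h4 : turnCos (1 / 4) ≤ Real.cos (2 * Real.pi / p) :=
      turnCos_le_cos (by norm_num) (by exact_mod_cast hp4)
    rwa [turnCos, show 2 * Real.pi * (1 / 4) = Real.pi / 2 by ring, Real.cos_pi_div_two] at h4
  have hpos : 0 ≤ 2 * Real.pi / (p : ℝ) := by positivity
  have hSle := Real.sin_le hpos
  have hsc := Real.sin_sq_add_cos_sq (2 * Real.pi / p)
  have hC1 := Real.cos_le_one (2 * Real.pi / p)
  set C := Real.cos (2 * Real.pi / p)
  set S := Real.sin (2 * Real.pi / p)
  have h1 : 2 - 2 * C ≤ 2 * S ^ 2 := by nlinarith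
  have h2 : |2 - 2 * C - 3 * t + R| ≤ 4 + 3 * |t| + |R| := by
    rw [abs_le]
    have := abs_le.1 (le_refl |t|)
    have := abs_le.1 (le_refl |R|)
    constructor <;> linarith
  rw [lt_div_iff₀ hM] at hp
  rw [abs_mul, abs_of_nonneg (by linarith)]
  calc (2 - 2 * C) * |2 - 2 * C - 3 * t + R| ≤ 2 * S ^ 2 * (4 + 3 * |t| + |R|) :=
        mul_le_mul h1 h2 (abs_nonneg _) (by positivity)
    _ = 2 * S * (S * (4 + 3 * |t| + |R|)) := by ring
    _ < 2 * S * |I| := by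
        refine mul_lt_mul_of_pos_left (lt_of_le_of_lt ?_ hp) (by positivity)
        exact mul_le_mul_of_nonneg_right hSle hM.le

open Filter Topology in
theorem tendsto_lineInv {t : ℝ} (ht : t ≠ 0) (R I : ℝ) : Tendsto (fun p : ℕ =>
    lineInv (Real.cos (2 * Real.pi / p)) (Real.sin (2 * Real.pi / p)) t R I) atTop (𝓝 1) := by
  have h : ContinuousAt (fun x : ℝ => lineInv (Real.cos x) (Real.sin x) t R I) 0 := by
    unfold lineInv
    apply ContinuousAt.div
    · fun_prop
    · fun_prop
    · simpa using ht
  have h1 := h.tendsto.comp tendsto_two_pi_div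
  simpa [lineInv, ht, Function.comp_def] using h1

theorem HasParams.im_eq_zero {τ : ℂ} {R I : ℝ} (h : HasParams τ 0 R I) : I = 0 := by
  have := Complex.normSq_eq_zero.1 h.normSq
  rw [← h.im, this]
  simp

open Filter in
/-- If `Im τ³ < 0`, the group is hyperbolic for finitely many `p`. -/
theorem eventually_not_hyperbolic {τ : ℂ} {t R I : ℝ} (hτ : HasParams τ t R I) (hI : I < 0) :
    ∀ᶠ p : ℕ in atTop, ¬ IsHyperbolicTriangleGroup (2 * Real.pi / p) τ := by
  filter_upwards [eventually_abs_lt t R hI.ne, eventually_ge_atTop 2] with p hp hp2 hhyp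
  have h1 := hhyp.det_neg hτ hp2
  have h2 := (abs_lt.1 hp).1
  rw [abs_of_neg hI] at h2
  linarith

open Filter Topology in
/-- If `Im τ³ > 0` and a power of `R₁ R₂` is a complex reflection of order at least `p / 8`, the
group is discrete for finitely many `p`. -/
theorem eventually_not_discrete {τ : ℂ} {t R I : ℝ} (hτ : HasParams τ t R I) (hI : 0 < I) {n : ℕ}
    {κ : ℂ → ℂ} (hn : ∀ ζ, PowScalar ζ (2 - t) (κ ζ) n)
    (hκ : ∀ p : ℕ, 0 < p → ∃ j o : ℕ, j.Coprime o ∧ p ≤ 8 * o ∧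
      κ (Complex.exp (Complex.I * ((2 * Real.pi / p : ℝ) : ℂ))) =
        Complex.exp (Complex.I * ((2 * Real.pi * (j / o) : ℝ) : ℂ))) :
    ∀ᶠ p : ℕ in atTop, ¬ IsDiscreteGroup (triangleGroup (2 * Real.pi / p) τ) := by
  have ht : t ≠ 0 := by
    rintro rfl
    exact hI.ne' hτ.im_eq_zero
  have hcos : Tendsto (fun p : ℕ => 2 - 2 * Real.cos (2 * Real.pi / p)) atTop (𝓝 0) := by
    have h : ContinuousAt (fun x : ℝ => 2 - 2 * Real.cos x) 0 := by fun_prop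
    have h1 := h.tendsto.comp tendsto_two_pi_div
    simpa [Function.comp_def] using h1
  filter_upwards [eventually_abs_lt t R hI.ne', eventually_ge_atTop 200,
    (tendsto_lineInv ht R I).eventually_lt_const one_lt_two, hcos.eventually_ne ht.symm]
    with p hp hp2 hlt hne
  obtain ⟨j, o, hjo, hpo, hκp⟩ := hκ p (by omega)
  have h1 : 1 < lineInv (Real.cos (2 * Real.pi / p)) (Real.sin (2 * Real.pi / p)) t R I := by
    have hpos : 0 < (t - (2 - 2 * Real.cos (2 * Real.pi / p))) ^ 2 := by
      have := sub_ne_zero.2 hne.symm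
      positivity
    have h2 := (abs_lt.1 hp).2
    rw [abs_of_pos hI] at h2
    rw [lineInv, lt_div_iff₀ hpos]
    nlinarith
  refine not_discrete_of_line_jorgensen (by omega) hτ.normSq hτ.re hτ.im (hn _) (by omega) hjo hκp
    hne.symm h1 ?_
  have h3 := Real.one_sub_sq_div_two_le_cos (x := 2 * Real.pi / o)
  have ho : (25 : ℝ) ≤ o := by
    have : 25 ≤ o := by omega
    exact_mod_cast this
  have h4 : 2 * Real.pi / o ≤ 0.3 := by
    rw [div_le_iff₀ (by linarith)]
    linarith [Real.pi_lt_d2]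
  have h5 : 0 ≤ 2 * Real.pi / o := by positivity
  nlinarith

/-- The set of the `p` for which the group is hyperbolic and discrete. -/
def hyperbolicDiscreteOrders (τ : ℂ) : Set ℕ :=
  {p | 2 ≤ p ∧ IsHyperbolicTriangleGroup (2 * Real.pi / p) τ ∧
    IsDiscreteGroup (triangleGroup (2 * Real.pi / p) τ)}

open Filter in
theorem finite_of_eventually_not {P : ℕ → Prop} (h : ∀ᶠ p in atTop, ¬ P p) : {p | P p}.Finite := by
  obtain ⟨N, hN⟩ := eventually_atTop.1 h
  refine (Set.finite_lt_nat N).subset fun p hp => ?_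
  by_contra hcon
  exact hN p (not_lt.1 hcon) hp

theorem finite_hyperbolicDiscreteOrders {τ : ℂ} {t R I : ℝ} (hτ : HasParams τ t R I) (hI : I ≠ 0)
    {n : ℕ} {κ : ℂ → ℂ} (hn : ∀ ζ, PowScalar ζ (2 - t) (κ ζ) n)
    (hκ : ∀ p : ℕ, 0 < p → ∃ j o : ℕ, j.Coprime o ∧ p ≤ 8 * o ∧
      κ (Complex.exp (Complex.I * ((2 * Real.pi / p : ℝ) : ℂ))) =
        Complex.exp (Complex.I * ((2 * Real.pi * (j / o) : ℝ) : ℂ))) :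
    (hyperbolicDiscreteOrders τ).Finite := by
  rcases hI.lt_or_gt with h | h
  · exact (finite_of_eventually_not (eventually_not_hyperbolic hτ h)).subset fun p hp => hp.2.1
  · exact (finite_of_eventually_not (eventually_not_discrete hτ h hn hκ)).subset
      fun p hp => hp.2.2

theorem exists_coprime_div (a : ℕ) {b : ℕ} (hb : 0 < b) : ∃ j o : ℕ, j.Coprime o ∧
    b = a.gcd b * o ∧ (a / b : ℝ) = j / o := by
  have hg : 0 < a.gcd b := Nat.gcd_pos_of_pos_right a hb
  refine ⟨a / a.gcd b, b / a.gcd b, Nat.coprime_div_gcd_div_gcd hg,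
    (Nat.mul_div_cancel' (Nat.gcd_dvd_right a b)).symm, ?_⟩
  rw [Nat.cast_div (Nat.gcd_dvd_left a b) (by exact_mod_cast hg.ne'),
    Nat.cast_div (Nat.gcd_dvd_right a b) (by exact_mod_cast hg.ne')]
  have : (a.gcd b : ℝ) ≠ 0 := by exact_mod_cast hg.ne'
  have : (b : ℝ) ≠ 0 := by exact_mod_cast hb.ne'
  field_simp

theorem exists_order_pow {n : ℕ} (hn0 : 0 < n) (hn : n ≤ 8) (p : ℕ) (hp : 0 < p) :
    ∃ j o : ℕ, j.Coprime o ∧ p ≤ 8 * o ∧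
      Complex.exp (Complex.I * ((2 * Real.pi / p : ℝ) : ℂ)) ^ n =
        Complex.exp (Complex.I * ((2 * Real.pi * (j / o) : ℝ) : ℂ)) := by
  obtain ⟨j, o, h1, h2, h3⟩ := exists_coprime_div n hp
  refine ⟨j, o, h1, ?_, by rw [exp_pow_eq, h3]⟩
  have : n.gcd p ≤ 8 := (Nat.gcd_le_left p hn0).trans hn
  calc p = n.gcd p * o := h2
    _ ≤ 8 * o := Nat.mul_le_mul_right o this

theorem exists_order_neg_sq (p : ℕ) (hp : 0 < p) :
    ∃ j o : ℕ, j.Coprime o ∧ p ≤ 8 * o ∧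
      -Complex.exp (Complex.I * ((2 * Real.pi / p : ℝ) : ℂ)) ^ 2 =
        Complex.exp (Complex.I * ((2 * Real.pi * (j / o) : ℝ) : ℂ)) := by
  obtain ⟨j, o, h1, h2, h3⟩ := exists_coprime_div (p + 4) (b := 2 * p) (by omega)
  have hp0 : (p : ℝ) ≠ 0 := by exact_mod_cast hp.ne'
  refine ⟨j, o, h1, ?_, ?_⟩
  · have h4 : (p + 4).gcd (2 * p) ∣ 8 := by
      have h5 := (Nat.gcd_dvd_left (p + 4) (2 * p)).mul_left 2
      have h6 := Nat.dvd_sub h5 (Nat.gcd_dvd_right (p + 4) (2 * p))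
      rwa [show 2 * (p + 4) - 2 * p = 8 by omega] at h6
    have h7 : (p + 4).gcd (2 * p) ≤ 8 := Nat.le_of_dvd (by norm_num) h4
    calc p ≤ 2 * p := by omega
      _ = (p + 4).gcd (2 * p) * o := h2
      _ ≤ 8 * o := Nat.mul_le_mul_right o h7
  · rw [neg_exp_sq_eq, ← h3,
      show (1 / 2 + 2 / p : ℝ) = ((p + 4 : ℕ) : ℝ) / ((2 * p : ℕ) : ℝ) by
        push_cast
        field_simp
        ring]

/-! ### The finiteness for the sporadic values -/

theorem HasParams.im_ne_zero {τ : ℂ} {t R I : ℝ} (h : HasParams τ t R I) (hR : R ^ 2 ≠ t ^ 3) :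
    I ≠ 0 := by
  rintro rfl
  have h1 : Complex.normSq (τ ^ 3) = t ^ 3 := by rw [map_pow, h.normSq]
  rw [Complex.normSq_apply, h.re, h.im] at h1
  apply hR
  linarith

theorem turnCos_twelfth_ne_zero : turnCos (1 / 12) ≠ 0 := by
  intro h
  have := turnCos_twelfth_sq
  rw [h] at this
  norm_num at this

theorem finite_pair_of_seventh {τ : ℂ} {c : ℝ} (hc : c ^ 3 + c ^ 2 - 2 * c - 1 = 0)
    (hτ : HasParams τ (1 + c + c ^ 2) (-(1 - c ^ 3) / 2 + 3 * c / 2 + 3 * c ^ 2)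
      (turnCos (1 / 12) * (1 - c ^ 3 + 3 * c))) :
    (hyperbolicDiscreteOrders τ).Finite ∧ (hyperbolicDiscreteOrders (conj τ)).Finite := by
  have hI : turnCos (1 / 12) * (1 - c ^ 3 + 3 * c) ≠ 0 := by
    rw [show 1 - c ^ 3 + 3 * c = c * (c + 1) by linear_combination -hc]
    refine mul_ne_zero turnCos_twelfth_ne_zero (mul_ne_zero ?_ ?_)
    · rintro rfl
      norm_num at hc
    · intro h
      rw [show c = -1 by linarith] at hc
      norm_num at hc
  exact ⟨finite_hyperbolicDiscreteOrders hτ hI (fun ζ => powScalar_of_seventh ζ hc)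
      (exists_order_pow (by norm_num) (by norm_num)),
    finite_hyperbolicDiscreteOrders hτ.conj (neg_ne_zero.2 hI)
      (fun ζ => powScalar_of_seventh ζ hc) (exists_order_pow (by norm_num) (by norm_num))⟩

theorem finite_pair_of_normSq_two {τ : ℂ} {R I : ℝ} (hτ : HasParams τ 2 R I) (hI : I ≠ 0) :
    (hyperbolicDiscreteOrders τ).Finite ∧ (hyperbolicDiscreteOrders (conj τ)).Finite :=
  ⟨finite_hyperbolicDiscreteOrders hτ hI powScalar_of_two exists_order_neg_sq,
    finite_hyperbolicDiscreteOrders hτ.conj (neg_ne_zero.2 hI) powScalar_of_two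
      exists_order_neg_sq⟩

theorem finite_pair_sporadic {τ : ℂ} (h : τ ∈ ({σ₁, σ₂, σ₃, σ₄, σ₅, σ₆, σ₇, σ₈, σ₉} : Set ℂ)) :
    (hyperbolicDiscreteOrders τ).Finite ∧ (hyperbolicDiscreteOrders (conj τ)).Finite := by
  have ninth : ∀ {c : ℝ}, c ^ 2 + c = 1 → turnCos (1 / 12) * (2 + c) ≠ 0 := by
    intro c hc
    refine mul_ne_zero turnCos_twelfth_ne_zero fun h => ?_
    rw [show c = -2 by linarith] at hc
    norm_num at hc
  simp only [Set.mem_insert_iff, Set.mem_singleton_iff] at h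
  rcases h with rfl | rfl | rfl | rfl | rfl | rfl | rfl | rfl | rfl
  · have hI := hasParams_σ₁.im_ne_zero (by norm_num)
    exact ⟨finite_hyperbolicDiscreteOrders hasParams_σ₁ hI powScalar_of_three
        (exists_order_pow (by norm_num) (by norm_num)),
      finite_hyperbolicDiscreteOrders hasParams_σ₁.conj (neg_ne_zero.2 hI) powScalar_of_three
        (exists_order_pow (by norm_num) (by norm_num))⟩
  · have hI : 2 * turnCos (1 / 10) - 1 ≠ 0 := by
      intro h
      have h1 := two_turnCos_tenth_sq
      rw [show 2 * turnCos (1 / 10) = 1 by linarith] at h1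
      norm_num at h1
    exact ⟨finite_hyperbolicDiscreteOrders hasParams_σ₂ hI powScalar_of_fifth_sixth
        (exists_order_pow (by norm_num) (by norm_num)),
      finite_hyperbolicDiscreteOrders hasParams_σ₂.conj (neg_ne_zero.2 hI)
        powScalar_of_fifth_sixth (exists_order_pow (by norm_num) (by norm_num))⟩
  · have hI : 2 * turnCos (1 / 5) + 1 ≠ 0 := by
      intro h
      have h1 := two_turnCos_fifth_sq
      rw [show 2 * turnCos (1 / 5) = -1 by linarith] at h1
      norm_num at h1
    exact ⟨finite_hyperbolicDiscreteOrders hasParams_σ₃ hI powScalar_of_two_fifths_sixth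
        (exists_order_pow (by norm_num) (by norm_num)),
      finite_hyperbolicDiscreteOrders hasParams_σ₃.conj (neg_ne_zero.2 hI)
        powScalar_of_two_fifths_sixth (exists_order_pow (by norm_num) (by norm_num))⟩
  · exact finite_pair_of_normSq_two hasParams_σ₄ (hasParams_σ₄.im_ne_zero (by norm_num))
  · exact finite_pair_of_normSq_two hasParams_σ₅ (ninth two_turnCos_fifth_sq)
  · exact finite_pair_of_normSq_two hasParams_σ₆ (ninth two_turnCos_two_fifths_sq)
  · exact finite_pair_of_seventh two_turnCos_one_seventh_pow_three hasParams_σ₇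
  · refine finite_pair_of_seventh ?_ hasParams_σ₈
    exact_mod_cast two_turnCos_seventh_pow_three (k := 2) (by norm_num) (by norm_num)
  · refine finite_pair_of_seventh ?_ hasParams_σ₉
    exact_mod_cast two_turnCos_seventh_pow_three (k := 3) (by norm_num) (by norm_num)

theorem finite_sporadicValues : sporadicValues.Finite := by
  have h : ({σ₁, σ₂, σ₃, σ₄, σ₅, σ₆, σ₇, σ₈, σ₉} : Set ℂ).Finite := Set.toFinite _
  exact h.union (h.preimage (starRingEnd ℂ).injective.injOn)

theorem finite_sporadic : {x : ℕ × ℂ | 2 ≤ x.1 ∧ x.2 ∈ sporadicValues ∧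
    IsHyperbolicTriangleGroup (2 * Real.pi / x.1) x.2 ∧
    IsDiscreteGroup (triangleGroup (2 * Real.pi / x.1) x.2)}.Finite := by
  have key : ∀ τ ∈ sporadicValues, (hyperbolicDiscreteOrders τ).Finite := by
    rintro τ (h | h)
    · exact (finite_pair_sporadic h).1
    · simpa using (finite_pair_sporadic h).2
  refine (finite_sporadicValues.biUnion fun τ hτ => (key τ hτ).image fun p => (p, τ)).subset ?_
  rintro ⟨p, τ⟩ ⟨h1, h2, h3, h4⟩
  exact Set.mem_biUnion h2 ⟨p, ⟨h1, h3, h4⟩, rfl⟩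

theorem theorem8p1 :
    {x : ℕ × ℂ | 2 ≤ x.1 ∧ x.2 ∈ sporadicValues ∧
        IsHyperbolicTriangleGroup (2 * Real.pi / x.1) x.2 ∧
        IsDiscreteGroup (triangleGroup (2 * Real.pi / x.1) x.2)}.Finite ∧
    (∀ p : ℕ, 7 ≤ p → ¬ IsDiscreteGroup (triangleGroup (2 * Real.pi / p) σ₁)) ∧
    (∀ p : ℕ, p ∈ ({3, 5, 6, 7} : Set ℕ) →
      ¬ IsDiscreteGroup (triangleGroup (2 * Real.pi / p) (conj σ₁))) ∧
    (∀ p : ℕ, 6 ≤ p → ¬ IsDiscreteGroup (triangleGroup (2 * Real.pi / p) σ₂)) ∧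
    (∀ p : ℕ, 6 ≤ p → p ≤ 19 →
      ¬ IsDiscreteGroup (triangleGroup (2 * Real.pi / p) (conj σ₂))) ∧
    (∀ p : ℕ, p ∈ ({4, 5, 6} : Set ℕ) →
      ¬ IsDiscreteGroup (triangleGroup (2 * Real.pi / p) σ₄)) ∧
    (∀ p : ℕ, 2 ≤ p → p ∉ ({2, 3, 4, 5, 6, 8, 12} : Set ℕ) →
      ¬ IsDiscreteGroup (triangleGroup (2 * Real.pi / p) (conj σ₄))) ∧
    (∀ p : ℕ, 2 ≤ p → p ∉ ({2, 3, 4, 5, 6, 8, 12} : Set ℕ) →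
      ¬ IsDiscreteGroup (triangleGroup (2 * Real.pi / p) σ₅)) ∧
    ¬ IsDiscreteGroup (triangleGroup (2 * Real.pi / 4) (conj σ₅)) ∧
    (¬ IsDiscreteGroup (triangleGroup (2 * Real.pi / 5) σ₆) ∧
      ¬ IsDiscreteGroup (triangleGroup (2 * Real.pi / 5) (conj σ₆))) ∧
    (∀ p : ℕ, 2 ≤ p → p ∉ ({2, 3, 4, 7, 14} : Set ℕ) →
      ¬ IsDiscreteGroup (triangleGroup (2 * Real.pi / p) σ₇)) := by
  refine ⟨finite_sporadic, fun p hp => ?_, fun p hp => ?_, fun p => not_discrete_σ₂_of_le,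
    fun p => not_discrete_conj_σ₂_of_le, fun p hp => ?_, fun p hp2 hp => ?_, fun p hp2 hp => ?_,
    mod_cast not_discrete_conj_σ₅_four,
    ⟨mod_cast not_discrete_σ₆_five, mod_cast not_discrete_conj_σ₆_five⟩,
    fun p hp2 hp => ?_⟩
  · by_cases h9 : p = 9
    · subst h9
      exact not_discrete_σ₁_nine
    · exact not_discrete_σ₁_of_le hp h9
  · simp only [Set.mem_insert_iff, Set.mem_singleton_iff] at hp
    rcases hp with rfl | rfl | rfl | rfl
    · exact not_discrete_conj_σ₁_three
    · exact not_discrete_conj_σ₁_five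
    · exact not_discrete_conj_σ₁_of_orbit (p := 6) le_rfl (near_turnCos 0 0.866025)
        (by norm_num) (by norm_num) (near_turnCos 0 0.5) (Or.inr (by norm_num))
    · exact not_discrete_conj_σ₁_of_orbit (p := 7) (by norm_num) (near_turnCos 0 0.781831)
        (by norm_num) (by norm_num) (near_turnCos 0 0.62349) (Or.inl (by norm_num))
  · simp only [Set.mem_insert_iff, Set.mem_singleton_iff] at hp
    rcases hp with rfl | rfl | rfl
    · exact not_discrete_σ₄_four
    · exact not_discrete_σ₄_five
    · exact not_discrete_σ₄_six
  · simp only [Set.mem_insert_iff, Set.mem_singleton_iff, not_or] at hp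
    exact not_discrete_conj_σ₄_of_le (by omega) (by omega) (by omega)
  · simp only [Set.mem_insert_iff, Set.mem_singleton_iff, not_or] at hp
    exact not_discrete_σ₅_of_le (by omega) (by omega) (by omega)
  · simp only [Set.mem_insert_iff, Set.mem_singleton_iff, not_or] at hp
    exact not_discrete_σ₇_of_le (by omega) (by omega) (by omega)
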